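/- **Setting.** Let $R^a=\mathbb Z[A^{\pm1},z_1,z_2,\dots]$ and $z_0=-A^2-A^{-2}\in R^a$. For $n\ge1$ order the set $V_n=\{0,1\}\times\{1,\dots,n\}$ by $(0,1)<\dots<(0,n)<(1,n)<\dots<(1,1)$. A *flat virtual $n$-tangle* $E$ is a partition of $V_n$ into pairs. An *arrow flat $n$-tangle* is a pair $F=(E,f)$ with $f:E\to\mathbb Z$ such that, for $\alpha=\{(a,b),(c,d)\}\in E$, $f(\alpha)$ is odd if $a=c$ and even if $a\ne c$. Put $\varpi(\alpha)=-1$ if $a=c$ and $\varpi(\alpha)=1$ if $a\neq c$. For a walk traversing successively pairs $\alpha_1,\dots,\alpha_\ell$, where $\alpha_i$ is traversed from $x_i$ to $y_i$, define its weight $\sum_{i=1}^{\ell}\varpi^c_i f(\alpha_i)$, where $\varpi^c_i=\prod_{j<i}\varpi(\alpha_j)$ if $x_i<y_i$ and $\varpi_i^c=\prod_{j\le i}\varpi(\alpha_j)$ if $y_i<x_i$. **The algebras.** Let $\mathrm{ATL}_n(R^a)$ be the free $R^a$-module on the arrow flat $n$-tangles. Given $F=(E,f)$ and $F'=(E',f')$,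 glue each point $(1,b)$ of $E$ to the point $(0,b)$ of $E'$. The $n$ arcs so obtained join the remaining points in pairs, and form an arrow flat $n$-tangle $F*F'$, each pair being labeled by the weight of its arc, traversed from its smaller to its larger end. One also obtains closed cycles $\gamma_1,\dots,\gamma_m$; the weight $h(\gamma)$ of a cycle is computed by starting at the point $(1,b_0)$ of $E$ with $b_0$ the smallest column met by the cycle at the glued points, and traversing first the pair of $E$ containing that point; its zigzag number is $\zeta(\gamma)=|h(\gamma)|/2$. The bilinear product is defined by $FF'=z_{\zeta(\gamma_1)}\cdots z_{\zeta(\gamma_m)}\,(F*F')$. The unit is the tangle with pairs $\{(0,i),(1,i)\}$ labeled $0$. Let $\mathrm{ATL}_n(R^a)\to\mathrm{ATL}_{n+1}(R^a)$ be the linear map that adds to each tangle the pair $\{(0,n+1),(1,n+1)\}$ with label $0$. For $1\le i\le n-1$ let $F_i$ be the tangle with the pairs $\{(0,i),(0,i+1)\}$ and $\{(1,i),(1,i+1)\}$, both labeled $1$, and $\{(0,k),(1,k)\}$ labeled $0$ for $k\ne i,i+1$; let $w_i$ be the tangle with the pairs $\{(0,i),(1,i+1)\}$, $\{(0,i+1),(1,i)\}$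 and $\{(0,k),(1,k)\}$ for $k\ne i,i+1$, all labeled $0$. **The linear forms.** For $F=(E,f)$ glue $(0,b)$ to $(1,b)$ for every $b$. Let $\gamma_1,\dots,\gamma_m$ be the cycles of this closure of $E$; put $\zeta(\gamma)=|h(\gamma)|/2$, where $h(\gamma)$ is the weight of $\gamma$ traversed starting at $(0,b_0)$, along the pair of $E$ containing it, with $b_0$ the smallest column met by $\gamma$. Let $T_n'^a:\mathrm{ATL}_n(R^a)\to R^a$ be the linear form with $T_n'^a(F)=z_{\zeta(\gamma_1)}\cdots z_{\zeta(\gamma_m)}$. **Theorem 3.5.** With these products and embeddings, $\{\mathrm{ATL}_n(R^a)\}_{n\ge1}$ is a tower of associative unital $R^a$-algebras. There are algebra homomorphisms $\rho_n:R^a[\mathrm{VB}_n]\to\mathrm{ATL}_n(R^a)$, $n\ge1$, compatible with the inclusions $\mathrm{VB}_n\to\mathrm{VB}_{n+1}$ of virtual braid groups and the embeddings of the tower, with $\rho_n(\sigma_i)=S_i:=-A^{-2}\,1-A^{-4}F_i$ and $\rho_n(\tau_i)=w_i$ for $1\le i\le n-1$, where $\mathrm{VB}_n$ is the group with generators $\sigma_1,\dots,\sigma_{n-1},\tau_1,\dots,\tau_{n-1}$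 and relations $\tau_i^2=1$; $\sigma_i\sigma_j=\sigma_j\sigma_i$, $\tau_i\tau_j=\tau_j\tau_i$, $\tau_i\sigma_j=\sigma_j\tau_i$ for $|i-j|\ge2$; $\sigma_i\sigma_j\sigma_i=\sigma_j\sigma_i\sigma_j$, $\tau_i\tau_j\tau_i=\tau_j\tau_i\tau_j$, $\tau_i\tau_j\sigma_i=\sigma_j\tau_i\tau_j$ for $|i-j|=1$. With respect to them the sequence $\{T_n'^a\}_{n\ge1}$ is a Markov trace, that is: (a) $T_n'^a(xy)=T_n'^a(yx)$ for all $n\ge1$ and $x,y\in\mathrm{ATL}_n(R^a)$; (b) $T_n'^a(x)=T_{n+1}'^a(xS_n)=T_{n+1}'^a(xS_n^{-1})=T_{n+1}'^a(xw_n)$ for all $n\ge1$ and $x\in\mathrm{ATL}_n(R^a)$; (c) $T_n'^a(x)=T_{n+1}'^a(xS_n^{-1}w_{n-1}S_n)$ for all $n\ge2$ and $x\in\mathrm{ATL}_n(R^a)$; (d) $T_n'^a(x)=T_{n+1}'^a(xw_nw_{n-1}S_{n-1}w_nS_{n-1}^{-1}w_{n-1}w_n)$ for all $n\ge2$ and $x\in\mathrm{ATL}_n(R^a)$.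 -/

import Mathlib

open Finset

noncomputable section

namespace ArrowTL

/-! ## The coefficient ring `R^a = ℤ[A^{±1}, z₁, z₂, …]` -/

/-- Polynomials in `z₁, z₂, …` over the Laurent polynomials in `A` with integer coefficients. -/
abbrev Ra : Type := MvPolynomial ℕ+ (LaurentPolynomial ℤ)

/-- The power `A ^ k` in `R^a`. -/
def Apow (k : ℤ) : Ra := MvPolynomial.C (LaurentPolynomial.T k)

/-- The elements `z₀ = -A² - A⁻²` and `z₁, z₂, …` (the variables) of `R^a`. -/
def z : ℕ → Ra
  | 0 => -Apow 2 - Apow (-2)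
  | k + 1 => MvPolynomial.X k.succPNat

/-! ## Arrow flat tangles -/

/-- The `2n` end points `{0,1} × {1,…,n}`. The row `0` is `false`, the row `1` is `true`, and the
columns are numbered from `0`. -/
abbrev Vertex (n : ℕ) : Type := Bool × Fin n

/-- The position of a vertex in the order
`(0,1) < (0,2) < ⋯ < (0,n) < (1,n) < ⋯ < (1,2) < (1,1)`. -/
def rank {n : ℕ} (v : Vertex n) : ℕ := if v.1 then 2 * n - 1 - v.2 else v.2

/-- A flat virtual `n`-tangle: a partition of the vertices into pairs, given by the map that sends
each vertex to the other element of its pair. -/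
structure FlatTangle (n : ℕ) where
  mate : Vertex n → Vertex n
  mate_mate : ∀ v, mate (mate v) = v
  mate_ne : ∀ v, mate v ≠ v

/-- An arrow flat `n`-tangle: a flat virtual `n`-tangle together with an integer label on each pair
(a function on the vertices that is constant on pairs), odd if both ends of the pair are in the same
row and even otherwise. -/
@[ext]
structure ArrowTangle (n : ℕ) extends FlatTangle n where
  label : Vertex n → ℤ
  label_mate : ∀ v, label (mate v) = label v
  label_odd : ∀ v, Odd (label v) ↔ (mate v).1 = v.1

/-! ## Cumulated parities along a walk -/

/-- A family of labeled pairs of points; each point has a row, and the two points of a pair are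
compared through their ranks. -/
structure Diagram (X : Type) where
  mate : X → X
  label : X → ℤ
  row : X → Bool
  rank : X → ℕ

namespace Diagram

variable {X : Type}

/-- The parity of the pair of `x`: `-1` if both ends are in the same row, `1` otherwise. -/
def parity (D : Diagram X) (x : X) : ℤ := if D.row (D.mate x) = D.row x then -1 else 1

/-- Let a walk traverse successively the pairs `{x 0, mate (x 0)}`, `{x 1, mate (x 1)}`, …, each from
`x i` to `mate (x i)`. This is the cumulated parity of its pair number `i`: the product of the
parities of the preceding pairs, times its own parity if it is traversed against the order. -/
def cumParity (D : Diagram X) (x : ℕ → X) (i : ℕ) : ℤ :=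
  if D.rank (x i) < D.rank (D.mate (x i)) then ∏ j ∈ range i, D.parity (x j)
  else ∏ j ∈ range (i + 1), D.parity (x j)

/-- The sum of the labels of the first `ℓ` pairs of a walk, weighted by the cumulated parities. -/
def weight (D : Diagram X) (x : ℕ → X) (ℓ : ℕ) : ℤ :=
  ∑ i ∈ range ℓ, D.cumParity x i * D.label (x i)

lemma cumParity_odd (D : Diagram X) (x : ℕ → X) (i : ℕ) : Odd (D.cumParity x i) := by
  have h : ∀ k, Odd (∏ j ∈ range k, D.parity (x j)) := by
    intro k
    refine Finset.prod_induction _ (fun a : ℤ => Odd a) (fun _ _ => Odd.mul) odd_one ?_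
    intro j _
    unfold parity
    split_ifs <;> decide
  unfold cumParity
  split_ifs <;> exact h _

end Diagram

/-! ## Two tangles on top of each other -/

/-- The disjoint union `E ⊔ E'`. -/
def stack {n : ℕ} (F F' : ArrowTangle n) : Diagram (Vertex n ⊕ Vertex n) where
  mate := Sum.map F.mate F'.mate
  label := Sum.elim F.label F'.label
  row := Sum.elim Prod.fst Prod.fst
  rank := Sum.elim rank rank

/-- The inner points of `E ⊔ E'` are exchanged, `(1,b)` of `E` with `(0,b)` of `E'`; the outer
points are fixed. -/
def glue {n : ℕ} : Vertex n ⊕ Vertex n → Vertex n ⊕ Vertex n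
  | Sum.inl (true, b) => Sum.inr (false, b)
  | Sum.inr (false, b) => Sum.inl (true, b)
  | Sum.inl (false, b) => Sum.inl (false, b)
  | Sum.inr (true, b) => Sum.inr (true, b)

/-- The outer points of `E ⊔ E'`: the points `(0,b)` of `E` and `(1,b)` of `E'`. -/
def outer {n : ℕ} (v : Vertex n) : Vertex n ⊕ Vertex n :=
  if v.1 then Sum.inr v else Sum.inl v

def IsOuter {n : ℕ} (x : Vertex n ⊕ Vertex n) : Prop := ∃ v, x = outer v

/-- One step of a walk in `E ⊔ E'`: traverse the pair of `x`, then cross from one tangle to the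
other, unless the end of the pair is an outer point. -/
def next {n : ℕ} (F F' : ArrowTangle n) (x : Vertex n ⊕ Vertex n) : Vertex n ⊕ Vertex n :=
  glue ((stack F F').mate x)

/-- The number of pairs of the arc of `E ⊔ E'` that starts at the outer point `v`. -/
def arcLength {n : ℕ} (F F' : ArrowTangle n) (v : Vertex n) : ℕ :=
  sInf {ℓ : ℕ | 0 < ℓ ∧ IsOuter ((next F F')^[ℓ] (outer v))}

/-- The other end of the arc of `E ⊔ E'` that starts at the outer point `v`. -/
def arcEnd {n : ℕ} (F F' : ArrowTangle n) (v : Vertex n) : Vertex n :=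
  Sum.elim id id ((next F F')^[arcLength F F' v] (outer v))

/-- The sum of the labels along the arc of `E ⊔ E'` that starts at the outer point `v`, weighted by
the cumulated parities. -/
def arcWeight {n : ℕ} (F F' : ArrowTangle n) (v : Vertex n) : ℤ :=
  (stack F F').weight (fun i => (next F F')^[i] (outer v)) (arcLength F F' v)

/-! The arcs of `E ⊔ E'` form an arrow flat tangle. -/

section WellDefined

lemma iterate_reverse {X : Type} {m g f : X → X} (hf : ∀ x, f x = g (m x))
    (hm : ∀ x, m (m x) = x) (hg : ∀ x, g (g x) = x) (j : ℕ) (y : X) :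
    f^[j] (g (f^[j] y)) = g y := by
  induction j with
  | zero => rfl
  | succ j ih =>
    rw [Function.iterate_succ_apply' _ j y, Function.iterate_succ_apply, hf (g _), hf (f^[j] y), hg,
      hm]
    exact ih

lemma exists_return {X : Type} [Finite X] {m g f : X → X} (hf : ∀ x, f x = g (m x))
    (hm : ∀ x, m (m x) = x) (hg : ∀ x, g (g x) = x) (x : X) : ∃ ℓ, 0 < ℓ ∧ f^[ℓ] x = x := by
  have hinj : Function.Injective f := by
    intro a b hab
    rw [hf, hf] at hab
    have := congrArg g hab
    rw [hg, hg] at this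
    have := congrArg m this
    rwa [hm, hm] at this
  obtain ⟨ℓ, h0, hℓ⟩ := hinj.mem_periodicPts x
  exact ⟨ℓ, h0, hℓ⟩

variable {n : ℕ} (F F' : ArrowTangle n)

lemma mate_stack (x) : (stack F F').mate ((stack F F').mate x) = x := by
  rcases x with x | x <;> simp [stack, F.mate_mate, F'.mate_mate]

lemma mate_stack_ne (x) : (stack F F').mate x ≠ x := by
  rcases x with x | x <;> simp [stack, F.mate_ne, F'.mate_ne]

lemma glue_glue (x : Vertex n ⊕ Vertex n) : glue (glue x) = x := by
  rcases x with ⟨a, b⟩ | ⟨a, b⟩ <;> cases a <;> rfl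

lemma isOuter_iff (x : Vertex n ⊕ Vertex n) : IsOuter x ↔ glue x = x := by
  rcases x with ⟨a, b⟩ | ⟨a, b⟩ <;> cases a <;> simp [IsOuter, glue, outer]

lemma glue_outer (v : Vertex n) : glue (outer v) = outer v := (isOuter_iff _).1 ⟨v, rfl⟩

lemma elim_outer (v : Vertex n) : Sum.elim id id (outer v) = v := by
  rcases v with ⟨a, b⟩; cases a <;> rfl

lemma arcLength_spec (v : Vertex n) :
    0 < arcLength F F' v ∧ IsOuter ((next F F')^[arcLength F F' v] (outer v)) := by
  obtain ⟨ℓ, h0, hℓ⟩ := exists_return (m := (stack F F').mate) (f := next F F') (fun _ => rfl) (mate_stack F F') glue_glue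
    (outer v)
  exact Nat.sInf_mem (s := {ℓ : ℕ | 0 < ℓ ∧ IsOuter ((next F F')^[ℓ] (outer v))})
    ⟨ℓ, h0, by rw [hℓ]; exact ⟨v, rfl⟩⟩

lemma not_isOuter (v : Vertex n) {j : ℕ} (h0 : 0 < j) (hj : j < arcLength F F' v) :
    ¬ IsOuter ((next F F')^[j] (outer v)) :=
  fun h => Nat.notMem_of_lt_sInf hj ⟨h0, h⟩

lemma outer_arcEnd (v : Vertex n) :
    outer (arcEnd F F' v) = (next F F')^[arcLength F F' v] (outer v) := by
  obtain ⟨w, hw⟩ := (arcLength_spec F F' v).2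
  rw [arcEnd, hw, elim_outer]

lemma iterate_arcEnd (v : Vertex n) {j : ℕ} (hj : j ≤ arcLength F F' v) :
    (next F F')^[j] (outer (arcEnd F F' v)) =
      glue ((next F F')^[arcLength F F' v - j] (outer v)) := by
  have h := iterate_reverse (m := (stack F F').mate) (f := next F F') (fun _ => rfl) (mate_stack F F') glue_glue j
    ((next F F')^[arcLength F F' v - j] (outer v))
  rw [← Function.iterate_add_apply, Nat.add_sub_cancel' hj, ← outer_arcEnd, glue_outer] at h
  exact h

lemma arcLength_arcEnd (v : Vertex n) : arcLength F F' (arcEnd F F' v) = arcLength F F' v := by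
  obtain ⟨h0, _⟩ := arcLength_spec F F' v
  obtain ⟨h0', h1'⟩ := arcLength_spec F F' (arcEnd F F' v)
  apply le_antisymm
  · apply Nat.sInf_le
    refine ⟨h0, ?_⟩
    rw [iterate_arcEnd F F' v le_rfl, Nat.sub_self]
    exact ⟨v, glue_outer v⟩
  · by_contra! h
    rw [iterate_arcEnd F F' v h.le, isOuter_iff, glue_glue] at h1'
    exact not_isOuter F F' v (by omega) (by omega) ((isOuter_iff _).2 h1'.symm)

lemma arcEnd_arcEnd (v : Vertex n) : arcEnd F F' (arcEnd F F' v) = v := by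
  rw [arcEnd, arcLength_arcEnd, iterate_arcEnd F F' v le_rfl, Nat.sub_self]
  exact (congrArg _ (glue_outer v)).trans (elim_outer v)

lemma arcEnd_ne (v : Vertex n) : arcEnd F F' v ≠ v := by
  intro h
  have key := fun j hj => iterate_arcEnd F F' v (j := j) hj
  rw [h] at key
  obtain ⟨h0, _⟩ := arcLength_spec F F' v
  obtain ⟨k, hk⟩ := Nat.even_or_odd' (arcLength F F' v)
  rcases hk with hk | hk
  · have h1 := key k (by omega)
    rw [show arcLength F F' v - k = k by omega] at h1
    exact not_isOuter F F' v (j := k) (by omega) (by omega) ((isOuter_iff _).2 h1.symm)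
  · have h1 := key (k + 1) (by omega)
    rw [show arcLength F F' v - (k + 1) = k by omega, Function.iterate_succ_apply'] at h1
    have h2 := congrArg glue h1
    rw [next, glue_glue, glue_glue] at h2
    exact mate_stack_ne F F' _ h2

lemma label_stack_odd (x) :
    Odd ((stack F F').label x) ↔ (stack F F').row ((stack F F').mate x) = (stack F F').row x := by
  rcases x with x | x
  · exact F.label_odd x
  · exact F'.label_odd x

lemma row_glue (x : Vertex n ⊕ Vertex n) (hx : ¬ IsOuter x) :
    (stack F F').row (glue x) = !(stack F F').row x := by
  rw [isOuter_iff] at hx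
  rcases x with ⟨a, b⟩ | ⟨a, b⟩ <;> cases a <;> simp_all [glue, stack]

lemma isOuter_glue (x : Vertex n ⊕ Vertex n) : IsOuter (glue x) ↔ IsOuter x := by
  rw [isOuter_iff, isOuter_iff, glue_glue]; exact eq_comm

lemma odd_weight_walk (v : Vertex n) (k : ℕ) (hk : k < arcLength F F' v) :
    Odd ((stack F F').weight (fun i => (next F F')^[i] (outer v)) k) ↔
      (stack F F').row ((next F F')^[k] (outer v)) ≠ (stack F F').row (outer v) := by
  induction k with
  | zero => simp [Diagram.weight]
  | succ k ih =>
    have ih := ih (by omega)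
    have h1 := not_isOuter F F' v (Nat.succ_pos k) hk
    rw [Function.iterate_succ_apply'] at h1 ⊢
    have h2 := label_stack_odd F F' ((next F F')^[k] (outer v))
    have hc := (stack F F').cumParity_odd (fun i => (next F F')^[i] (outer v)) k
    rw [next, isOuter_glue] at h1
    rw [next, row_glue F F' _ h1, Diagram.weight, sum_range_succ, Int.odd_add, ← Diagram.weight, ih,
      ← Int.not_odd_iff_even, Int.odd_mul, h2]
    simp only [hc, true_and]
    generalize (stack F F').row ((stack F F').mate ((next F F')^[k] (outer v))) = p
    generalize (stack F F').row ((next F F')^[k] (outer v)) = q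
    generalize (stack F F').row (outer v) = r
    revert p q r
    decide

lemma odd_arcWeight (v : Vertex n) : Odd (arcWeight F F' v) ↔ (arcEnd F F' v).1 = v.1 := by
  have hrow : ∀ w : Vertex n, w.1 = (stack F F').row (outer w) := by
    rintro ⟨a, b⟩; cases a <;> rfl
  obtain ⟨h0, h1⟩ := arcLength_spec F F' v
  obtain ⟨k, hk⟩ : ∃ k, arcLength F F' v = k + 1 := ⟨arcLength F F' v - 1, by omega⟩
  have ih := odd_weight_walk F F' v k (by omega)
  rw [hrow, hrow, outer_arcEnd, arcWeight]
  rw [hk, Function.iterate_succ_apply'] at h1 ⊢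
  have h2 := label_stack_odd F F' ((next F F')^[k] (outer v))
  have hc := (stack F F').cumParity_odd (fun i => (next F F')^[i] (outer v)) k
  rw [next, isOuter_glue, isOuter_iff] at h1
  rw [next, h1, Diagram.weight, sum_range_succ, Int.odd_add, ← Diagram.weight, ih,
      ← Int.not_odd_iff_even, Int.odd_mul, h2]
  simp only [hc, true_and]
  generalize (stack F F').row ((stack F F').mate ((next F F')^[k] (outer v))) = p
  generalize (stack F F').row ((next F F')^[k] (outer v)) = q
  generalize (stack F F').row (outer v) = r
  revert p q r
  decide

lemma rank_injective : Function.Injective (rank : Vertex n → ℕ) := by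
  rintro ⟨a, b⟩ ⟨c, d⟩ h
  have := b.2
  have := d.2
  cases a <;> cases c <;> simp only [rank, Bool.false_eq_true, if_true, if_false] at h <;>
    simp only [Prod.mk.injEq, Fin.ext_iff, true_and, false_and, reduceCtorEq] <;> omega

end WellDefined

/-- The arrow flat tangle `F * F'`: its pairs are the boundaries of the arcs of `E ⊔ E'`, and the
label of such a pair is the weight of the arc, traversed from its smaller to its larger end. -/
def ArrowTangle.comp {n : ℕ} (F F' : ArrowTangle n) : ArrowTangle n where
  mate := arcEnd F F'
  mate_mate := arcEnd_arcEnd F F'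
  mate_ne := arcEnd_ne F F'
  label v := if rank v < rank (arcEnd F F' v) then arcWeight F F' v
    else arcWeight F F' (arcEnd F F' v)
  label_mate v := by
    have h : rank (arcEnd F F' v) ≠ rank v := fun h => arcEnd_ne F F' v (rank_injective h)
    rw [arcEnd_arcEnd]
    split_ifs <;> first | rfl | omega
  label_odd v := by
    split_ifs
    · exact odd_arcWeight F F' v
    · rw [odd_arcWeight, arcEnd_arcEnd]
      exact eq_comm

/-! ## Cycles -/

/-- The cycles of `E ⊔ E'` are in bijection with the columns `b` satisfying this predicate: `b` is
the smallest column met by the closed walk that starts at the point `(1,b)` of `E`, meets only inner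
points, and returns to its starting point for the first time, and the walk meets the column `b` only
at its starting point. -/
def IsCycle {n : ℕ} (F F' : ArrowTangle n) (b : Fin n) : Prop :=
  (∀ i, ¬ IsOuter ((next F F')^[i] (Sum.inl (true, b)))) ∧
  ∀ i, 0 < i → i < Function.minimalPeriod (next F F') (Sum.inl (true, b)) →
    b < (Sum.elim Prod.snd Prod.snd ((next F F')^[i] (Sum.inl (true, b))) : Fin n)

/-- The number of zigzags of the cycle of `E ⊔ E'` that starts at the point `(1,b)` of `E`. -/
def cycleZigzag {n : ℕ} (F F' : ArrowTangle n) (b : Fin n) : ℕ :=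
  ((stack F F').weight (fun i => (next F F')^[i] (Sum.inl (true, b)))
    (Function.minimalPeriod (next F F') (Sum.inl (true, b)))).natAbs / 2

open Classical in
/-- The product of the `z_{ζ(γ)}` over the cycles `γ` of `E ⊔ E'`. -/
def cycleFactor {n : ℕ} (F F' : ArrowTangle n) : Ra :=
  ∏ b ∈ univ.filter (IsCycle F F'), z (cycleZigzag F F' b)

/-- A single tangle as a family of labeled pairs. -/
def ArrowTangle.diagram {n : ℕ} (F : ArrowTangle n) : Diagram (Vertex n) where
  mate := F.mate
  label := F.label
  row := Prod.fst
  rank := rank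

/-- One step of a walk in the closure of `E`: traverse the pair of `v`, then jump to the other row of
the same column. -/
def closureNext {n : ℕ} (F : ArrowTangle n) (v : Vertex n) : Vertex n :=
  (!(F.mate v).1, (F.mate v).2)

/-- The cycles of the closure of `E` are in bijection with the columns `b` satisfying this predicate:
`b` is the smallest column met by the closed walk that starts at `(0,b)` and returns to its starting
point for the first time, and the walk meets the column `b` only at its starting point. -/
def IsClosureCycle {n : ℕ} (F : ArrowTangle n) (b : Fin n) : Prop :=
  ∀ i, 0 < i → i < Function.minimalPeriod (closureNext F) (false, b) →
    b < ((closureNext F)^[i] (false, b)).2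

/-- The number of zigzags of the cycle of the closure of `E` that starts at `(0,b)`. -/
def closureZigzag {n : ℕ} (F : ArrowTangle n) (b : Fin n) : ℕ :=
  (F.diagram.weight (fun i => (closureNext F)^[i] (false, b))
    (Function.minimalPeriod (closureNext F) (false, b))).natAbs / 2

open Classical in
/-- The product of the `z_{ζ(γ)}` over the cycles `γ` of the closure of `E`. -/
def closureFactor {n : ℕ} (F : ArrowTangle n) : Ra :=
  ∏ b ∈ univ.filter (IsClosureCycle F), z (closureZigzag F b)

/-! ## Particular tangles -/

/-- The tangle that joins `(0,i)` to `(1, p i)` for all `i`, with all labels `0`. -/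
def ArrowTangle.ofPerm {n : ℕ} (p : Equiv.Perm (Fin n)) : ArrowTangle n where
  mate v := if v.1 then (false, p.symm v.2) else (true, p v.2)
  mate_mate := by rintro ⟨a, b⟩; cases a <;> simp
  mate_ne := by rintro ⟨a, b⟩; cases a <;> simp
  label _ := 0
  label_mate _ := rfl
  label_odd := by rintro ⟨a, b⟩; cases a <;> simp

/-- The tangle with the two pairs `{(0,i), (0,j)}` and `{(1,i), (1,j)}`, both labeled `1`, all other
pairs being `{(0,k), (1,k)}` with label `0`. -/
def ArrowTangle.cupCap {n : ℕ} (i j : Fin n) (hij : i ≠ j) : ArrowTangle n where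
  mate v := if v.2 = i then (v.1, j) else if v.2 = j then (v.1, i) else (!v.1, v.2)
  mate_mate := by
    rintro ⟨a, b⟩
    by_cases h1 : b = i
    · simp [h1, hij.symm]
    · by_cases h2 : b = j <;> simp [h1, h2, hij.symm]
  mate_ne := by
    rintro ⟨a, b⟩
    by_cases h1 : b = i
    · simp [h1, hij.symm]
    · by_cases h2 : b = j
      · subst h2; simp [hij, hij.symm]
      · simp [h1, h2]
  label v := if v.2 = i ∨ v.2 = j then 1 else 0
  label_mate := by
    rintro ⟨a, b⟩
    by_cases h1 : b = i
    · simp [h1]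
    · by_cases h2 : b = j <;> simp [h1, h2, hij.symm]
  label_odd := by
    rintro ⟨a, b⟩
    by_cases h1 : b = i
    · simp [h1]
    · by_cases h2 : b = j <;> simp [h1, h2, hij.symm]

/-- The tangle `F♯` obtained from `F` by adding the pair `{(0,n+1), (1,n+1)}` with label `0`. -/
def ArrowTangle.sharp {n : ℕ} (F : ArrowTangle n) : ArrowTangle (n + 1) where
  mate v := Fin.lastCases (!v.1, Fin.last n)
    (fun k => ((F.mate (v.1, k)).1, (F.mate (v.1, k)).2.castSucc)) v.2
  mate_mate := by
    rintro ⟨a, b⟩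
    induction b using Fin.lastCases <;> simp [F.mate_mate]
  mate_ne := by
    rintro ⟨a, b⟩
    induction b using Fin.lastCases with
    | last => simp
    | cast k =>
      have := F.mate_ne (a, k)
      simpa [Prod.ext_iff] using this
  label v := Fin.lastCases 0 (fun k => F.label (v.1, k)) v.2
  label_mate := by
    rintro ⟨a, b⟩
    induction b using Fin.lastCases <;> simp [F.label_mate]
  label_odd := by
    rintro ⟨a, b⟩
    induction b using Fin.lastCases <;> simp [F.label_odd]

/-! ## The modules `ATL_n(R^a)`, their product, embeddings, and linear forms -/

/-- `ATL_n(R^a)`: the free `R^a`-module on the arrow flat `n`-tangles. -/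
def ATL (n : ℕ) : Type := ArrowTangle n →₀ Ra

namespace ATL

variable {n : ℕ}

instance : AddCommGroup (ATL n) := inferInstanceAs (AddCommGroup (ArrowTangle n →₀ Ra))

instance : Module Ra (ATL n) := inferInstanceAs (Module Ra (ArrowTangle n →₀ Ra))

/-- The basis element given by a tangle. -/
def of (F : ArrowTangle n) : ATL n := (Finsupp.single F 1 : ArrowTangle n →₀ Ra)

/-- The `R^a`-linear map with prescribed values on the tangles. -/
def lift {M : Type} [AddCommGroup M] [Module Ra M] (φ : ArrowTangle n → M) : ATL n →ₗ[Ra] M :=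
  (Finsupp.linearCombination Ra φ : (ArrowTangle n →₀ Ra) →ₗ[Ra] M)

lemma lift_of {M : Type} [AddCommGroup M] [Module Ra M] (φ : ArrowTangle n → M)
    (F : ArrowTangle n) : lift φ (of F) = φ F := by
  exact (Finsupp.linearCombination_single Ra 1 F).trans (one_smul _ _)

/-- The bilinear product with `F F' = z_{ζ(γ₁)} ⋯ z_{ζ(γ_m)} (F * F')` for tangles `F` and `F'`, where
`γ₁, …, γ_m` are the cycles of `E ⊔ E'`. -/
def mulMap : ATL n →ₗ[Ra] ATL n →ₗ[Ra] ATL n :=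
  lift fun F => lift fun F' => cycleFactor F F' • of (F.comp F')

instance : Mul (ATL n) := ⟨fun x y => mulMap x y⟩

instance : One (ATL n) := ⟨of (ArrowTangle.ofPerm 1)⟩

lemma of_mul_of (F F' : ArrowTangle n) : of F * of F' = cycleFactor F F' • of (F.comp F') := by
  change mulMap (of F) (of F') = _
  rw [mulMap, lift_of, lift_of]

/-- The map `ATL_n(R^a) → ATL_{n+1}(R^a)` that sends each tangle `F` to `F♯`. -/
def incl (n : ℕ) : ATL n →ₗ[Ra] ATL (n + 1) := lift fun F => of F.sharp

/-- The linear form `T_n'^a`. -/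
def trace (n : ℕ) : ATL n →ₗ[Ra] Ra := lift closureFactor

/-- The tangle `F_i` joining `(0,i)` to `(0,i+1)` and `(1,i)` to `(1,i+1)`, with labels `1`. The
strands are numbered from `0`. -/
def F (n i : ℕ) (h : i + 1 < n) : ATL n :=
  of (ArrowTangle.cupCap ⟨i, by omega⟩ ⟨i + 1, h⟩ (by simp))

/-- The tangle `w_i` joining `(0,i)` to `(1,i+1)` and `(0,i+1)` to `(1,i)`, with labels `0`. -/
def w (n i : ℕ) (h : i + 1 < n) : ATL n :=
  of (ArrowTangle.ofPerm (Equiv.swap ⟨i, by omega⟩ ⟨i + 1, h⟩))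

end ATL

/-! ## Virtual braid groups -/

/-- The generators of the virtual braid group on `n` strands; the strands are numbered from `0`, and
the generators number `i` involve the strands `i` and `i + 1`. -/
inductive VBGen (n : ℕ) : Type
  | sigma (i : ℕ) (h : i + 1 < n) : VBGen n
  | tau (i : ℕ) (h : i + 1 < n) : VBGen n

/-- The generator `σ_i` in the free group. -/
def fs {n : ℕ} (i : ℕ) (h : i + 1 < n) : FreeGroup (VBGen n) := FreeGroup.of (VBGen.sigma i h)

/-- The generator `τ_i` in the free group. -/
def ft {n : ℕ} (i : ℕ) (h : i + 1 < n) : FreeGroup (VBGen n) := FreeGroup.of (VBGen.tau i h)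

/-- The defining relations of the virtual braid group. -/
inductive VBRel (n : ℕ) : FreeGroup (VBGen n) → FreeGroup (VBGen n) → Prop
  | tau_sq (i hi) : VBRel n (ft i hi * ft i hi) 1
  | sigma_sigma (i j hi hj) : (i + 2 ≤ j ∨ j + 2 ≤ i) →
      VBRel n (fs i hi * fs j hj) (fs j hj * fs i hi)
  | tau_tau (i j hi hj) : (i + 2 ≤ j ∨ j + 2 ≤ i) →
      VBRel n (ft i hi * ft j hj) (ft j hj * ft i hi)
  | tau_sigma (i j hi hj) : (i + 2 ≤ j ∨ j + 2 ≤ i) →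
      VBRel n (ft i hi * fs j hj) (fs j hj * ft i hi)
  | braid_sigma (i j hi hj) : (i + 1 = j ∨ j + 1 = i) →
      VBRel n (fs i hi * fs j hj * fs i hi) (fs j hj * fs i hi * fs j hj)
  | braid_tau (i j hi hj) : (i + 1 = j ∨ j + 1 = i) →
      VBRel n (ft i hi * ft j hj * ft i hi) (ft j hj * ft i hi * ft j hj)
  | braid_mixed (i j hi hj) : (i + 1 = j ∨ j + 1 = i) →
      VBRel n (ft i hi * ft j hj * fs i hi) (fs j hj * ft i hi * ft j hj)

/-- The virtual braid group on `n` strands. -/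
abbrev VB (n : ℕ) : Type := PresentedGroup {r | ∃ a b, VBRel n a b ∧ r = a * b⁻¹}

namespace VB

def σ (n i : ℕ) (h : i + 1 < n) : VB n := PresentedGroup.of (VBGen.sigma i h)

def τ (n i : ℕ) (h : i + 1 < n) : VB n := PresentedGroup.of (VBGen.tau i h)

def genIncl {n : ℕ} : VBGen n → VBGen (n + 1)
  | VBGen.sigma i h => VBGen.sigma i (by omega)
  | VBGen.tau i h => VBGen.tau i (by omega)

lemma rel_incl {n : ℕ} {a b : FreeGroup (VBGen n)} (h : VBRel n a b) :
    VBRel (n + 1) (FreeGroup.map genIncl a) (FreeGroup.map genIncl b) := by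
  have hs : ∀ i hi, FreeGroup.map genIncl (fs (n := n) i hi) = fs i (by omega) :=
    fun i hi => FreeGroup.map.of
  have ht : ∀ i hi, FreeGroup.map genIncl (ft (n := n) i hi) = ft i (by omega) :=
    fun i hi => FreeGroup.map.of
  cases h <;> simp only [map_mul, map_one, hs, ht] <;> constructor <;> assumption

/-- The homomorphism `VB_n → VB_{n+1}` that sends `σ_i` to `σ_i` and `τ_i` to `τ_i`. -/
def incl (n : ℕ) : VB n →* VB (n + 1) :=
  PresentedGroup.toGroup (f := fun x => PresentedGroup.of (genIncl x)) (by
    rintro r ⟨a, b, h, rfl⟩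
    have key : ∀ c : FreeGroup (VBGen n),
        FreeGroup.lift (fun x => (PresentedGroup.of (genIncl x) : VB (n + 1))) c =
          PresentedGroup.mk _ (FreeGroup.map genIncl c) := by
      intro c
      have : FreeGroup.lift (fun x => (PresentedGroup.of (genIncl x) : VB (n + 1))) =
          (PresentedGroup.mk _).comp (FreeGroup.map genIncl) := by
        ext x
        simp [PresentedGroup.of]
      rw [this]
      rfl
    rw [key]
    apply PresentedGroup.one_of_mem
    exact ⟨_, _, rel_incl h, by rw [map_mul, map_inv]⟩)

end VB

/-! ## Towers of algebras and Markov traces -/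

section Markov

variable (R : Type*) [CommRing R]

/-- The algebra laws, for a module with a multiplication and a unit. -/
structure IsAlgebra (A : Type*) [AddCommGroup A] [Module R A] [Mul A] [One A] : Prop where
  add_mul : ∀ x y t : A, (x + y) * t = x * t + y * t
  mul_add : ∀ x y t : A, x * (y + t) = x * y + x * t
  smul_mul : ∀ (r : R) (x y : A), (r • x) * y = r • (x * y)
  mul_smul : ∀ (r : R) (x y : A), x * (r • y) = r • (x * y)
  mul_assoc : ∀ x y t : A, x * y * t = x * (y * t)
  one_mul : ∀ x : A, 1 * x = x
  mul_one : ∀ x : A, x * 1 = x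

variable {R}

/-- A linear map that respects multiplications and units. -/
structure IsAlgebraHom {A B : Type*} [AddCommGroup A] [Module R A] [Mul A] [One A]
    [AddCommGroup B] [Module R B] [Mul B] [One B] (φ : A →ₗ[R] B) : Prop where
  map_one : φ 1 = 1
  map_mul : ∀ x y : A, φ (x * y) = φ x * φ y

variable {A : ℕ → Type*} [∀ n, AddCommGroup (A n)] [∀ n, Module R (A n)] [∀ n, Mul (A n)]
  [∀ n, One (A n)]

/-- `A 1, A 2, …` are algebras, each embedded in the next one by `ι`. -/
structure IsTower (ι : ∀ n, A n →ₗ[R] A (n + 1)) : Prop where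
  isAlgebra : ∀ n, 1 ≤ n → IsAlgebra R (A n)
  isAlgebraHom : ∀ n, 1 ≤ n → IsAlgebraHom (ι n)
  injective : ∀ n, 1 ≤ n → Function.Injective (ι n)

/-- The maps `ρ n : R[VB_n] → A n`, `n ≥ 1`, are algebra homomorphisms, and the restriction of
`ρ (n + 1)` to `R[VB_n]` is `ρ n`. -/
structure IsCompatible (ι : ∀ n, A n →ₗ[R] A (n + 1)) (ρ : ∀ n, MonoidAlgebra R (VB n) →ₗ[R] A n) :
    Prop where
  isAlgebraHom : ∀ n, 1 ≤ n → IsAlgebraHom (ρ n)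
  restrict : ∀ n, 1 ≤ n → ∀ x : MonoidAlgebra R (VB n),
    ρ (n + 1) (MonoidAlgebra.mapDomain (VB.incl n) x) = ι n (ρ n x)

/-- The image in `A n` of a virtual braid. -/
def img (ρ : ∀ n, MonoidAlgebra R (VB n) →ₗ[R] A n) {n : ℕ} (β : VB n) : A n :=
  ρ n (MonoidAlgebra.of R (VB n) β)

open VB in
/-- The sequence `T 1, T 2, …` of linear forms is a Markov trace on the tower `A 1, A 2, …`, with
respect to the homomorphisms `ρ n`. As the strands are numbered from `0`, the elements usually
called `σ_n` and `σ_{n-1}` are here `σ (n + 1) (n - 1) _` and `σ (n + 1) (n - 2) _`. -/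
structure IsMarkovTrace (ι : ∀ n, A n →ₗ[R] A (n + 1)) (ρ : ∀ n, MonoidAlgebra R (VB n) →ₗ[R] A n)
    (T : ∀ n, A n →ₗ[R] R) : Prop where
  cyclic : ∀ n, 1 ≤ n → ∀ x y : A n, T n (x * y) = T n (y * x)
  sigma : ∀ n, ∀ _ : 1 ≤ n, ∀ x : A n,
    T n x = T (n + 1) (ι n x * img ρ (σ (n + 1) (n - 1) (by omega)))
  sigma_inv : ∀ n, ∀ _ : 1 ≤ n, ∀ x : A n,
    T n x = T (n + 1) (ι n x * img ρ (σ (n + 1) (n - 1) (by omega))⁻¹)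
  tau : ∀ n, ∀ _ : 1 ≤ n, ∀ x : A n,
    T n x = T (n + 1) (ι n x * img ρ (τ (n + 1) (n - 1) (by omega)))
  right : ∀ n, ∀ _ : 2 ≤ n, ∀ x : A n,
    T n x = T (n + 1) (ι n x * img ρ (σ (n + 1) (n - 1) (by omega))⁻¹ *
      img ρ (τ (n + 1) (n - 2) (by omega)) * img ρ (σ (n + 1) (n - 1) (by omega)))
  left : ∀ n, ∀ _ : 2 ≤ n, ∀ x : A n,
    T n x = T (n + 1) (ι n x * img ρ (τ (n + 1) (n - 1) (by omega)) *
      img ρ (τ (n + 1) (n - 2) (by omega)) * img ρ (σ (n + 1) (n - 2) (by omega)) *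
      img ρ (τ (n + 1) (n - 1) (by omega)) * img ρ (σ (n + 1) (n - 2) (by omega))⁻¹ *
      img ρ (τ (n + 1) (n - 2) (by omega)) * img ρ (τ (n + 1) (n - 1) (by omega)))

end Markov

end ArrowTL

end

/-! The weight of a walk looks path dependent, since each label is multiplied by a cumulated parity.
But the parity of a pair is minus the product of the row signs of its two ends, and every gluing
crossed by a walk changes the row, so the product of parities telescopes. Hence a weight is the row
sign of the starting point times a plain sum of angles, where the angle of an oriented pair is its
label up to a sign and is negated when the pair is reversed (`Diagram.weight_eq`). A tangle is
determined by this antisymmetric data, its `net` (`ArrowTangle.ext_net`); the labels of a product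
are sums of angles along arcs (`comp_isReduction`); and the zigzag number of a cycle is half the
absolute value of its total angle, so it depends neither on the starting point nor on the direction
(`Net.value_conn`). Products over cycles may therefore be computed with any set of representatives
(`Net.prod_transversal`).

The global identities come from gluing in two stages. If some points of a net are glued first and
the remaining ones later, arcs concatenate (`IsReduction.trans`), and the final cycles are those
closed at the first stage together with those of the reduced net (`IsReduction.isTransversal_union`,
`IsReduction.prod_union`). Both bracketings of a triple product are staged gluings of one net, which
gives associativity (`comp_assoc_cycleFactor`). The closure of a product is a staged gluing of the
two tangles along both rows, a symmetric picture, which gives cyclicity of the trace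
(`cycleFactor_mul_closureFactor_comm`).

The rest is local. Permutations have angle 0; a hook has angle 1 from its first to its second
column, in both rows. The loop in the square of a hook and the zigzags in products of hooks have
total angle 0, so the `F_i` satisfy the Temperley–Lieb relations with loop value `z 0`, and a hook
times a transposition sharing one column with it times the hook is the hook. With `q = A⁻²` and `q'
= A²` one has `S_i = -q - q² F_i` and `z 0 = -q - q'`, from which inverses and the braid relations
follow.

For the Markov property, a free last strand multiplies the closure by `z 0`, while a hook or
transposition linking it to another column removes it without changing any angle. So `S_n`
contributes `-q z 0 - q² = 1`. In a conjugate `S⁻¹ w S` the terms in `w`, `w e` and `e w` cancel,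
and `e w e = e` leaves the trace of `x` (`trace_skein_conj`). The last move reduces to the same
computation with a hook oriented backwards, from the last column. -/

open Finset

noncomputable section

namespace ArrowTL

/-! ## Nets: pairings with an antisymmetric angle -/

/-- A pairing of the points of `X` together with an integer for each oriented pair, the two
orientations of a pair having opposite integers. -/
structure Net (X : Type) where
  mate : X → X
  angle : X → ℤ
  mate_mate : ∀ x, mate (mate x) = x
  mate_ne : ∀ x, mate x ≠ x
  angle_mate : ∀ x, angle (mate x) = -angle x

namespace Net

variable {X Y Z : Type}

/-- One step of a walk: traverse a pair, then cross the gluing `g`. -/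
def step (N : Net X) (g : X → X) (x : X) : X := g (N.mate x)

/-- The sum of the angles of the first `k` pairs of the walk that starts at `x`. -/
def walkSum (N : Net X) (g : X → X) (x : X) (k : ℕ) : ℤ :=
  ∑ i ∈ range k, N.angle ((N.step g)^[i] x)

/-- The walk that starts at `x` never meets a point fixed by the gluing. -/
def IsClosed (N : Net X) (g : X → X) (x : X) : Prop :=
  ∀ i, g ((N.step g)^[i] x) ≠ (N.step g)^[i] x

/-- The points `x` and `y` belong to the same component of the glued net. -/
def Conn (N : Net X) (g : X → X) (x y : X) : Prop :=
  ∃ k, (N.step g)^[k] x = y ∨ (N.step g)^[k] x = g y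

/-- The sum of the angles along the closed walk that starts at `x`. -/
def holonomy (N : Net X) (g : X → X) (x : X) : ℤ :=
  N.walkSum g x (Function.minimalPeriod (N.step g) x)

/-- The variable attached to the component of `x`. -/
def value (N : Net X) (g : X → X) (x : X) : Ra := z ((N.holonomy g x).natAbs / 2)

/-- A set of points with exactly one point in each closed component. -/
structure IsTransversal (N : Net X) (g : X → X) (S : Finset X) : Prop where
  isClosed : ∀ x ∈ S, N.IsClosed g x
  exists_conn : ∀ x, N.IsClosed g x → ∃ y ∈ S, N.Conn g y x
  eq_of_conn : ∀ x ∈ S, ∀ y ∈ S, N.Conn g x y → x = y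

lemma Conn.refl (N : Net X) (g : X → X) (x : X) : N.Conn g x x := ⟨0, Or.inl rfl⟩

lemma walkSum_add (N : Net X) (g : X → X) (x : X) (a b : ℕ) :
    N.walkSum g x (a + b) = N.walkSum g x a + N.walkSum g ((N.step g)^[a] x) b := by
  simp only [walkSum, sum_range_add, ← Function.iterate_add_apply, Nat.add_comm _ a]

lemma walkSum_one (N : Net X) (g : X → X) (x : X) : N.walkSum g x 1 = N.angle x := by
  simp [walkSum]

lemma walkSum_mul (N : Net X) (g : X → X) (x : X) {p : ℕ} (hp : (N.step g)^[p] x = x) (c : ℕ) :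
    N.walkSum g x (c * p) = c * N.walkSum g x p := by
  induction c with
  | zero => simp [walkSum]
  | succ c ih =>
    have h : (N.step g)^[c * p] x = x := (Function.IsPeriodicPt.const_mul hp c)
    rw [Nat.succ_mul, walkSum_add, ih, h]
    push_cast
    ring

/-! ### Walks, their reversal, and closed components. -/

section Basic

variable (N : Net X) {g : X → X} (hg : ∀ x, g (g x) = x)
include hg

lemma step_injective : Function.Injective (N.step g) := by
  intro a b h
  have h1 := congrArg g h
  simp only [step, hg] at h1
  rw [← N.mate_mate a, h1, N.mate_mate]

/-- Conjugation by `g` inverts `step`, because `step` is a product of two involutions. All arguments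
about walking backwards use this form. -/
lemma iterate_glue (j : ℕ) (y : X) : (N.step g)^[j] (g ((N.step g)^[j] y)) = g y :=
  iterate_reverse (m := N.mate) (f := N.step g) (fun _ => rfl) N.mate_mate hg j y

lemma exists_iterate [Finite X] (k : ℕ) (x : X) : ∃ j, (N.step g)^[j] ((N.step g)^[k] x) = x := by
  obtain ⟨l, h0, hl⟩ := exists_return (m := N.mate) (f := N.step g) (fun _ => rfl) N.mate_mate hg x
  -- `k * l` is a multiple of a return time `l > 0` and is at least `k`.
  refine ⟨k * l - k, ?_⟩
  rw [← Function.iterate_add_apply, Nat.sub_add_cancel (Nat.le_mul_of_pos_right _ h0)]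
  exact Function.IsPeriodicPt.const_mul hl k

lemma minimalPeriod_pos [Finite X] (x : X) : 0 < Function.minimalPeriod (N.step g) x := by
  obtain ⟨l, h0, hl⟩ := exists_return (m := N.mate) (f := N.step g) (fun _ => rfl) N.mate_mate hg x
  exact Function.IsPeriodicPt.minimalPeriod_pos h0 hl

variable {N}

lemma Conn.symm [Finite X] {x y : X} (h : N.Conn g x y) : N.Conn g y x := by
  obtain ⟨k, h | h⟩ := h
  · obtain ⟨j, hj⟩ := N.exists_iterate hg k x
    exact ⟨j, Or.inl (by rw [← h, hj])⟩
  · have h1 := N.iterate_glue hg k y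
    have h2 := (N.step_injective hg).iterate k (h1.trans h.symm)
    exact ⟨k, Or.inr (by rw [← h2, hg])⟩

lemma Conn.trans [Finite X] {x y w : X} (h : N.Conn g x y) (h' : N.Conn g y w) :
    N.Conn g x w := by
  obtain ⟨k, h | h⟩ := h
  · obtain ⟨l, h'⟩ := h'
    refine ⟨l + k, ?_⟩
    rwa [Function.iterate_add_apply, h]
  · obtain ⟨l, h'⟩ := h'
    have h1 := N.iterate_glue hg l y
    obtain ⟨j, hj⟩ := N.exists_iterate hg l (g ((N.step g)^[l] y))
    refine ⟨j + k, ?_⟩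
    rw [Function.iterate_add_apply, h, ← h1, hj]
    rcases h' with h' | h' <;> simp [h', hg]

lemma IsClosed.of_conn [Finite X] {x y : X} (hx : N.IsClosed g x) (h : N.Conn g x y) :
    N.IsClosed g y := by
  intro i hi
  obtain ⟨k, h | h⟩ := h
  · rw [← h, ← Function.iterate_add_apply] at hi
    exact hx _ hi
  · have h1 := N.iterate_glue hg i y
    rw [hi, ← h] at h1
    obtain ⟨j, hj⟩ := N.exists_iterate hg i ((N.step g)^[i] y)
    rw [h1, ← Function.iterate_add_apply] at hj
    exact hx (j + k) (by rw [hj, hi])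

/-- The two orientations of a closed component are disjoint orbits. A walk that reached `g x` would
fold onto itself, and its middle would be a fixed point of `g` if its length is even, of `mate` if
it is odd. -/
lemma IsClosed.iterate_ne {x : X} (hx : N.IsClosed g x) (k : ℕ) : (N.step g)^[k] x ≠ g x := by
  intro h
  obtain ⟨j, hj | hj⟩ := Nat.even_or_odd' k
  · rw [← N.iterate_glue hg j x, hj, two_mul, Function.iterate_add_apply] at h
    exact hx j ((N.step_injective hg).iterate j h).symm
  · rw [← N.iterate_glue hg j x, hj, show 2 * j + 1 = j + (j + 1) by omega,
      Function.iterate_add_apply, Function.iterate_succ_apply'] at h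
    have h1 := congrArg g ((N.step_injective hg).iterate j h)
    rw [step, hg, hg] at h1
    exact N.mate_ne _ h1

variable (N)

/-- The reversed walk traverses the same pairs in the opposite order and direction, and angles are
antisymmetric. -/
lemma walkSum_reverse (x : X) (k : ℕ) :
    N.walkSum g (g ((N.step g)^[k] x)) k = -N.walkSum g x k := by
  rw [walkSum, walkSum, ← sum_range_reflect, ← sum_neg_distrib]
  refine sum_congr rfl fun i hi => ?_
  have hi := mem_range.1 hi
  rw [← N.angle_mate]
  congr 1
  have h := N.iterate_glue hg (k - 1 - i) ((N.step g)^[i + 1] x)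
  rw [← Function.iterate_add_apply, show k - 1 - i + (i + 1) = k by omega] at h
  rw [h, Function.iterate_succ_apply', step, hg]

lemma holonomy_glue (x : X) : N.holonomy g (g x) = -N.holonomy g x := by
  have h : ∀ y, Function.minimalPeriod (N.step g) (g y) ∣ Function.minimalPeriod (N.step g) y := by
    intro y
    apply Function.IsPeriodicPt.minimalPeriod_dvd
    have := N.iterate_glue hg (Function.minimalPeriod (N.step g) y) y
    rwa [Function.iterate_minimalPeriod] at this
  have h1 := h (g x)
  rw [hg] at h1
  have h2 := N.walkSum_reverse hg x (Function.minimalPeriod (N.step g) x)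
  rw [Function.iterate_minimalPeriod] at h2
  rw [holonomy, Nat.dvd_antisymm (h x) h1, h2, holonomy]

/-- One period plus one step can be cut after its first pair or before its last one; these two pairs
coincide. -/
lemma holonomy_step [Finite X] (x : X) : N.holonomy g (N.step g x) = N.holonomy g x := by
  have hx : x ∈ Function.periodicPts (N.step g) :=
    Function.minimalPeriod_pos_iff_mem_periodicPts.1 (N.minimalPeriod_pos hg x)
  have h1 := N.walkSum_add g x 1 (Function.minimalPeriod (N.step g) x)
  rw [Nat.add_comm, walkSum_add, Function.iterate_minimalPeriod, add_comm] at h1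
  rw [holonomy, Function.minimalPeriod_apply hx]
  exact (add_left_cancel h1).symm

lemma holonomy_iterate [Finite X] (x : X) (k : ℕ) :
    N.holonomy g ((N.step g)^[k] x) = N.holonomy g x := by
  induction k with
  | zero => rfl
  | succ k ih => rw [Function.iterate_succ_apply', N.holonomy_step hg, ih]

/-- Moving along the walk preserves the holonomy and reversing the direction negates it, which is
why `value` takes an absolute value. -/
lemma value_conn [Finite X] {x y : X} (h : N.Conn g x y) : N.value g x = N.value g y := by
  obtain ⟨k, h | h⟩ := h
  · rw [← h, value, value, N.holonomy_iterate hg]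
  · have := N.holonomy_iterate hg x k
    rw [h, N.holonomy_glue hg] at this
    rw [value, value, ← this, Int.natAbs_neg]

/-- Sending each representative to the one connected with it is a bijection that preserves values.
This frees the cycle products from the choice of smallest columns. -/
lemma prod_transversal [Finite X] {S S' : Finset X} (hS : N.IsTransversal g S)
    (hS' : N.IsTransversal g S') : ∏ x ∈ S, N.value g x = ∏ x ∈ S', N.value g x := by
  choose i hi hc using fun x (hx : x ∈ S) => hS'.exists_conn x (hS.isClosed x hx)
  refine prod_bij i hi ?_ ?_ ?_
  · intro a ha b hb hab
    have h := hc b hb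
    rw [← hab] at h
    exact hS.eq_of_conn a ha b hb (((hc a ha).symm hg).trans hg h)
  · intro b hb
    obtain ⟨a, ha, hab⟩ := hS.exists_conn b (hS'.isClosed b hb)
    exact ⟨a, ha, hS'.eq_of_conn _ (hi a ha) _ hb ((hc a ha).trans hg hab)⟩
  · intro a ha
    exact (N.value_conn hg (hc a ha)).symm

end Basic

/-! ### Morphisms -/

section Hom

variable {N : Net X} {M : Net Y} {g : X → X} {h : Y → Y} {j : X → Y}
  (hm : ∀ x, M.mate (j x) = j (N.mate x)) (hh : ∀ x, h (j x) = j (g x))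
include hm hh

lemma iterate_hom (k : ℕ) (x : X) : (M.step h)^[k] (j x) = j ((N.step g)^[k] x) := by
  induction k with
  | zero => rfl
  | succ k ih => rw [Function.iterate_succ_apply', Function.iterate_succ_apply', ih, step, hm, hh]; rfl

variable (hj : Function.Injective j)
include hj

lemma isClosed_hom (x : X) : M.IsClosed h (j x) ↔ N.IsClosed g x := by
  simp only [IsClosed, iterate_hom hm hh, hh, hj.ne_iff]

lemma conn_hom (x y : X) : M.Conn h (j x) (j y) ↔ N.Conn g x y := by
  simp only [Conn, iterate_hom hm hh, hh, hj.eq_iff]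

lemma value_hom (ha : ∀ x, M.angle (j x) = N.angle x) (x : X) :
    M.value h (j x) = N.value g x := by
  have h1 : Function.minimalPeriod (M.step h) (j x) = Function.minimalPeriod (N.step g) x := by
    apply Nat.dvd_antisymm <;> apply Function.IsPeriodicPt.minimalPeriod_dvd
    · rw [Function.IsPeriodicPt, Function.IsFixedPt, iterate_hom hm hh,
        Function.iterate_minimalPeriod]
    · apply hj
      rw [← iterate_hom hm hh, Function.iterate_minimalPeriod]
  simp only [value, holonomy, walkSum, h1, iterate_hom hm hh, ha]

/-- The hypothesis `hc` ensures that the points missed by the embedding lie on no closed component,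
so none is lost. -/
lemma IsTransversal.image [DecidableEq Y] (hc : ∀ y, (¬ ∃ x, j x = y) → ¬ M.IsClosed h y)
    {S : Finset X} (hS : N.IsTransversal g S) : M.IsTransversal h (S.image j) where
  isClosed := by
    simp only [mem_image]
    rintro _ ⟨x, hx, rfl⟩
    exact (isClosed_hom hm hh hj x).2 (hS.isClosed x hx)
  exists_conn y hy := by
    by_cases h1 : ∃ x, j x = y
    · obtain ⟨x, rfl⟩ := h1
      obtain ⟨w, hw, hwx⟩ := hS.exists_conn x ((isClosed_hom hm hh hj x).1 hy)
      exact ⟨j w, mem_image_of_mem j hw, (conn_hom hm hh hj w x).2 hwx⟩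
    · exact absurd hy (hc y h1)
  eq_of_conn := by
    simp only [mem_image]
    rintro _ ⟨x, hx, rfl⟩ _ ⟨y, hy, rfl⟩ hxy
    rw [hS.eq_of_conn x hx y hy ((conn_hom hm hh hj x y).1 hxy)]

lemma prod_value_image [DecidableEq Y] (ha : ∀ x, M.angle (j x) = N.angle x) (S : Finset X) :
    ∏ y ∈ S.image j, M.value h y = ∏ x ∈ S, N.value g x := by
  rw [prod_image hj.injOn]
  exact prod_congr rfl fun x _ => value_hom hm hh hj ha x

end Hom

/-! ### Arcs -/

/-- `N.Arc g x w s`: the walk that starts at `x` meets a point fixed by `g` for the first time (after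
traversing at least one pair) at `w`, and `s` is the sum of the angles along it. -/
inductive Arc (N : Net X) (g : X → X) : X → X → ℤ → Prop
  | last {x w : X} {s : ℤ} : N.mate x = w → g w = w → N.angle x = s → Arc N g x w s
  | cons {x y w : X} {s t : ℤ} : g (N.mate x) = y → y ≠ N.mate x → Arc N g y w s →
      N.angle x + s = t → Arc N g x w t

lemma Arc.fixed {N : Net X} {g : X → X} {x w : X} {s : ℤ} (h : N.Arc g x w s) : g w = w := by
  induction h with
  | last _ h _ => exact h
  | cons _ _ _ _ ih => exact ih

/-- A walk is deterministic. Hence exhibiting any derivation of `Arc` computes the end and the angle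
of an arc; all explicit products below are obtained in this way. -/
lemma Arc.unique {N : Net X} {g : X → X} {x w w' : X} {s s' : ℤ} (h : N.Arc g x w s)
    (h' : N.Arc g x w' s') : w = w' ∧ s = s' := by
  induction h generalizing s' with
  | last h1 h2 h3 =>
    cases h' with
    | last k1 k2 k3 => exact ⟨h1.symm.trans k1, h3.symm.trans k3⟩
    | cons k1 k2 _ _ => subst h1 k1; exact absurd h2 k2
  | cons h1 h2 _ h3 ih =>
    cases h' with
    | last k1 k2 k3 => subst h1 k1; exact absurd k2 h2
    | cons k1 k2 k3 k4 =>
      subst h1 k1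
      obtain ⟨rfl, rfl⟩ := ih k3
      exact ⟨rfl, h3.symm.trans k4⟩

lemma Arc.map {N : Net X} {M : Net Y} {g : X → X} {h : Y → Y} {j : X → Y}
    (hm : ∀ x, M.mate (j x) = j (N.mate x)) (hh : ∀ x, h (j x) = j (g x))
    (hj : Function.Injective j) (ha : ∀ x, M.angle (j x) = N.angle x) {x w : X} {s : ℤ}
    (H : N.Arc g x w s) : M.Arc h (j x) (j w) s := by
  induction H with
  | last h1 h2 h3 => exact .last (by rw [hm, h1]) (by rw [hh, h2]) (by rw [ha, h3])
  | cons h1 h2 _ h3 ih =>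
    exact .cons (by rw [hm, hh, h1]) (by rw [hm, hj.ne_iff]; exact h2) ih (by rw [ha, h3])

/-- The net `M` arises from `N` by gluing the points not fixed by `g`; the map `e` embeds the points
of `M` as the fixed points of `g`. -/
structure IsReduction (N : Net X) (g : X → X) (M : Net Y) (e : Y → X) : Prop where
  injective : Function.Injective e
  fixed_iff : ∀ x, g x = x ↔ ∃ y, e y = x
  arc : ∀ y, N.Arc g (e y) (e (M.mate y)) (M.angle y)

lemma IsReduction.unique {N : Net X} {g : X → X} {M M' : Net Y} {e : Y → X}
    (h : N.IsReduction g M e) (h' : N.IsReduction g M' e) (y : Y) :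
    M.mate y = M'.mate y ∧ M.angle y = M'.angle y := by
  obtain ⟨h1, h2⟩ := (h.arc y).unique (h'.arc y)
  exact ⟨h.injective h1, h2⟩

/-! ### Gluing in two stages -/

section Stage

set_option linter.unusedSectionVars false

variable {N : Net X} {g₁ g : X → X} {M : Net Y} {h : Y → Y} {e : Y → X}
  (hred : N.IsReduction g₁ M e) (h₁ : ∀ x, g₁ (g₁ x) = x)
  (hg₁ : ∀ x, g₁ x ≠ x → g x = g₁ x) (hg₂ : ∀ y, g (e y) = e (h y))

include h₁ hg₁

/-- Here `g` refines the first-stage gluing `g₁`: they agree wherever `g₁` glues, so an arc for `g₁`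
is an initial piece of a walk for `g`. -/
lemma Arc.extend_last {x w : X} {s : ℤ} (H : N.Arc g₁ x w s) (hw : g w = w) : N.Arc g x w s := by
  induction H with
  | last a _ b => exact .last a hw b
  | cons a b _ c ih => exact .cons (by rw [hg₁ _ (a ▸ b), a]) b (ih hw) c

lemma Arc.extend_cons {x w w' : X} {s s' : ℤ} (H : N.Arc g₁ x w s) (hw : g w ≠ w)
    (H' : N.Arc g (g w) w' s') : N.Arc g x w' (s + s') := by
  induction H with
  | last a _ b => exact .cons (by rw [a]) (by rwa [a]) H' (by rw [b])
  | cons a b _ c ih =>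
    exact .cons (by rw [hg₁ _ (a ▸ b), a]) b (ih hw H') (by rw [← c, add_assoc])

/-- The final clause makes `L` the length of one block: the walk for `g` visits no point left free
by `g₁` strictly inside it. -/
lemma Arc.iterate {x w : X} {s : ℤ} (H : N.Arc g₁ x w s) :
    ∃ L, 0 < L ∧ (N.step g)^[L] x = g w ∧ N.walkSum g x L = s ∧
      ∀ i, 0 < i → i < L → g₁ ((N.step g)^[i] x) ≠ (N.step g)^[i] x := by
  induction H with
  | @last x w s a _ b => exact ⟨1, one_pos, by simp [step, a], by rw [walkSum_one, b], by omega⟩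
  | @cons x y w s t a b _ c ih =>
    obtain ⟨L, _, h2, h3, h4⟩ := ih
    have hstep : N.step g x = y := by rw [step, hg₁ _ (a ▸ b), a]
    refine ⟨L + 1, by omega, by rw [Function.iterate_succ_apply, hstep, h2], ?_, ?_⟩
    · rw [Nat.add_comm, walkSum_add, walkSum_one, Function.iterate_one, hstep, h3, c]
    · intro i hi hi'
      obtain ⟨i, rfl⟩ := Nat.exists_eq_succ_of_ne_zero hi.ne'
      rw [Function.iterate_succ_apply, hstep]
      rcases Nat.eq_zero_or_pos i with rfl | h0
      · change g₁ y ≠ y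
        rw [← a, h₁, a]
        exact b.symm
      · exact h4 i h0 (by omega)

lemma iterate_of_isClosed {x : X} (hx : N.IsClosed g₁ x) (i : ℕ) :
    (N.step g)^[i] x = (N.step g₁)^[i] x := by
  induction i with
  | zero => rfl
  | succ i ih =>
    rw [Function.iterate_succ_apply', Function.iterate_succ_apply', ih, step, step]
    apply hg₁
    intro hc
    apply hx (i + 1)
    rw [Function.iterate_succ_apply', step, hc, hc]

lemma value_of_isClosed {x : X} (hx : N.IsClosed g₁ x) : N.value g x = N.value g₁ x := by
  have h1 : Function.minimalPeriod (N.step g) x = Function.minimalPeriod (N.step g₁) x := by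
    apply Nat.dvd_antisymm <;> apply Function.IsPeriodicPt.minimalPeriod_dvd
    · rw [Function.IsPeriodicPt, Function.IsFixedPt, iterate_of_isClosed h₁ hg₁ hx,
        Function.iterate_minimalPeriod]
    · rw [Function.IsPeriodicPt, Function.IsFixedPt, ← iterate_of_isClosed h₁ hg₁ hx,
        Function.iterate_minimalPeriod]
  simp only [value, holonomy, walkSum, h1, iterate_of_isClosed h₁ hg₁ hx]

lemma conn_of_isClosed {x y : X} (hx : N.IsClosed g₁ x) (hy : N.IsClosed g₁ y) :
    N.Conn g x y ↔ N.Conn g₁ x y := by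
  simp only [Conn, iterate_of_isClosed h₁ hg₁ hx, hg₁ y (hy 0)]

include hred hg₂

lemma IsReduction.fixed_of_fixed {x : X} (hx : g x = x) : ∃ y, e y = x ∧ h y = y := by
  have h1 : g₁ x = x := by
    by_contra hc
    exact hc (hg₁ x hc ▸ hx)
  obtain ⟨y, rfl⟩ := (hred.fixed_iff x).1 h1
  rw [hg₂] at hx
  exact ⟨y, rfl, hred.injective hx⟩

/-- Each pair of `M` is an arc of `N` for `g₁`; replacing the pairs of an arc of `M` by these arcs
gives an arc of `N` for `g`. -/
lemma IsReduction.trans {K : Net Z} {e' : Z → Y} (hred' : M.IsReduction h K e') :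
    N.IsReduction g K (e ∘ e') where
  injective := hred.injective.comp hred'.injective
  fixed_iff x := by
    constructor
    · intro hx
      obtain ⟨y, rfl, hy⟩ := hred.fixed_of_fixed h₁ hg₁ hg₂ hx
      obtain ⟨w, rfl⟩ := (hred'.fixed_iff y).1 hy
      exact ⟨w, rfl⟩
    · rintro ⟨w, rfl⟩
      rw [Function.comp_apply, hg₂, (hred'.fixed_iff _).2 ⟨w, rfl⟩]
  arc w := by
    have key : ∀ y y' s, M.Arc h y y' s → N.Arc g (e y) (e y') s := by
      intro y y' s H
      induction H with
      | @last x w s a b c =>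
        subst a c
        exact (hred.arc x).extend_last h₁ hg₁ (by rw [hg₂, b])
      | @cons x y w s t a b _ c ih =>
        subst a c
        refine (hred.arc x).extend_cons h₁ hg₁ ?_ ?_
        · rw [hg₂, hred.injective.ne_iff]; exact b
        · rw [hg₂]; exact ih
    exact key _ _ _ (hred'.arc w)

lemma IsReduction.exists_step (y : Y) :
    ∃ L, 0 < L ∧ (N.step g)^[L] (e y) = e (M.step h y) ∧ N.walkSum g (e y) L = M.angle y ∧
      ∀ i, 0 < i → i < L → g₁ ((N.step g)^[i] (e y)) ≠ (N.step g)^[i] (e y) := by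
  obtain ⟨L, h1, h2, h3, h4⟩ := (hred.arc y).iterate h₁ hg₁
  exact ⟨L, h1, by rw [h2, hg₂, step], h3, h4⟩

lemma IsReduction.iterate_up (j : ℕ) (y : Y) :
    ∃ k, (0 < j → 0 < k) ∧ (N.step g)^[k] (e y) = e ((M.step h)^[j] y) ∧
      N.walkSum g (e y) k = M.walkSum h y j := by
  induction j generalizing y with
  | zero => exact ⟨0, id, rfl, by simp [walkSum]⟩
  | succ j ih =>
    obtain ⟨L, h1, h2, h3, _⟩ := hred.exists_step h₁ hg₁ hg₂ y
    obtain ⟨k, _, k2, k3⟩ := ih (M.step h y)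
    refine ⟨L + k, by omega, ?_, ?_⟩
    · rw [Nat.add_comm, Function.iterate_add_apply, h2, k2, Function.iterate_succ_apply]
    · rw [walkSum_add, h2, h3, k3, Nat.add_comm j, walkSum_add, walkSum_one, Function.iterate_one]

/-- A walk of `N` between points of `M` splits into whole blocks, one for each step in `M`; the
induction peels off the first block. -/
lemma IsReduction.iterate_down (k : ℕ) (y y' : Y) (hk : (N.step g)^[k] (e y) = e y') :
    ∃ j, (0 < k → 0 < j) ∧ (M.step h)^[j] y = y' ∧
      N.walkSum g (e y) k = M.walkSum h y j := by
  induction k using Nat.strong_induction_on generalizing y with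
  | _ k ih =>
    rcases Nat.eq_zero_or_pos k with rfl | hpos
    · exact ⟨0, id, hred.injective hk, by simp [walkSum]⟩
    obtain ⟨L, h1, h2, h3, h4⟩ := hred.exists_step h₁ hg₁ hg₂ y
    -- The endpoint `e y'` is fixed by `g₁` and no interior point of a block is, so the walk cannot
    -- stop inside the first block.
    have hL : L ≤ k := by
      by_contra! hc
      exact h4 k hpos hc (by rw [hk]; exact (hred.fixed_iff _).2 ⟨_, rfl⟩)
    obtain ⟨k, rfl⟩ := Nat.exists_eq_add_of_le hL
    rw [Nat.add_comm, Function.iterate_add_apply, h2] at hk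
    obtain ⟨j, _, j2, j3⟩ := ih k (by omega) (M.step h y) hk
    refine ⟨j + 1, by omega, by rw [Function.iterate_succ_apply, j2], ?_⟩
    rw [walkSum_add, h2, h3, j3, Nat.add_comm j, walkSum_add, walkSum_one, Function.iterate_one]

lemma IsReduction.isClosed_iff (y : Y) : N.IsClosed g (e y) ↔ M.IsClosed h y := by
  constructor
  · intro H j hj
    obtain ⟨k, _, k2, _⟩ := hred.iterate_up h₁ hg₁ hg₂ j y
    exact H k (by rw [k2, hg₂, hj])
  · intro H k hk
    obtain ⟨y', hy', hh⟩ := hred.fixed_of_fixed h₁ hg₁ hg₂ hk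
    obtain ⟨j, _, j2, _⟩ := hred.iterate_down h₁ hg₁ hg₂ k y y' hy'.symm
    exact H j (by rw [j2, hh])

lemma IsReduction.conn_iff (y y' : Y) : N.Conn g (e y) (e y') ↔ M.Conn h y y' := by
  constructor
  · rintro ⟨k, hk | hk⟩
    · obtain ⟨j, _, j2, _⟩ := hred.iterate_down h₁ hg₁ hg₂ k y _ hk
      exact ⟨j, Or.inl j2⟩
    · obtain ⟨j, _, j2, _⟩ := hred.iterate_down h₁ hg₁ hg₂ k y _ (hk.trans (hg₂ _))
      exact ⟨j, Or.inr j2⟩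
  · rintro ⟨j, hj⟩
    obtain ⟨k, _, k2, _⟩ := hred.iterate_up h₁ hg₁ hg₂ j y
    refine ⟨k, ?_⟩
    rw [k2, hg₂]
    exact hj.imp (congrArg e) (congrArg e)

/-- This gives the dichotomy behind two-stage gluing: a component is either already closed for `g₁`
or passes through a point of `M`. -/
lemma IsReduction.exists_iterate_of_not_isClosed {x : X} (hx : ¬ N.IsClosed g₁ x) :
    ∃ k y, (N.step g)^[k] x = e y := by
  simp only [IsClosed, not_forall, not_not] at hx
  obtain ⟨i, hi⟩ := hx
  induction i generalizing x with
  | zero =>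
    obtain ⟨y, hy⟩ := (hred.fixed_iff x).1 hi
    exact ⟨0, y, hy.symm⟩
  | succ i ih =>
    by_cases hc : g₁ (N.mate x) = N.mate x
    · obtain ⟨y, hy⟩ := (hred.fixed_iff _).1 hc
      exact ⟨1, h y, by rw [Function.iterate_one, step, ← hy, hg₂]⟩
    · have hs : N.step g x = N.step g₁ x := hg₁ _ hc
      rw [Function.iterate_succ_apply] at hi
      obtain ⟨k, y, hk⟩ := ih hi
      exact ⟨k + 1, y, by rw [Function.iterate_succ_apply, hs, hk]⟩

variable (hg : ∀ x, g (g x) = x)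
include hg

lemma IsReduction.glue_glue (y : Y) : h (h y) = y := by
  apply hred.injective
  rw [← hg₂, ← hg₂, hg]

/-- Without matching the minimal periods directly: a period in `N` covers `c` periods in `M`, and a
period in `M` covers `d` periods in `N`. The holonomies thus satisfy `H = c H'` and `H' = d H`, so
either `c d = 1` or both vanish. -/
lemma IsReduction.value_eq [Finite X] [Finite Y] (y : Y) : N.value g (e y) = M.value h y := by
  obtain ⟨j, j1, j2, j3⟩ := hred.iterate_down h₁ hg₁ hg₂ (Function.minimalPeriod (N.step g) (e y)) y
    y Function.iterate_minimalPeriod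
  obtain ⟨k, k1, k2, k3⟩ := hred.iterate_up h₁ hg₁ hg₂ (Function.minimalPeriod (M.step h) y) y
  rw [Function.iterate_minimalPeriod] at k2
  obtain ⟨c, rfl⟩ := Function.IsPeriodicPt.minimalPeriod_dvd j2
  obtain ⟨d, rfl⟩ := Function.IsPeriodicPt.minimalPeriod_dvd k2
  have j1 := j1 (N.minimalPeriod_pos hg _)
  have k1 := k1 (M.minimalPeriod_pos (hred.glue_glue h₁ hg₁ hg₂ hg) _)
  have hc : 0 < c := Nat.pos_of_mul_pos_left j1
  have hd : 0 < d := Nat.pos_of_mul_pos_left k1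
  rw [mul_comm, walkSum_mul _ _ _ Function.iterate_minimalPeriod] at j3 k3
  change N.holonomy g (e y) = c * M.holonomy h y at j3
  change d * N.holonomy g (e y) = M.holonomy h y at k3
  have : N.holonomy g (e y) = M.holonomy h y := by
    rw [← k3] at j3 ⊢
    have hcd : ((c : ℤ) * d - 1) * N.holonomy g (e y) = 0 := by linear_combination -j3
    rcases mul_eq_zero.1 hcd with h0 | h0
    · have : c * d = 1 := by zify; linarith
      rw [Nat.eq_one_of_mul_eq_one_left this]
      simp
    · rw [h0, mul_zero]
  rw [value, value, this]

theorem IsReduction.isTransversal_union [Finite X] [DecidableEq X] {S : Finset X} {S' : Finset Y}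
    (hS : N.IsTransversal g₁ S) (hS' : M.IsTransversal h S') :
    N.IsTransversal g (S ∪ S'.image e) := by
  have cl : ∀ x, N.IsClosed g₁ x → N.IsClosed g x := by
    intro x hx i hi
    obtain ⟨y, hy, _⟩ := hred.fixed_of_fixed h₁ hg₁ hg₂ hi
    rw [iterate_of_isClosed h₁ hg₁ hx] at hy
    exact hx i ((hred.fixed_iff _).2 ⟨y, hy⟩)
  -- A walk closed at the first stage stays away from the fixed points of `g₁`, hence from the
  -- points of `M`; the two families of components are disjoint.
  have sep : ∀ x y, N.IsClosed g₁ x → ¬ N.Conn g x (e y) := by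
    rintro x y hx ⟨k, hk⟩
    rw [iterate_of_isClosed h₁ hg₁ hx, hg₂] at hk
    exact hx k ((hred.fixed_iff _).2 (hk.elim (fun h => ⟨_, h.symm⟩) (fun h => ⟨_, h.symm⟩)))
  refine ⟨?_, ?_, ?_⟩
  · simp only [mem_union, mem_image]
    rintro x (hx | ⟨y, hy, rfl⟩)
    · exact cl x (hS.isClosed x hx)
    · exact (hred.isClosed_iff h₁ hg₁ hg₂ y).2 (hS'.isClosed y hy)
  · intro x hx
    by_cases hx₁ : N.IsClosed g₁ x
    · obtain ⟨y, hy, hyx⟩ := hS.exists_conn x hx₁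
      exact ⟨y, mem_union_left _ hy,
        (conn_of_isClosed h₁ hg₁ (hS.isClosed y hy) hx₁).2 hyx⟩
    · obtain ⟨k, y, hk⟩ := hred.exists_iterate_of_not_isClosed h₁ hg₁ hg₂ hx₁
      have hc : N.Conn g x (e y) := ⟨k, Or.inl hk⟩
      obtain ⟨w, hw, hwy⟩ := hS'.exists_conn y
        ((hred.isClosed_iff h₁ hg₁ hg₂ y).1 (hx.of_conn hg hc))
      exact ⟨e w, mem_union_right _ (mem_image_of_mem e hw),
        ((hred.conn_iff h₁ hg₁ hg₂ _ _).2 hwy).trans hg (hc.symm hg)⟩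
  · simp only [mem_union, mem_image]
    rintro x (hx | ⟨y, hy, rfl⟩) x' (hx' | ⟨y', hy', rfl⟩) hxx'
    · exact hS.eq_of_conn x hx x' hx' ((conn_of_isClosed h₁ hg₁ (hS.isClosed x hx)
        (hS.isClosed x' hx')).1 hxx')
    · exact absurd hxx' (sep _ _ (hS.isClosed x hx))
    · exact absurd (hxx'.symm hg) (sep _ _ (hS.isClosed x' hx'))
    · rw [hS'.eq_of_conn y hy y' hy' ((hred.conn_iff h₁ hg₁ hg₂ _ _).1 hxx')]

theorem IsReduction.prod_union [Finite X] [Finite Y] [DecidableEq X] {S : Finset X} {S' : Finset Y}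
    (hS : N.IsTransversal g₁ S) :
    ∏ x ∈ S ∪ S'.image e, N.value g x = (∏ x ∈ S, N.value g₁ x) * ∏ y ∈ S', M.value h y := by
  rw [Finset.prod_union, prod_image hred.injective.injOn]
  · congr 1
    · exact prod_congr rfl fun x hx => value_of_isClosed h₁ hg₁ (hS.isClosed x hx)
    · exact prod_congr rfl fun y _ => hred.value_eq h₁ hg₁ hg₂ hg y
  · rw [disjoint_left]
    intro x hx hx'
    obtain ⟨y, _, rfl⟩ := mem_image.1 hx'
    exact hS.isClosed _ hx 0 ((hred.fixed_iff _).2 ⟨y, rfl⟩)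

end Stage

/-! ### Transversals given by columns -/

/-- This matches the smallest-column convention with transversals. Each column has at most the two
glued points `s b` and `g (s b)`, which are connected, so a closed component contains `s b` for its
smallest column `b`, up to orientation. -/
theorem isTransversal_columns {n : ℕ} [Finite X] [DecidableEq X] (N : Net X) {g : X → X}
    (hg : ∀ x, g (g x) = x) (col : X → Fin n) (s : Fin n → X) (hcol : ∀ x, col (g x) = col x)
    (hs : ∀ b, col (s b) = b) (hx : ∀ x, g x ≠ x → x = s (col x) ∨ x = g (s (col x)))
    (P : Fin n → Prop) [DecidablePred P]
    (hP : ∀ b, P b ↔ N.IsClosed g (s b) ∧ ∀ i, 0 < i →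
      i < Function.minimalPeriod (N.step g) (s b) → b < col ((N.step g)^[i] (s b))) :
    N.IsTransversal g ((univ.filter P).image s) := by
  have hmin : ∀ b, P b → ∀ x, N.Conn g (s b) x → b ≤ col x := by
    intro b hb x hc
    obtain ⟨h1, h2⟩ := (hP b).1 hb
    have key : ∀ k, b ≤ col ((N.step g)^[k] (s b)) := by
      intro k
      rw [← Function.iterate_mod_minimalPeriod_eq]
      rcases Nat.eq_zero_or_pos (k % Function.minimalPeriod (N.step g) (s b)) with h0 | h0
      · rw [h0]; exact (hs b).ge
      · exact (h2 _ h0 (Nat.mod_lt _ (N.minimalPeriod_pos hg _))).le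
    obtain ⟨k, hk | hk⟩ := hc
    · rw [← hk]; exact key k
    · rw [← hcol x, ← hk]; exact key k
  refine ⟨?_, ?_, ?_⟩
  · simp only [mem_image, mem_filter, mem_univ, true_and]
    rintro _ ⟨b, hb, rfl⟩
    exact ((hP b).1 hb).1
  · intro x hxc
    obtain ⟨b, ⟨y, hxy, rfl⟩, hb⟩ := WellFounded.has_min (wellFounded_lt (α := Fin n))
      {b | ∃ y, N.Conn g x y ∧ col y = b} ⟨_, x, Conn.refl N g x, rfl⟩
    have hy := hxc.of_conn hg hxy
    have hsy : N.Conn g x (s (col y)) := by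
      rcases hx y (hy 0) with h | h
      · rwa [← h]
      · refine hxy.trans hg ⟨0, Or.inr h⟩
    refine ⟨s (col y), ?_, hsy.symm hg⟩
    simp only [mem_image, mem_filter, mem_univ, true_and]
    refine ⟨col y, (hP _).2 ⟨hxc.of_conn hg hsy, fun i hi hi' => ?_⟩, rfl⟩
    have hsc := hxc.of_conn hg hsy
    -- A second visit to the smallest column would be at `s b`, contradicting the minimal period, or
    -- at `g (s b)`, contradicting `IsClosed.iterate_ne`.
    refine lt_of_le_of_ne (not_lt.1 (hb _ ⟨_, hsy.trans hg ⟨i, Or.inl rfl⟩, rfl⟩)) fun heq => ?_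
    rcases hx _ (hsc i) with h | h <;> rw [← heq] at h
    · exact Function.not_isPeriodicPt_of_pos_of_lt_minimalPeriod hi.ne' hi' h
    · exact hsc.iterate_ne hg i h
  · simp only [mem_image, mem_filter, mem_univ, true_and]
    rintro _ ⟨b, hb, rfl⟩ _ ⟨c, hc, rfl⟩ hbc
    have h1 := hmin b hb _ hbc
    have h2 := hmin c hc _ (hbc.symm hg)
    rw [hs] at h1 h2
    rw [le_antisymm h1 h2]

/-- The disjoint union of two nets. -/
def sum (N : Net X) (M : Net Y) : Net (X ⊕ Y) where
  mate := Sum.map N.mate M.mate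
  angle := Sum.elim N.angle M.angle
  mate_mate := by rintro (x | x) <;> simp [N.mate_mate, M.mate_mate]
  mate_ne := by rintro (x | x) <;> simp [N.mate_ne, M.mate_ne]
  angle_mate := by rintro (x | x) <;> simp [N.angle_mate, M.angle_mate]

end Net

/-! ## Signed labels -/

/-- The sign of a row. -/
def rowSign (a : Bool) : ℤ := if a then -1 else 1

lemma rowSign_mul_self (a : Bool) : rowSign a * rowSign a = 1 := by cases a <;> rfl

lemma rowSign_not (a : Bool) : rowSign (!a) = -rowSign a := by cases a <;> rfl

lemma natAbs_rowSign_mul (a : Bool) (k : ℤ) : (rowSign a * k).natAbs = k.natAbs := by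
  cases a <;> simp [rowSign]

namespace Diagram

variable {X : Type} (D : Diagram X)

/-- The sign relating labels to angles. -/
def sign (x : X) : ℤ := rowSign (D.row x) * if D.rank x < D.rank (D.mate x) then 1 else D.parity x

/-- The label of the pair of `x`, with a sign depending on the direction in which it is traversed. -/
def angle (x : X) : ℤ := D.sign x * D.label x

lemma sign_mul_self (x : X) : D.sign x * D.sign x = 1 := by
  unfold sign rowSign parity
  split_ifs <;> rfl

lemma parity_eq (x : X) : D.parity x = -(rowSign (D.row x) * rowSign (D.row (D.mate x))) := by
  unfold parity
  cases D.row x <;> cases D.row (D.mate x) <;> rfl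

/-- By `parity_eq` and the change of row at each crossing, the parities of the pairs before number
`i` multiply to the row sign at `x 0` times that at `x i`. The second factor is absorbed into
`sign`, and the first one comes out of the sum. -/
lemma weight_eq {x : ℕ → X} {l : ℕ}
    (hx : ∀ i, i + 1 < l → D.row (x (i + 1)) = !D.row (D.mate (x i))) :
    D.weight x l = rowSign (D.row (x 0)) * ∑ i ∈ range l, D.angle (x i) := by
  have key : ∀ i < l, ∏ j ∈ range i, D.parity (x j) =
      rowSign (D.row (x 0)) * rowSign (D.row (x i)) := by
    intro i hi
    induction i with
    | zero => simp [rowSign_mul_self]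
    | succ i ih =>
      rw [prod_range_succ, ih (by omega), hx i hi, rowSign_not, parity_eq]
      linear_combination -rowSign (D.row (x 0)) * rowSign (D.row (D.mate (x i))) *
        rowSign_mul_self (D.row (x i))
  rw [weight, mul_sum]
  refine sum_congr rfl fun i hi => ?_
  have hi := mem_range.1 hi
  unfold cumParity angle sign
  rw [prod_range_succ, key i hi]
  split_ifs <;> ring

end Diagram

/-! ## The net of a tangle -/

lemma ArrowTangle.angle_diagram {n : ℕ} (F : ArrowTangle n) (v : Vertex n) :
    F.diagram.angle v = (rowSign v.1 * if rank v < rank (F.mate v) then 1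
      else -(rowSign v.1 * rowSign (F.mate v).1)) * F.label v := by
  rw [Diagram.angle, Diagram.sign, Diagram.parity_eq]
  rfl

/-- The net of an arrow flat tangle. -/
def ArrowTangle.net {n : ℕ} (F : ArrowTangle n) : Net (Vertex n) where
  mate := F.mate
  angle := F.diagram.angle
  mate_mate := F.mate_mate
  mate_ne := F.mate_ne
  angle_mate v := by
    have h : rank (F.mate v) ≠ rank v := fun h => F.mate_ne v (rank_injective h)
    have h1 := rowSign_mul_self (F.mate v).1
    have h2 := rowSign_mul_self v.1
    rw [F.angle_diagram, F.angle_diagram, F.mate_mate, F.label_mate]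
    split_ifs
    · omega
    · linear_combination -(rowSign (F.mate v).1 * F.label v) * h2
    · linear_combination -(rowSign v.1 * F.label v) * h1
    · omega

/-- The sign relating label and angle depends only on the pairing and squares to 1, so the angles
determine the labels. -/
lemma ArrowTangle.ext_net {n : ℕ} {F G : ArrowTangle n}
    (h : ∀ v, F.net.mate v = G.net.mate v ∧ F.net.angle v = G.net.angle v) : F = G := by
  have hm : F.mate = G.mate := funext fun v => (h v).1
  have hs : ∀ v, F.diagram.sign v = G.diagram.sign v := by
    intro v
    rw [Diagram.sign, Diagram.sign, Diagram.parity_eq, Diagram.parity_eq]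
    change (rowSign v.1 * if rank v < rank (F.mate v) then 1
      else -(rowSign v.1 * rowSign (F.mate v).1)) = _
    rw [hm]
    rfl
  refine ArrowTangle.ext hm (funext fun v => ?_)
  have h1 : F.diagram.sign v * F.label v = G.diagram.sign v * G.label v := (h v).2
  have h2 := F.diagram.sign_mul_self v
  rw [← hs] at h1
  linear_combination F.diagram.sign v * h1 - (F.label v - G.label v) * h2

/-- The net formed by two tangles on top of each other. -/
def stackNet {n : ℕ} (F F' : ArrowTangle n) : Net (Vertex n ⊕ Vertex n) := F.net.sum F'.net

/-- The jump to the other row of the same column. -/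
def flipRow {n : ℕ} (v : Vertex n) : Vertex n := (!v.1, v.2)

lemma flipRow_flipRow {n : ℕ} (v : Vertex n) : flipRow (flipRow v) = v := by simp [flipRow]

lemma flipRow_ne {n : ℕ} (v : Vertex n) : flipRow v ≠ v := by simp [flipRow, Prod.ext_iff]

lemma outer_injective {n : ℕ} : Function.Injective (outer : Vertex n → _) := by
  intro v w h
  rw [← elim_outer v, h, elim_outer]

lemma Net.Arc.of_iterate {X : Type} {N : Net X} {g : X → X} (hg : ∀ x, g (g x) = x) {L : ℕ}
    (hL : 0 < L) {x : X} (h : g ((N.step g)^[L] x) = (N.step g)^[L] x)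
    (hi : ∀ i, 0 < i → i < L → g ((N.step g)^[i] x) ≠ (N.step g)^[i] x) :
    N.Arc g x ((N.step g)^[L] x) (N.walkSum g x L) := by
  induction L generalizing x with
  | zero => omega
  | succ L ih =>
    rcases Nat.eq_zero_or_pos L with rfl | h0
    · rw [Function.iterate_one, step, hg] at h
      rw [walkSum_one, zero_add, Function.iterate_one, step, ← h]
      exact .last rfl (by rw [← h]) rfl
    · rw [Nat.add_comm L, walkSum_add, walkSum_one, Nat.add_comm 1, Function.iterate_succ_apply]
      refine .cons rfl ?_ (ih h0 h fun i h1 h2 => ?_) rfl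
      · have := hi 1 one_pos (by omega)
        rw [Function.iterate_one, step, hg] at this
        exact this.symm
      · exact hi (i + 1) (by omega) (by omega)

/-! ### Products and closures of tangles in terms of nets. -/

section Comp

variable {n : ℕ} (F F' : ArrowTangle n)

lemma angle_stack (x) : (stack F F').angle x = (stackNet F F').angle x := by
  rcases x with x | x <;> rfl

lemma weight_stack (x : Vertex n ⊕ Vertex n) (l : ℕ)
    (hx : ∀ i, 0 < i → i < l → ¬ IsOuter ((next F F')^[i] x)) :
    (stack F F').weight (fun i => (next F F')^[i] x) l =
      rowSign ((stack F F').row x) * (stackNet F F').walkSum glue x l := by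
  rw [Diagram.weight_eq]
  · congr 1
    exact sum_congr rfl fun i _ => angle_stack F F' _
  · intro i hi
    have h := hx (i + 1) (Nat.succ_pos i) hi
    simp only [Function.iterate_succ_apply'] at h ⊢
    rw [next, isOuter_glue] at h
    exact row_glue F F' _ h

/-- The label of a product is measured from the smaller end of an arc, while the angle is
directional. For a walk from the larger end, the extra parity in `angle_diagram` accounts for the
change of starting row and for the reversal of the sum. -/
lemma comp_isReduction : (stackNet F F').IsReduction glue (F.comp F').net outer where
  injective := outer_injective
  fixed_iff x := (isOuter_iff x).symm.trans ⟨fun ⟨v, h⟩ => ⟨v, h.symm⟩, fun ⟨v, h⟩ => ⟨v, h.symm⟩⟩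
  arc v := by
    have key : (F.comp F').net.angle v = (stackNet F F').walkSum glue (outer v) (arcLength F F' v) := by
      have hw : ∀ v, arcWeight F F' v =
          rowSign v.1 * (stackNet F F').walkSum glue (outer v) (arcLength F F' v) := by
        intro v
        rw [arcWeight, weight_stack F F' _ _ fun i h0 hi => not_isOuter F F' v h0 hi]
        congr 2
        rcases v with ⟨a, b⟩
        cases a <;> rfl
      have hrev := (stackNet F F').walkSum_reverse glue_glue (outer v) (arcLength F F' v)
      have h1 : ((stackNet F F').step glue)^[arcLength F F' v] (outer v) =
        outer (arcEnd F F' v) := (outer_arcEnd F F' v).symm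
      rw [h1, glue_outer] at hrev
      have hs := rowSign_mul_self v.1
      have hs' := rowSign_mul_self (arcEnd F F' v).1
      refine ((F.comp F').angle_diagram v).trans ?_
      simp only [ArrowTangle.comp, hw, arcLength_arcEnd, hrev]
      generalize Net.walkSum _ _ _ _ = W
      split_ifs
      · linear_combination W * hs
      · linear_combination W * hs * rowSign (arcEnd F F' v).1 * rowSign (arcEnd F F' v).1 + W * hs'
    obtain ⟨h0, h1⟩ := arcLength_spec F F' v
    have h := Net.Arc.of_iterate (N := stackNet F F') glue_glue h0 ((isOuter_iff _).1 h1)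
      fun i hi hi' => fun hc => not_isOuter F F' v hi hi' ((isOuter_iff _).2 hc)
    have h2 : ((stackNet F F').step glue)^[arcLength F F' v] (outer v) =
        outer ((F.comp F').net.mate v) := (outer_arcEnd F F' v).symm
    rwa [← key, h2] at h

variable {F F'}

lemma comp_eq_of_arc {v w : Vertex n} {s : ℤ}
    (h : (stackNet F F').Arc glue (outer v) (outer w) s) :
    (F.comp F').net.mate v = w ∧ (F.comp F').net.angle v = s := by
  obtain ⟨h1, h2⟩ := ((comp_isReduction F F').arc v).unique h
  exact ⟨outer_injective h1, h2⟩

variable (F F')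

/-- The row sign of the starting point, the only difference between weight and holonomy, disappears
in the absolute value. -/
lemma exists_transversal_stack : ∃ S, (stackNet F F').IsTransversal glue S ∧
    cycleFactor F F' = ∏ x ∈ S, (stackNet F F').value glue x := by
  classical
  have hP : ∀ b, IsCycle F F' b ↔ (stackNet F F').IsClosed glue (Sum.inl (true, b)) ∧ ∀ i, 0 < i →
      i < Function.minimalPeriod ((stackNet F F').step glue) (Sum.inl (true, b)) →
      b < Sum.elim Prod.snd Prod.snd (((stackNet F F').step glue)^[i] (Sum.inl (true, b))) := by
    intro b
    simp only [IsCycle, isOuter_iff]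
    rfl
  refine ⟨(univ.filter (IsCycle F F')).image fun b => Sum.inl (true, b),
    Net.isTransversal_columns _ glue_glue (Sum.elim Prod.snd Prod.snd) _ ?_ ?_ ?_ _ hP, ?_⟩
  · rintro (⟨a, b⟩ | ⟨a, b⟩) <;> cases a <;> rfl
  · intro b
    rfl
  · rintro (⟨a, b⟩ | ⟨a, b⟩) <;> cases a <;> simp [glue]
  · rw [cycleFactor, prod_image fun a _ b _ h => by simpa using h]
    refine prod_congr (by congr) fun b hb => ?_
    have hb := (mem_filter.1 hb).2
    rw [Net.value, cycleZigzag, weight_stack _ _ _ _ fun i _ _ => hb.1 i, natAbs_rowSign_mul]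
    rfl

lemma cycleFactor_eq {S} (hS : (stackNet F F').IsTransversal glue S) :
    cycleFactor F F' = ∏ x ∈ S, (stackNet F F').value glue x := by
  obtain ⟨S', h1, h2⟩ := exists_transversal_stack F F'
  rw [h2, Net.prod_transversal _ glue_glue h1 hS]

/-- Since `flipRow` has no fixed point, every component of a closure is closed. -/
lemma exists_transversal_closure : ∃ S, F.net.IsTransversal flipRow S ∧
    closureFactor F = ∏ x ∈ S, F.net.value flipRow x := by
  classical
  have hP : ∀ b, IsClosureCycle F b ↔ F.net.IsClosed flipRow (false, b) ∧ ∀ i, 0 < i →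
      i < Function.minimalPeriod (F.net.step flipRow) (false, b) →
      b < ((F.net.step flipRow)^[i] (false, b)).2 :=
    fun b => ⟨fun h => ⟨fun i => flipRow_ne _, h⟩, fun h => h.2⟩
  refine ⟨(univ.filter (IsClosureCycle F)).image fun b => (false, b),
    Net.isTransversal_columns _ flipRow_flipRow Prod.snd _ (fun _ => rfl) (fun _ => rfl) ?_ _ hP, ?_⟩
  · rintro ⟨a, b⟩
    cases a <;> simp [flipRow]
  · rw [closureFactor, prod_image fun a _ b _ h => by simpa using h]
    refine prod_congr (by congr) fun b hb => ?_
    rw [Net.value, closureZigzag, Diagram.weight_eq, natAbs_rowSign_mul]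
    · rfl
    · intro i _
      simp only [Function.iterate_succ_apply']
      rfl

lemma closureFactor_eq {S} (hS : F.net.IsTransversal flipRow S) :
    closureFactor F = ∏ x ∈ S, F.net.value flipRow x := by
  obtain ⟨S', h1, h2⟩ := exists_transversal_closure F
  rw [h2, Net.prod_transversal _ flipRow_flipRow h1 hS]

end Comp

/-! ### Reductions inside a disjoint union. -/

namespace Net

variable {X Y Z : Type}

lemma IsReduction.sum_left {N : Net X} {g : X → X} {M : Net Y} {e : Y → X}
    (h : N.IsReduction g M e) (K : Net Z) :
    (N.sum K).IsReduction (Sum.map g id) (M.sum K) (Sum.map e id) where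
  injective := h.injective.sumMap Function.injective_id
  fixed_iff := by rintro (x | x) <;> simp [h.fixed_iff]
  arc := by
    rintro (y | y)
    · exact (h.arc y).map (M := N.sum K) (j := Sum.inl) (fun _ => rfl) (fun _ => rfl)
        Sum.inl_injective fun _ => rfl
    · exact .last rfl rfl rfl

lemma IsReduction.sum_right {N : Net X} {g : X → X} {M : Net Y} {e : Y → X}
    (h : N.IsReduction g M e) (K : Net Z) :
    (K.sum N).IsReduction (Sum.map id g) (K.sum M) (Sum.map id e) where
  injective := Function.injective_id.sumMap h.injective
  fixed_iff := by rintro (x | x) <;> simp [h.fixed_iff]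
  arc := by
    rintro (y | y)
    · exact .last rfl rfl rfl
    · exact (h.arc y).map (M := K.sum N) (j := Sum.inr) (fun _ => rfl) (fun _ => rfl)
        Sum.inr_injective fun _ => rfl

end Net

/-! ## Associativity -/

section Assoc

variable {n : ℕ}

/-- The gluing of three tangles on top of each other. -/
def glueThree : (Vertex n ⊕ Vertex n) ⊕ Vertex n → (Vertex n ⊕ Vertex n) ⊕ Vertex n
  | Sum.inl (Sum.inl (true, b)) => Sum.inl (Sum.inr (false, b))
  | Sum.inl (Sum.inr (false, b)) => Sum.inl (Sum.inl (true, b))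
  | Sum.inl (Sum.inr (true, b)) => Sum.inr (false, b)
  | Sum.inr (false, b) => Sum.inl (Sum.inr (true, b))
  | Sum.inl (Sum.inl (false, b)) => Sum.inl (Sum.inl (false, b))
  | Sum.inr (true, b) => Sum.inr (true, b)

/-- The gluing of three tangles on top of each other, the last two being put together first. -/
def glueThree' (x : Vertex n ⊕ (Vertex n ⊕ Vertex n)) : Vertex n ⊕ (Vertex n ⊕ Vertex n) :=
  Equiv.sumAssoc _ _ _ (glueThree ((Equiv.sumAssoc _ _ _).symm x))

lemma glueThree_glueThree (x : (Vertex n ⊕ Vertex n) ⊕ Vertex n) :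
    glueThree (glueThree x) = x := by
  rcases x with (⟨a, b⟩ | ⟨a, b⟩) | ⟨a, b⟩ <;> cases a <;> rfl

lemma glueThree'_glueThree' (x : Vertex n ⊕ (Vertex n ⊕ Vertex n)) :
    glueThree' (glueThree' x) = x := by
  simp [glueThree', glueThree_glueThree]

variable (F F' F'' : ArrowTangle n)

/-- Both bracketings are two-stage reductions of the same three-tangle net, up to `Equiv.sumAssoc`.
Uniqueness of arcs identifies the tangles; independence of the transversal identifies the factors.
-/
theorem comp_assoc_cycleFactor : (F.comp F').comp F'' = F.comp (F'.comp F'') ∧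
    cycleFactor F F' * cycleFactor (F.comp F') F'' =
      cycleFactor F' F'' * cycleFactor F (F'.comp F'') := by
  classical
  have r1 := (comp_isReduction F F').sum_left F''.net
  have r2 := (comp_isReduction F' F'').sum_right F.net
  have a1 : ∀ x : (Vertex n ⊕ Vertex n) ⊕ Vertex n,
      Sum.map glue id (Sum.map glue id x) = x := by
    rintro (x | x) <;> simp [glue_glue]
  have a2 : ∀ x : Vertex n ⊕ (Vertex n ⊕ Vertex n),
      Sum.map id glue (Sum.map id glue x) = x := by
    rintro (x | x) <;> simp [glue_glue]
  have b1 : ∀ x : (Vertex n ⊕ Vertex n) ⊕ Vertex n,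
      Sum.map glue id x ≠ x → glueThree x = Sum.map glue id x := by
    rintro ((⟨a, b⟩ | ⟨a, b⟩) | ⟨a, b⟩) <;> cases a <;> simp [glue, glueThree]
  have b2 : ∀ x : Vertex n ⊕ (Vertex n ⊕ Vertex n),
      Sum.map id glue x ≠ x → glueThree' x = Sum.map id glue x := by
    rintro (⟨a, b⟩ | (⟨a, b⟩ | ⟨a, b⟩)) <;> cases a <;> simp [glue, glueThree', glueThree]
  have c1 : ∀ y : Vertex n ⊕ Vertex n,
      glueThree (Sum.map outer id y) = Sum.map outer id (glue y) := by
    rintro (⟨a, b⟩ | ⟨a, b⟩) <;> cases a <;> rfl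
  have c2 : ∀ y : Vertex n ⊕ Vertex n,
      glueThree' (Sum.map id outer y) = Sum.map id outer (glue y) := by
    rintro (⟨a, b⟩ | ⟨a, b⟩) <;> cases a <;> rfl
  have m : ∀ x, (F.net.sum (stackNet F' F'')).mate (Equiv.sumAssoc _ _ _ x) =
      Equiv.sumAssoc _ _ _ (((stackNet F F').sum F''.net).mate x) := by
    rintro ((x | x) | x) <;> rfl
  have ma : ∀ x, (F.net.sum (stackNet F' F'')).angle (Equiv.sumAssoc _ _ _ x) =
      ((stackNet F F').sum F''.net).angle x := by
    rintro ((x | x) | x) <;> rfl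
  have mg : ∀ x : (Vertex n ⊕ Vertex n) ⊕ Vertex n, glueThree' (Equiv.sumAssoc _ _ _ x) =
      Equiv.sumAssoc _ _ _ (glueThree x) := by
    intro x
    simp [glueThree']
  have mj := (Equiv.sumAssoc (Vertex n) (Vertex n) (Vertex n)).injective
  constructor
  · apply ArrowTangle.ext_net
    intro v
    have t1 := ((r1.trans a1 b1 c1 (comp_isReduction (F.comp F') F'')).arc v).map m mg mj ma
    have t2 := (r2.trans a2 b2 c2 (comp_isReduction F (F'.comp F''))).arc v
    have e : ∀ v : Vertex n, Equiv.sumAssoc _ _ _ ((Sum.map outer id ∘ outer) v) =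
        (Sum.map id outer ∘ outer) v := by
      rintro ⟨a, b⟩
      cases a <;> rfl
    rw [e, e] at t1
    obtain ⟨h1, h2⟩ := t1.unique t2
    exact ⟨((Function.injective_id.sumMap outer_injective).comp outer_injective) h1, h2⟩
  · obtain ⟨S1, s1, p1⟩ := exists_transversal_stack F F'
    obtain ⟨S2, s2, p2⟩ := exists_transversal_stack (F.comp F') F''
    obtain ⟨S3, s3, p3⟩ := exists_transversal_stack F' F''
    obtain ⟨S4, s4, p4⟩ := exists_transversal_stack F (F'.comp F'')
    have t1 := s1.image (M := (stackNet F F').sum F''.net) (h := Sum.map glue id)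
      (j := Sum.inl) (fun _ => rfl) (fun _ => rfl) Sum.inl_injective (by
        rintro (y | y) hy
        · exact absurd ⟨y, rfl⟩ hy
        · exact fun h => h 0 rfl)
    have t3 := s3.image (M := F.net.sum (stackNet F' F'')) (h := Sum.map id glue)
      (j := Sum.inr) (fun _ => rfl) (fun _ => rfl) Sum.inr_injective (by
        rintro (y | y) hy
        · exact fun h => h 0 rfl
        · exact absurd ⟨y, rfl⟩ hy)
    have u1 := r1.isTransversal_union a1 b1 c1 glueThree_glueThree t1 s2
    have u2 := r2.isTransversal_union a2 b2 c2 glueThree'_glueThree' t3 s4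
    have q1 := r1.prod_union a1 b1 c1 glueThree_glueThree t1 (S' := S2)
    have q2 := r2.prod_union a2 b2 c2 glueThree'_glueThree' t3 (S' := S4)
    have u3 := u1.image m mg mj fun y hy => absurd ⟨_, Equiv.apply_symm_apply _ y⟩ hy
    have q3 := Net.prod_transversal _ glueThree'_glueThree' u3 u2
    rw [Net.prod_value_image m mg mj ma, q1, q2,
      Net.prod_value_image (N := stackNet F F') (g := glue) (M := (stackNet F F').sum F''.net)
        (fun _ => rfl) (fun _ => rfl) Sum.inl_injective (fun _ => rfl),
      Net.prod_value_image (N := stackNet F' F'') (g := glue)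
        (M := F.net.sum (stackNet F' F''))
        (fun _ => rfl) (fun _ => rfl) Sum.inr_injective (fun _ => rfl)] at q3
    rw [p1, p2, p3, p4]
    exact q3

end Assoc

/-! ## Closures -/

section Closure

variable {n : ℕ}

/-- The gluing of two tangles on top of each other along both rows. -/
def glueClosure : Vertex n ⊕ Vertex n → Vertex n ⊕ Vertex n
  | Sum.inl v => Sum.inr (flipRow v)
  | Sum.inr v => Sum.inl (flipRow v)

lemma glueClosure_glueClosure (x : Vertex n ⊕ Vertex n) : glueClosure (glueClosure x) = x := by
  rcases x with x | x <;> simp [glueClosure, flipRow_flipRow]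

/-- Multiplying glues the inner rows and taking the closure glues the outer ones: together, two
stages of `glueClosure`. -/
lemma exists_transversal_glueClosure (F F' : ArrowTangle n) :
    ∃ S, (stackNet F F').IsTransversal glueClosure S ∧
      cycleFactor F F' * closureFactor (F.comp F') =
        ∏ x ∈ S, (stackNet F F').value glueClosure x := by
  classical
  obtain ⟨S1, s1, p1⟩ := exists_transversal_stack F F'
  obtain ⟨S2, s2, p2⟩ := exists_transversal_closure (F.comp F')
  have b : ∀ x : Vertex n ⊕ Vertex n, glue x ≠ x → glueClosure x = glue x := by
    rintro (⟨a, b⟩ | ⟨a, b⟩) <;> cases a <;> simp [glue, glueClosure, flipRow]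
  have c : ∀ v : Vertex n, glueClosure (outer v) = outer (flipRow v) := by
    rintro ⟨a, b⟩
    cases a <;> rfl
  have hr := comp_isReduction F F'
  refine ⟨_, hr.isTransversal_union glue_glue b c glueClosure_glueClosure s1 s2, ?_⟩
  rw [hr.prod_union glue_glue b c glueClosure_glueClosure s1, p1, p2]

/-- Gluing along both rows treats the two tangles alike, so `Sum.swap` is an isomorphism between the
two glued nets. -/
theorem cycleFactor_mul_closureFactor_comm (F F' : ArrowTangle n) :
    cycleFactor F F' * closureFactor (F.comp F') =
      cycleFactor F' F * closureFactor (F'.comp F) := by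
  classical
  obtain ⟨S1, s1, p1⟩ := exists_transversal_glueClosure F F'
  obtain ⟨S2, s2, p2⟩ := exists_transversal_glueClosure F' F
  have m : ∀ x, (stackNet F' F).mate (Sum.swap x) = Sum.swap ((stackNet F F').mate x) := by
    rintro (x | x) <;> rfl
  have ma : ∀ x, (stackNet F' F).angle (Sum.swap x) = (stackNet F F').angle x := by
    rintro (x | x) <;> rfl
  have mg : ∀ x : Vertex n ⊕ Vertex n, glueClosure (Sum.swap x) = Sum.swap (glueClosure x) := by
    rintro (x | x) <;> rfl
  have mj := (Equiv.sumComm (Vertex n) (Vertex n)).injective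
  have t := s1.image m mg mj fun y hy => absurd ⟨Sum.swap y, Sum.swap_swap y⟩ hy
  have q := Net.prod_transversal _ glueClosure_glueClosure t s2
  have q' := Net.prod_value_image m mg mj ma S1
  rw [p1, p2, ← q, ← q']

end Closure

/-! ### Transversals with at most one point, and loops of angle zero. -/

namespace Net

variable {X : Type} {N : Net X} {g : X → X}

lemma Arc.not_isClosed (hg : ∀ x, g (g x) = x) {x w : X} {s : ℤ} (H : N.Arc g x w s) :
    ¬ N.IsClosed g x := by
  obtain ⟨L, _, h, _⟩ := H.iterate hg (fun _ _ => rfl)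
  intro hc
  exact hc L (by rw [h, hg, H.fixed])

lemma isTransversal_empty (h : ∀ x, ¬ N.IsClosed g x) : N.IsTransversal g ∅ :=
  ⟨by simp, fun x hx => absurd hx (h x), by simp⟩

lemma isTransversal_singleton {x : X} (hx : N.IsClosed g x)
    (h : ∀ y, N.IsClosed g y → N.Conn g x y) : N.IsTransversal g {x} where
  isClosed := by simpa using hx
  exists_conn y hy := ⟨x, by simp, h y hy⟩
  eq_of_conn := by simp

/-- Any positive return time will do, as the sum over it is a nonzero multiple of the holonomy. -/
lemma value_eq_z_zero {x : X} {k : ℕ} (hk : 0 < k) (h : (N.step g)^[k] x = x)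
    (hs : N.walkSum g x k = 0) : N.value g x = z 0 := by
  obtain ⟨c, rfl⟩ := Function.IsPeriodicPt.minimalPeriod_dvd h
  rw [mul_comm, walkSum_mul _ _ _ Function.iterate_minimalPeriod] at hs
  have hc : (c : ℤ) ≠ 0 := by
    have := Nat.pos_of_mul_pos_left hk
    omega
  have h0 : N.holonomy g x = 0 := (mul_eq_zero.1 hs).resolve_left hc
  simp [value, h0]

end Net

lemma isClosed_inl {n : ℕ} {N : Net (Vertex n ⊕ Vertex n)} {b : Fin n}
    (h : N.IsClosed glue (Sum.inl (true, b))) : N.IsClosed glue (Sum.inr (false, b)) :=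
  h.of_conn glue_glue ⟨0, Or.inr rfl⟩

lemma isClosed_inr {n : ℕ} {N : Net (Vertex n ⊕ Vertex n)} {b : Fin n}
    (h : N.IsClosed glue (Sum.inr (false, b))) : N.IsClosed glue (Sum.inl (true, b)) :=
  h.of_conn glue_glue ⟨0, Or.inr rfl⟩

lemma isTransversal_stack_empty {n : ℕ} {N : Net (Vertex n ⊕ Vertex n)}
    (h : ∀ b, ¬ N.IsClosed glue (Sum.inr (false, b))) : N.IsTransversal glue ∅ := by
  apply Net.isTransversal_empty
  rintro (⟨a, b⟩ | ⟨a, b⟩) hc <;> cases a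
  · exact hc 0 rfl
  · exact h b (isClosed_inl hc)
  · exact h b hc
  · exact hc 0 rfl

/-! ## Products with permutations -/

section Perm

variable {n : ℕ} (p : Equiv.Perm (Fin n)) (G : ArrowTangle n)

/-- A permutation of the points of the row `0`. -/
def permTop : Equiv.Perm (Vertex n) where
  toFun v := if v.1 then v else (false, p v.2)
  invFun v := if v.1 then v else (false, p.symm v.2)
  left_inv := by rintro ⟨a, b⟩; cases a <;> simp
  right_inv := by rintro ⟨a, b⟩; cases a <;> simp

/-- A permutation of the points of the row `1`. -/
def permBot : Equiv.Perm (Vertex n) where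
  toFun v := if v.1 then (true, p v.2) else v
  invFun v := if v.1 then (true, p.symm v.2) else v
  left_inv := by rintro ⟨a, b⟩; cases a <;> simp
  right_inv := by rintro ⟨a, b⟩; cases a <;> simp

lemma ofPerm_angle (v : Vertex n) : (ArrowTangle.ofPerm p).net.angle v = 0 := mul_zero _

lemma arc_ofPerm_left (u : Vertex n) : (stackNet (ArrowTangle.ofPerm p) G).Arc glue (Sum.inr u)
    (outer ((permTop p).symm (G.mate u))) (G.net.angle u) := by
  obtain ⟨⟨a, b⟩, h⟩ : ∃ v, G.mate u = v := ⟨_, rfl⟩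
  rw [h]
  cases a
  · exact .cons (y := Sum.inl (true, b)) (congrArg (glue ∘ Sum.inr) h) Sum.inl_ne_inr
      (.last rfl rfl (ofPerm_angle p _)) (add_zero _)
  · exact .last (congrArg Sum.inr h) rfl rfl

/-- Strands of a permutation have angle 0, so multiplying by it only renames end points. -/
lemma ofPerm_comp (v : Vertex n) :
    ((ArrowTangle.ofPerm p).comp G).net.mate v = (permTop p).symm (G.mate (permTop p v)) ∧
      ((ArrowTangle.ofPerm p).comp G).net.angle v = G.net.angle (permTop p v) := by
  apply comp_eq_of_arc
  have h := arc_ofPerm_left p G (permTop p v)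
  rcases v with ⟨a, b⟩
  cases a
  · exact .cons (y := Sum.inr (false, p b)) rfl Sum.inr_ne_inl h
      ((congrArg (· + _) (ofPerm_angle p _)).trans (zero_add _))
  · exact h

lemma cycleFactor_ofPerm_left : cycleFactor (ArrowTangle.ofPerm p) G = 1 := by
  rw [cycleFactor_eq _ _ (isTransversal_stack_empty fun b =>
    (arc_ofPerm_left p G (false, b)).not_isClosed glue_glue), prod_empty]

lemma arc_ofPerm_right (u : Vertex n) : (stackNet G (ArrowTangle.ofPerm p)).Arc glue (Sum.inl u)
    (outer (permBot p (G.mate u))) (G.net.angle u) := by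
  obtain ⟨⟨a, b⟩, h⟩ : ∃ v, G.mate u = v := ⟨_, rfl⟩
  rw [h]
  cases a
  · exact .last (congrArg Sum.inl h) rfl rfl
  · exact .cons (y := Sum.inr (false, b)) (congrArg (glue ∘ Sum.inl) h) Sum.inr_ne_inl
      (.last rfl rfl (ofPerm_angle p _)) (add_zero _)

lemma comp_ofPerm (v : Vertex n) :
    (G.comp (ArrowTangle.ofPerm p)).net.mate v = permBot p (G.mate ((permBot p).symm v)) ∧
      (G.comp (ArrowTangle.ofPerm p)).net.angle v = G.net.angle ((permBot p).symm v) := by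
  apply comp_eq_of_arc
  have h := arc_ofPerm_right p G ((permBot p).symm v)
  rcases v with ⟨a, b⟩
  cases a
  · exact h
  · exact .cons (y := Sum.inl (true, p.symm b)) rfl Sum.inl_ne_inr h
      ((congrArg (· + _) (ofPerm_angle p _)).trans (zero_add _))

lemma cycleFactor_ofPerm_right : cycleFactor G (ArrowTangle.ofPerm p) = 1 := by
  rw [cycleFactor_eq _ _ (isTransversal_stack_empty fun b hb =>
    (arc_ofPerm_right p G (true, b)).not_isClosed glue_glue (isClosed_inr hb)), prod_empty]

end Perm

/-! ## Hooks -/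

section Hook

variable {n : ℕ}

/-- The tangle with the pairs `{(0,a), (0,b)}` and `{(1,a), (1,b)}`, with angle `1` from `a` to `b`,
all other pairs being `{(0,k), (1,k)}` with label `0`. -/
def hook (a b : Fin n) (hab : a ≠ b) : ArrowTangle n where
  toFlatTangle := (ArrowTangle.cupCap a b hab).toFlatTangle
  label v := (if a < b then 1 else -1) * (ArrowTangle.cupCap a b hab).label v
  label_mate v := by rw [(ArrowTangle.cupCap a b hab).label_mate]
  label_odd v := by
    rw [← (ArrowTangle.cupCap a b hab).label_odd, Int.odd_mul]
    split_ifs <;> simp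

lemma cupCap_eq_hook {a b : Fin n} (hab : a < b) :
    ArrowTangle.cupCap a b hab.ne = hook a b hab.ne := by
  refine ArrowTangle.ext rfl (funext fun v => ?_)
  change _ = (if a < b then (1 : ℤ) else -1) * _
  rw [if_pos hab, one_mul]

variable {a b : Fin n} (hab : a ≠ b)

lemma hook_mate_left (r : Bool) : (hook a b hab).mate (r, a) = (r, b) := by
  simp [hook, ArrowTangle.cupCap]

lemma hook_mate_right (r : Bool) : (hook a b hab).mate (r, b) = (r, a) := by
  simp [hook, ArrowTangle.cupCap, hab.symm]

lemma hook_mate_of_ne (r : Bool) {k : Fin n} (ha : k ≠ a) (hb : k ≠ b) :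
    (hook a b hab).mate (r, k) = (!r, k) := by
  simp [hook, ArrowTangle.cupCap, ha, hb]

/-- For `a < b` the pair in row 1 is traversed against the order, and the resulting parity `-1`
cancels the row sign `-1`; for `b < a` the negative label compensates. The angle is thus the same in
both rows, which makes hooks equivariant under permutations. -/
lemma hook_angle_left (r : Bool) : (hook a b hab).net.angle (r, a) = 1 := by
  refine ((hook a b hab).angle_diagram (r, a)).trans ?_
  rw [hook_mate_left]
  have ha := a.2
  have hb := b.2
  have h1 : (a : ℕ) ≠ b := fun h => hab (Fin.ext h)
  rcases lt_or_gt_of_ne hab with h | h <;>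
    simp only [hook, ArrowTangle.cupCap, rank, Fin.lt_def] at h ⊢ <;> cases r <;>
    simp [h, h.not_gt, rowSign] <;> omega

lemma hook_angle_right (r : Bool) : (hook a b hab).net.angle (r, b) = -1 := by
  have h := (hook a b hab).net.angle_mate (r, a)
  rw [hook_angle_left] at h
  rw [← h]
  congr 1
  exact (hook_mate_left hab r).symm

lemma hook_angle_of_ne (r : Bool) {k : Fin n} (ha : k ≠ a) (hb : k ≠ b) :
    (hook a b hab).net.angle (r, k) = 0 := by
  refine ((hook a b hab).angle_diagram (r, k)).trans ?_
  simp [hook, ArrowTangle.cupCap, ha, hb]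

variable {G : ArrowTangle n}

lemma arc_hook_of_ne {u : Vertex n} (ha : G.mate u ≠ (false, a)) (hb : G.mate u ≠ (false, b)) :
    (stackNet (hook a b hab) G).Arc glue (Sum.inr u) (outer (G.mate u)) (G.net.angle u) := by
  obtain ⟨⟨r, k⟩, h⟩ : ∃ v, G.mate u = v := ⟨_, rfl⟩
  rw [h] at ha hb ⊢
  cases r
  · have ha : k ≠ a := by simpa using ha
    have hb : k ≠ b := by simpa using hb
    exact .cons (y := Sum.inl (true, k)) (congrArg (glue ∘ Sum.inr) h) Sum.inl_ne_inr
      (.last (congrArg Sum.inl (hook_mate_of_ne hab true ha hb)) rfl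
        (hook_angle_of_ne hab true ha hb)) (add_zero _)
  · exact .last (congrArg Sum.inr h) rfl rfl

/-- The walk enters the hook in column `a` and leaves it in column `b`, gaining angle 1. The
condition on `u` excludes the case where it closes into a loop. -/
lemma arc_hook_left {u : Vertex n} (h : G.mate u = (false, a)) (hu : u ≠ (false, b)) :
    (stackNet (hook a b hab) G).Arc glue (Sum.inr u) (outer (G.mate (false, b)))
      (G.net.angle u + (1 + G.net.angle (false, b))) := by
  refine .cons (y := Sum.inl (true, a)) (congrArg (glue ∘ Sum.inr) h) Sum.inl_ne_inr
    (.cons (y := Sum.inr (false, b)) (congrArg (glue ∘ Sum.inl) (hook_mate_left hab true)) Sum.inr_ne_inl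
      (arc_hook_of_ne hab ?_ (G.mate_ne _)) (congrArg (· + _) (hook_angle_left hab true))) rfl
  rw [← h]
  intro hc
  apply hu
  rw [← G.mate_mate u, ← hc, G.mate_mate]

lemma arc_hook_right {u : Vertex n} (h : G.mate u = (false, b)) (hu : u ≠ (false, a)) :
    (stackNet (hook a b hab) G).Arc glue (Sum.inr u) (outer (G.mate (false, a)))
      (G.net.angle u + (-1 + G.net.angle (false, a))) := by
  refine .cons (y := Sum.inl (true, b)) (congrArg (glue ∘ Sum.inr) h) Sum.inl_ne_inr
    (.cons (y := Sum.inr (false, a)) (congrArg (glue ∘ Sum.inl) (hook_mate_right hab true)) Sum.inr_ne_inl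
      (arc_hook_of_ne hab (G.mate_ne _) ?_) (congrArg (· + _) (hook_angle_right hab true))) rfl
  rw [← h]
  intro hc
  apply hu
  rw [← G.mate_mate u, ← hc, G.mate_mate]

lemma arc_hook_outer {v : Vertex n} (ha : v ≠ (false, a)) (hb : v ≠ (false, b))
    {w : Vertex n ⊕ Vertex n} {s : ℤ}
    (h : (stackNet (hook a b hab) G).Arc glue (Sum.inr v) w s) :
    (stackNet (hook a b hab) G).Arc glue (outer v) w s := by
  rcases v with ⟨r, k⟩
  cases r
  · have ha : k ≠ a := by simpa using ha
    have hb : k ≠ b := by simpa using hb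
    exact .cons (y := Sum.inr (false, k)) (congrArg (glue ∘ Sum.inl) (hook_mate_of_ne hab _ ha hb))
      Sum.inr_ne_inl h
      ((congrArg (· + _) (hook_angle_of_ne hab _ ha hb)).trans (zero_add _))
  · exact h

lemma hook_comp_cup : ((hook a b hab).comp G).net.mate (false, a) = (false, b) ∧
    ((hook a b hab).comp G).net.angle (false, a) = 1 :=
  comp_eq_of_arc (.last (congrArg Sum.inl (hook_mate_left hab false)) rfl (hook_angle_left hab false))

lemma hook_comp_cup' : ((hook a b hab).comp G).net.mate (false, b) = (false, a) ∧
    ((hook a b hab).comp G).net.angle (false, b) = -1 :=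
  comp_eq_of_arc
    (.last (congrArg Sum.inl (hook_mate_right hab false)) rfl (hook_angle_right hab false))

lemma hook_comp_of_ne {v : Vertex n} (ha : v ≠ (false, a)) (hb : v ≠ (false, b))
    (ha' : G.mate v ≠ (false, a)) (hb' : G.mate v ≠ (false, b)) :
    ((hook a b hab).comp G).net.mate v = G.mate v ∧
      ((hook a b hab).comp G).net.angle v = G.net.angle v :=
  comp_eq_of_arc (arc_hook_outer hab ha hb (arc_hook_of_ne hab ha' hb'))

lemma hook_comp_left {v : Vertex n} (ha : v ≠ (false, a)) (hb : v ≠ (false, b))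
    (h : G.mate v = (false, a)) :
    ((hook a b hab).comp G).net.mate v = G.mate (false, b) ∧
      ((hook a b hab).comp G).net.angle v = G.net.angle v + (1 + G.net.angle (false, b)) :=
  comp_eq_of_arc (arc_hook_outer hab ha hb (arc_hook_left hab h hb))

lemma hook_comp_right {v : Vertex n} (ha : v ≠ (false, a)) (hb : v ≠ (false, b))
    (h : G.mate v = (false, b)) :
    ((hook a b hab).comp G).net.mate v = G.mate (false, a) ∧
      ((hook a b hab).comp G).net.angle v = G.net.angle v + (-1 + G.net.angle (false, a)) :=
  comp_eq_of_arc (arc_hook_outer hab ha hb (arc_hook_right hab h ha))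

lemma not_isClosed_hook {k : Fin n} (ha : k ≠ a) (hb : k ≠ b) :
    ¬ (stackNet (hook a b hab) G).IsClosed glue (Sum.inr (false, k)) := by
  by_cases h1 : G.mate (false, k) = (false, a)
  · exact (arc_hook_left hab h1 (by simpa using hb)).not_isClosed glue_glue
  by_cases h2 : G.mate (false, k) = (false, b)
  · exact (arc_hook_right hab h2 (by simpa using ha)).not_isClosed glue_glue
  exact (arc_hook_of_ne hab h1 h2).not_isClosed glue_glue

lemma cycleFactor_hook (h : G.mate (false, a) ≠ (false, b)) : cycleFactor (hook a b hab) G = 1 := by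
  rw [cycleFactor_eq _ _ (isTransversal_stack_empty fun k => ?_), prod_empty]
  by_cases ha : k = a
  · subst ha
    exact (arc_hook_of_ne hab (G.mate_ne _) h).not_isClosed glue_glue
  by_cases hb : k = b
  · subst hb
    refine (arc_hook_of_ne hab (fun hc => h ?_) (G.mate_ne _)).not_isClosed glue_glue
    rw [← hc, G.mate_mate]
  exact not_isClosed_hook hab ha hb

/-- The only cycle consists of the pair of `G` from `a` to `b`, of angle 1, and the hook traversed
from `b` back to `a`, of angle `-1`. -/
lemma cycleFactor_hook_loop (h : G.mate (false, a) = (false, b))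
    (h1 : G.net.angle (false, a) = 1) : cycleFactor (hook a b hab) G = z 0 := by
  have s1 : (stackNet (hook a b hab) G).step glue (Sum.inr (false, a)) = Sum.inl (true, b) :=
    congrArg (glue ∘ Sum.inr) h
  have s2 : (stackNet (hook a b hab) G).step glue (Sum.inl (true, b)) = Sum.inr (false, a) :=
    congrArg (glue ∘ Sum.inl) (hook_mate_right hab true)
  have hcl : (stackNet (hook a b hab) G).IsClosed glue (Sum.inr (false, a)) := by
    intro i
    have : ((stackNet (hook a b hab) G).step glue)^[i] (Sum.inr (false, a)) = Sum.inr (false, a) ∨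
        ((stackNet (hook a b hab) G).step glue)^[i] (Sum.inr (false, a)) = Sum.inl (true, b) := by
      induction i with
      | zero => exact Or.inl rfl
      | succ i ih =>
        rw [Function.iterate_succ_apply']
        rcases ih with h | h
        · rw [h, s1]; exact Or.inr rfl
        · rw [h, s2]; exact Or.inl rfl
    rcases this with h | h <;> simp [h, glue]
  have hr : ∀ k, (stackNet (hook a b hab) G).IsClosed glue (Sum.inr (false, k)) →
      (stackNet (hook a b hab) G).Conn glue (Sum.inr (false, a)) (Sum.inr (false, k)) := by
    intro k hk
    by_cases ha : k = a
    · subst ha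
      exact ⟨0, Or.inl rfl⟩
    by_cases hb : k = b
    · subst hb
      exact ⟨1, Or.inr s1⟩
    exact absurd hk (not_isClosed_hook hab ha hb)
  have ht := Net.isTransversal_singleton hcl (by
    rintro (⟨r, k⟩ | ⟨r, k⟩) hc <;> cases r
    · exact absurd rfl (hc 0)
    · exact (hr k (isClosed_inl hc)).trans glue_glue ⟨0, Or.inr rfl⟩
    · exact hr k hc
    · exact absurd rfl (hc 0))
  rw [cycleFactor_eq _ _ ht, prod_singleton]
  refine Net.value_eq_z_zero (k := 2) two_pos ?_ ?_
  · rw [Function.iterate_succ_apply, Function.iterate_one, s1, s2]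
  · rw [Net.walkSum, sum_range_succ, sum_range_one, Function.iterate_one, s1]
    exact (congrArg₂ (· + ·) h1 (hook_angle_right hab true)).trans (by norm_num)

end Hook

/-! ## Adding a strand -/

section Sharp

variable {n : ℕ}

/-- The embedding of the end points of `n` strands in those of `n + 1` strands. -/
def vertexSucc (v : Vertex n) : Vertex (n + 1) := (v.1, v.2.castSucc)

lemma vertexSucc_injective : Function.Injective (vertexSucc (n := n)) := by
  rintro ⟨a, b⟩ ⟨c, d⟩ h
  simpa [vertexSucc] using h

lemma vertexSucc_ne (v : Vertex n) (a : Bool) : vertexSucc v ≠ (a, Fin.last n) := by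
  intro h
  exact Fin.castSucc_ne_last _ (congrArg Prod.snd h)

lemma eq_vertexSucc_or (v : Vertex (n + 1)) : (∃ u, v = vertexSucc u) ∨ v = (v.1, Fin.last n) := by
  rcases v with ⟨a, b⟩
  induction b using Fin.lastCases with
  | last => exact Or.inr rfl
  | cast k => exact Or.inl ⟨(a, k), rfl⟩

lemma outer_vertexSucc (v : Vertex n) :
    outer (vertexSucc v) = Sum.map vertexSucc vertexSucc (outer v) := by
  rcases v with ⟨a, b⟩
  cases a <;> rfl

lemma rank_vertexSucc (v w : Vertex n) :
    rank (vertexSucc v) < rank (vertexSucc w) ↔ rank v < rank w := by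
  rcases v with ⟨a, b⟩
  rcases w with ⟨c, d⟩
  have := b.2
  have := d.2
  cases a <;> cases c <;> simp [rank, vertexSucc] <;> omega

variable (F F' : ArrowTangle n)

lemma sharp_mate (v : Vertex n) : F.sharp.mate (vertexSucc v) = vertexSucc (F.mate v) := by
  simp [ArrowTangle.sharp, vertexSucc]

lemma sharp_mate_last (a : Bool) : F.sharp.mate (a, Fin.last n) = (!a, Fin.last n) := by
  simp [ArrowTangle.sharp]

lemma sharp_angle (v : Vertex n) : F.sharp.net.angle (vertexSucc v) = F.net.angle v := by
  refine (F.sharp.angle_diagram _).trans (Eq.trans ?_ (F.angle_diagram v).symm)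
  have h : F.sharp.label (vertexSucc v) = F.label v := by simp [ArrowTangle.sharp, vertexSucc]
  simp only [sharp_mate, rank_vertexSucc, h]
  rfl

lemma sharp_angle_last (a : Bool) : F.sharp.net.angle (a, Fin.last n) = 0 := by
  refine (F.sharp.angle_diagram _).trans ?_
  simp [ArrowTangle.sharp]

lemma sharp_injective : Function.Injective (ArrowTangle.sharp (n := n)) := by
  intro F G h
  refine ArrowTangle.ext_net fun v => ⟨vertexSucc_injective ?_, ?_⟩
  · exact (sharp_mate F v).symm.trans (h ▸ sharp_mate G v)
  · rw [← sharp_angle, h, sharp_angle]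

lemma arc_sharp_last (a : Bool) :
    (stackNet F.sharp F'.sharp).Arc glue (outer (a, Fin.last n)) (outer (!a, Fin.last n)) 0 := by
  cases a
  · exact .cons (y := Sum.inr (false, Fin.last n)) (congrArg (glue ∘ Sum.inl) (sharp_mate_last F _))
      Sum.inr_ne_inl
      (.last (congrArg Sum.inr (sharp_mate_last F' _)) rfl (sharp_angle_last F' _))
      ((add_zero _).trans (sharp_angle_last F _))
  · exact .cons (y := Sum.inl (true, Fin.last n)) (congrArg (glue ∘ Sum.inr) (sharp_mate_last F' _))
      Sum.inl_ne_inr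
      (.last (congrArg Sum.inl (sharp_mate_last F _)) rfl (sharp_angle_last F _))
      ((add_zero _).trans (sharp_angle_last F' _))

lemma stackNet_sharp :
    (∀ x, (stackNet F.sharp F'.sharp).mate (Sum.map vertexSucc vertexSucc x) =
      Sum.map vertexSucc vertexSucc ((stackNet F F').mate x)) ∧
    (∀ x, (stackNet F.sharp F'.sharp).angle (Sum.map vertexSucc vertexSucc x) =
      (stackNet F F').angle x) ∧
    ∀ x : Vertex n ⊕ Vertex n, glue (Sum.map vertexSucc vertexSucc x) =
      Sum.map vertexSucc vertexSucc (glue x) := by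
  refine ⟨?_, ?_, ?_⟩
  · rintro (x | x)
    · exact congrArg Sum.inl (sharp_mate F x)
    · exact congrArg Sum.inr (sharp_mate F' x)
  · rintro (x | x)
    · exact sharp_angle F x
    · exact sharp_angle F' x
  · rintro (⟨a, b⟩ | ⟨a, b⟩) <;> cases a <;> rfl

lemma comp_sharp : F.sharp.comp F'.sharp = (F.comp F').sharp := by
  obtain ⟨m, ma, mg⟩ := stackNet_sharp F F'
  refine ArrowTangle.ext_net fun v => comp_eq_of_arc ?_
  rcases eq_vertexSucc_or v with ⟨u, rfl⟩ | h
  · have := ((comp_isReduction F F').arc u).map m mg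
      (vertexSucc_injective.sumMap vertexSucc_injective) ma
    rw [← outer_vertexSucc, ← outer_vertexSucc] at this
    rw [sharp_angle]
    convert this
    exact sharp_mate _ u
  · rw [h, sharp_angle_last]
    convert arc_sharp_last F F' v.1 using 2
    exact sharp_mate_last _ _

lemma cycleFactor_sharp : cycleFactor F.sharp F'.sharp = cycleFactor F F' := by
  classical
  obtain ⟨m, ma, mg⟩ := stackNet_sharp F F'
  have mj : Function.Injective (Sum.map (vertexSucc (n := n)) (vertexSucc (n := n))) :=
    vertexSucc_injective.sumMap vertexSucc_injective
  obtain ⟨S, hS, h⟩ := exists_transversal_stack F F'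
  -- The added strand runs through to the outer rows, so it creates no cycle.
  have hl : ¬ (stackNet F.sharp F'.sharp).IsClosed glue (Sum.inr (false, Fin.last n)) :=
    (Net.Arc.last (congrArg Sum.inr (sharp_mate_last F' _)) rfl rfl :
      (stackNet F.sharp F'.sharp).Arc glue (Sum.inr (false, Fin.last n))
        (outer (true, Fin.last n)) _).not_isClosed glue_glue
  have ht := hS.image m mg mj (by
    rintro (y | y) hy hc <;> rcases eq_vertexSucc_or y with ⟨u, rfl⟩ | h
    · exact hy ⟨Sum.inl u, rfl⟩
    · rw [h] at hc
      cases hr : y.1 <;> rw [hr] at hc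
      · exact hc 0 rfl
      · exact hl (isClosed_inl hc)
    · exact hy ⟨Sum.inr u, rfl⟩
    · rw [h] at hc
      cases hr : y.1 <;> rw [hr] at hc
      · exact hl hc
      · exact hc 0 rfl)
  rw [h, cycleFactor_eq _ _ ht, Net.prod_value_image m mg mj ma]

end Sharp

/-! ## Relations between hooks and permutations -/

section Relations

variable {n : ℕ}

lemma Net.eq_at_mate {X : Type} {N M : Net X} {v w : X}
    (h : N.mate v = M.mate v ∧ N.angle v = M.angle v) (hw : M.mate v = w) :
    N.mate w = M.mate w ∧ N.angle w = M.angle w := by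
  obtain ⟨h1, h2⟩ := h
  subst hw
  rw [← h1, N.mate_mate, N.angle_mate, h2, h1, M.mate_mate, M.angle_mate]
  exact ⟨rfl, rfl⟩

lemma ofPerm_comp_ofPerm (p q : Equiv.Perm (Fin n)) :
    (ArrowTangle.ofPerm p).comp (ArrowTangle.ofPerm q) = ArrowTangle.ofPerm (q * p) := by
  refine ArrowTangle.ext_net fun v => ?_
  obtain ⟨h1, h2⟩ := ofPerm_comp p (ArrowTangle.ofPerm q) v
  rw [h1, h2, ofPerm_angle, ofPerm_angle]
  rcases v with ⟨a, b⟩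
  cases a <;> exact ⟨rfl, rfl⟩

lemma ofPerm_one_comp (F : ArrowTangle n) : (ArrowTangle.ofPerm 1).comp F = F := by
  refine ArrowTangle.ext_net fun v => ?_
  have h : permTop (1 : Equiv.Perm (Fin n)) = 1 := by
    ext ⟨a, b⟩ <;> cases a <;> rfl
  obtain ⟨h1, h2⟩ := ofPerm_comp 1 F v
  rw [h] at h1 h2
  exact ⟨h1, h2⟩

lemma comp_ofPerm_one (F : ArrowTangle n) : F.comp (ArrowTangle.ofPerm 1) = F := by
  refine ArrowTangle.ext_net fun v => ?_
  have h : permBot (1 : Equiv.Perm (Fin n)) = 1 := by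
    ext ⟨a, b⟩ <;> cases a <;> rfl
  obtain ⟨h1, h2⟩ := comp_ofPerm 1 F v
  rw [h] at h1 h2
  exact ⟨h1, h2⟩

lemma permTop_apply (p : Equiv.Perm (Fin n)) (k : Fin n) :
    permTop p (false, k) = (false, p k) ∧ permTop p (true, k) = (true, k) ∧
    (permTop p).symm (false, k) = (false, p.symm k) ∧ (permTop p).symm (true, k) = (true, k) :=
  ⟨rfl, rfl, rfl, rfl⟩

lemma permBot_apply (p : Equiv.Perm (Fin n)) (k : Fin n) :
    permBot p (false, k) = (false, k) ∧ permBot p (true, k) = (true, p k) ∧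
    (permBot p).symm (false, k) = (false, k) ∧ (permBot p).symm (true, k) = (true, p.symm k) :=
  ⟨rfl, rfl, rfl, rfl⟩

/-- A hook slides through a permutation with its oriented pair of columns transported. The
orientation matters: it produces backward hooks in the last Markov move. -/
lemma ofPerm_comp_hook (p : Equiv.Perm (Fin n)) {a b : Fin n} (hab : a ≠ b) (hp : p a ≠ p b) :
    (ArrowTangle.ofPerm p).comp (hook (p a) (p b) hp) =
      (hook a b hab).comp (ArrowTangle.ofPerm p) := by
  refine ArrowTangle.ext_net fun v => ?_
  obtain ⟨h1, h2⟩ := ofPerm_comp p (hook (p a) (p b) hp) v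
  obtain ⟨h3, h4⟩ := comp_ofPerm p (hook a b hab) v
  rw [h1, h2, h3, h4]
  rcases v with ⟨r, k⟩
  -- The column of `v` measured on the side of `hook a b`: in row 1 the permutation has to be undone
  -- first.
  obtain ⟨l, hl⟩ : ∃ l, l = if r then p.symm k else k := ⟨_, rfl⟩
  by_cases ha : l = a
  · cases r <;> simp only [if_true, if_false, Bool.false_eq_true] at hl
    · subst hl ha
      simp [permTop_apply, permBot_apply, hook_mate_left, hook_angle_left]
    · obtain rfl : k = p a := by rw [← ha, hl, Equiv.apply_symm_apply]
      simp [permTop_apply, permBot_apply, hook_mate_left, hook_angle_left]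
  by_cases hb : l = b
  · cases r <;> simp only [if_true, if_false, Bool.false_eq_true] at hl
    · subst hl hb
      simp [permTop_apply, permBot_apply, hook_mate_right, hook_angle_right]
    · obtain rfl : k = p b := by rw [← hb, hl, Equiv.apply_symm_apply]
      simp [permTop_apply, permBot_apply, hook_mate_right, hook_angle_right]
  have ha' := (p.injective.ne ha)
  have hb' := (p.injective.ne hb)
  cases r <;> simp only [if_true, if_false, Bool.false_eq_true] at hl
  · subst hl
    simp [permTop_apply, permBot_apply, hook_mate_of_ne, hook_angle_of_ne, ha, hb]
  · obtain rfl : k = p l := by rw [hl, Equiv.apply_symm_apply]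
    simp [permTop_apply, permBot_apply, hook_mate_of_ne, hook_angle_of_ne, ha, hb]

lemma hook_comp_self {a b : Fin n} (hab : a ≠ b) :
    (hook a b hab).comp (hook a b hab) = hook a b hab := by
  refine ArrowTangle.ext_net fun v => ?_
  by_cases h1 : v = (false, a)
  · subst h1
    obtain ⟨h1, h2⟩ := hook_comp_cup hab (G := hook a b hab)
    exact ⟨h1.trans (hook_mate_left hab _).symm, h2.trans (hook_angle_left hab _).symm⟩
  by_cases h2 : v = (false, b)
  · subst h2
    obtain ⟨h1, h2⟩ := hook_comp_cup' hab (G := hook a b hab)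
    exact ⟨h1.trans (hook_mate_right hab _).symm, h2.trans (hook_angle_right hab _).symm⟩
  refine hook_comp_of_ne hab h1 h2 (fun h => h2 ?_) (fun h => h1 ?_)
  · rw [← (hook a b hab).mate_mate v, h, hook_mate_left]
  · rw [← (hook a b hab).mate_mate v, h, hook_mate_right]

section Columns

variable {a b : Fin n} (hab : a ≠ b) (G : ArrowTangle n)

/-- To compare the product of a hook with a tangle `K`, it suffices to consider one point of each
pair of `K`. -/
lemma hook_comp_eq {K : ArrowTangle n} (hK : K.mate (false, a) = (false, b))
    (hKa : K.net.angle (false, a) = 1)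
    (h : ∀ v, v ≠ (false, a) → v ≠ (false, b) →
      ((hook a b hab).comp G).net.mate v = K.net.mate v ∧
        ((hook a b hab).comp G).net.angle v = K.net.angle v) :
    (hook a b hab).comp G = K := by
  have h1 : ((hook a b hab).comp G).net.mate (false, a) = K.net.mate (false, a) ∧
      ((hook a b hab).comp G).net.angle (false, a) = K.net.angle (false, a) := by
    obtain ⟨h1, h2⟩ := hook_comp_cup hab (G := G)
    exact ⟨h1.trans hK.symm, h2.trans hKa.symm⟩
  refine ArrowTangle.ext_net fun v => ?_
  by_cases ha : v = (false, a)
  · exact ha ▸ h1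
  by_cases hb : v = (false, b)
  · exact hb ▸ Net.eq_at_mate h1 hK
  exact h v ha hb

/-- A product `hook a b * G` is `hook a b` if `G` differs from the identity only in the columns
`a`, `b`, `c`, contains the cap from `a` to `b`, and joins `(0,a)`, `(0,b)`, `(0,c)`, `(1,c)` in a
suitable way. -/
lemma hook_comp_eq_hook {c : Fin n} (hca : c ≠ a) (hcb : c ≠ b)
    (h1 : G.mate (true, a) = (true, b) ∧ G.net.angle (true, a) = 1)
    (h2 : ∀ k, k ≠ a → k ≠ b → k ≠ c →
      G.mate (false, k) = (true, k) ∧ G.net.angle (false, k) = 0)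
    (h3 : (G.mate (false, c) = (false, a) ∧ G.mate (false, b) = (true, c) ∧
        G.net.angle (false, c) + (1 + G.net.angle (false, b)) = 0) ∨
      (G.mate (false, c) = (false, b) ∧ G.mate (false, a) = (true, c) ∧
        G.net.angle (false, c) + (-1 + G.net.angle (false, a)) = 0)) :
    (hook a b hab).comp G = hook a b hab := by
  have ta : ((hook a b hab).comp G).net.mate (true, a) = (hook a b hab).net.mate (true, a) ∧
      ((hook a b hab).comp G).net.angle (true, a) = (hook a b hab).net.angle (true, a) := by
    obtain ⟨e1, e2⟩ := hook_comp_of_ne hab (G := G) (v := (true, a)) (by simp) (by simp)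
      (by simp [h1.1]) (by simp [h1.1])
    exact ⟨(e1.trans h1.1).trans (hook_mate_left hab _).symm,
      (e2.trans h1.2).trans (hook_angle_left hab _).symm⟩
  have fk : ∀ k, k ≠ a → k ≠ b →
      ((hook a b hab).comp G).net.mate (false, k) = (hook a b hab).net.mate (false, k) ∧
      ((hook a b hab).comp G).net.angle (false, k) = (hook a b hab).net.angle (false, k) := by
    intro k ha hb
    rw [hook_angle_of_ne hab _ ha hb]
    change _ = (hook a b hab).mate _ ∧ _
    rw [hook_mate_of_ne hab _ ha hb]
    by_cases hc : k = c
    · subst hc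
      rcases h3 with ⟨e1, e2, e3⟩ | ⟨e1, e2, e3⟩
      · obtain ⟨e4, e5⟩ := hook_comp_left hab (v := (false, k)) (by simpa) (by simpa) e1
        exact ⟨e4.trans e2, e5.trans e3⟩
      · obtain ⟨e4, e5⟩ := hook_comp_right hab (v := (false, k)) (by simpa) (by simpa) e1
        exact ⟨e4.trans e2, e5.trans e3⟩
    · obtain ⟨e1, e2⟩ := h2 k ha hb hc
      obtain ⟨e3, e4⟩ := hook_comp_of_ne hab (G := G) (v := (false, k)) (by simpa) (by simpa)
        (by simp [e1]) (by simp [e1])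
      exact ⟨e3.trans e1, e4.trans e2⟩
  refine hook_comp_eq hab G (hook_mate_left hab _) (hook_angle_left hab _) ?_
  rintro ⟨r, k⟩ ha hb
  by_cases ka : k = a
  · cases r
    · exact absurd (by rw [ka]) ha
    · exact ka ▸ ta
  by_cases kb : k = b
  · cases r
    · exact absurd (by rw [kb]) hb
    · rw [kb]
      exact Net.eq_at_mate ta (hook_mate_left hab _)
  cases r
  · exact fk k ka kb
  · exact Net.eq_at_mate (fk k ka kb) (hook_mate_of_ne hab _ ka kb)

end Columns

/-- The strand in column `c` follows the lower hook from `a` to `b` and the upper one from `b` to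
`a`; the angles `1` and `-1` cancel and a straight strand remains. -/
lemma hook_comp_swap_left {a b c : Fin n} (hab : a ≠ b) (hca : c ≠ a) (hcb : c ≠ b) :
    (hook a b hab).comp ((ArrowTangle.ofPerm (Equiv.swap a c)).comp (hook a b hab)) =
      hook a b hab := by
  have h := ofPerm_comp (Equiv.swap a c) (hook a b hab)
  refine hook_comp_eq_hook hab _ hca hcb ?_ ?_ (Or.inr ?_)
  · obtain ⟨h1, h2⟩ := h (true, a)
    exact ⟨h1.trans (by simp [permTop_apply, hook_mate_left]),
      h2.trans (by simp [permTop_apply, hook_angle_left])⟩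
  · intro k ka kb kc
    obtain ⟨h1, h2⟩ := h (false, k)
    rw [(permTop_apply _ _).1, Equiv.swap_apply_of_ne_of_ne ka kc] at h1 h2
    exact ⟨h1.trans (by simp [permTop_apply, hook_mate_of_ne, ka, kb]),
      h2.trans (by simp [hook_angle_of_ne, ka, kb])⟩
  · obtain ⟨h1, h2⟩ := h (false, c)
    obtain ⟨h3, h4⟩ := h (false, a)
    refine ⟨h1.trans ?_, h3.trans ?_, (congrArg₂ (fun x y => x + (-1 + y)) h2 h4).trans ?_⟩
    · simp [permTop_apply, hook_mate_left, Equiv.swap_apply_of_ne_of_ne hab.symm hcb.symm]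
    · simp [permTop_apply, hook_mate_of_ne, hca, hcb]
    · simp [permTop_apply, hook_angle_left, hook_angle_of_ne, hca, hcb]

lemma hook_comp_swap_right {a b c : Fin n} (hab : a ≠ b) (hca : c ≠ a) (hcb : c ≠ b) :
    (hook a b hab).comp ((ArrowTangle.ofPerm (Equiv.swap b c)).comp (hook a b hab)) =
      hook a b hab := by
  have h := ofPerm_comp (Equiv.swap b c) (hook a b hab)
  refine hook_comp_eq_hook hab _ hca hcb ?_ ?_ (Or.inl ?_)
  · obtain ⟨h1, h2⟩ := h (true, a)
    exact ⟨h1.trans (by simp [permTop_apply, hook_mate_left]),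
      h2.trans (by simp [permTop_apply, hook_angle_left])⟩
  · intro k ka kb kc
    obtain ⟨h1, h2⟩ := h (false, k)
    rw [(permTop_apply _ _).1, Equiv.swap_apply_of_ne_of_ne kb kc] at h1 h2
    exact ⟨h1.trans (by simp [permTop_apply, hook_mate_of_ne, ka, kb]),
      h2.trans (by simp [hook_angle_of_ne, ka, kb])⟩
  · obtain ⟨h1, h2⟩ := h (false, c)
    obtain ⟨h3, h4⟩ := h (false, b)
    refine ⟨h1.trans ?_, h3.trans ?_, (congrArg₂ (fun x y => x + (1 + y)) h2 h4).trans ?_⟩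
    · simp [permTop_apply, hook_mate_right, Equiv.swap_apply_of_ne_of_ne hab hca.symm]
    · simp [permTop_apply, hook_mate_of_ne, hca, hcb]
    · simp [permTop_apply, hook_angle_right, hook_angle_of_ne, hca, hcb]

/-- The zigzag straightens: the strand in column `c` collects the angles `-1, -1, 1, 1`, with sum 0.
-/
lemma hook_comp_hook_next {a b c : Fin n} (hab : a ≠ b) (hbc : b ≠ c) (hca : c ≠ a) :
    (hook a b hab).comp ((hook b c hbc).comp (hook a b hab)) = hook a b hab := by
  have s : (hook a b hab).mate (false, c) = (true, c) := hook_mate_of_ne hab _ hca hbc.symm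
  refine hook_comp_eq_hook hab _ hca hbc.symm ?_ ?_ (Or.inr ?_)
  · obtain ⟨h1, h2⟩ := hook_comp_of_ne hbc (G := hook a b hab) (v := (true, a)) (by simp) (by simp)
      (by simp [hook_mate_left]) (by simp [hook_mate_left])
    exact ⟨h1.trans (hook_mate_left hab _), h2.trans (hook_angle_left hab _)⟩
  · intro k ka kb kc
    obtain ⟨h1, h2⟩ := hook_comp_of_ne hbc (G := hook a b hab) (v := (false, k)) (by simpa)
      (by simpa) (by simp [hook_mate_of_ne, ka, kb]) (by simp [hook_mate_of_ne, ka, kb])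
    exact ⟨h1.trans (hook_mate_of_ne hab _ ka kb), h2.trans (hook_angle_of_ne hab _ ka kb)⟩
  · obtain ⟨h1, h2⟩ := hook_comp_cup' hbc (G := hook a b hab)
    obtain ⟨h3, h4⟩ := hook_comp_left hbc (G := hook a b hab) (v := (false, a)) (by simpa)
      (by simpa using hca.symm) (hook_mate_left hab _)
    refine ⟨h1, h3.trans s, ?_⟩
    rw [h2, h4, hook_angle_left, hook_angle_of_ne hab _ hca hbc.symm]
    norm_num

lemma hook_comp_hook_prev {a b c : Fin n} (hab : a ≠ b) (hbc : b ≠ c) (hca : c ≠ a) :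
    (hook b c hbc).comp ((hook a b hab).comp (hook b c hbc)) = hook b c hbc := by
  have s : (hook b c hbc).mate (false, a) = (true, a) := hook_mate_of_ne hbc _ hab hca.symm
  refine hook_comp_eq_hook hbc _ hab hca.symm ?_ ?_ (Or.inl ?_)
  · obtain ⟨h1, h2⟩ := hook_comp_of_ne hab (G := hook b c hbc) (v := (true, b)) (by simp) (by simp)
      (by simp [hook_mate_left]) (by simp [hook_mate_left])
    exact ⟨h1.trans (hook_mate_left hbc _), h2.trans (hook_angle_left hbc _)⟩
  · intro k kb kc ka
    obtain ⟨h1, h2⟩ := hook_comp_of_ne hab (G := hook b c hbc) (v := (false, k)) (by simpa)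
      (by simpa) (by simp [hook_mate_of_ne, kb, kc]) (by simp [hook_mate_of_ne, kb, kc])
    exact ⟨h1.trans (hook_mate_of_ne hbc _ kb kc), h2.trans (hook_angle_of_ne hbc _ kb kc)⟩
  · obtain ⟨h1, h2⟩ := hook_comp_cup hab (G := hook b c hbc)
    obtain ⟨h3, h4⟩ := hook_comp_right hab (G := hook b c hbc) (v := (false, c)) (by simpa)
      (by simpa using hbc.symm) (hook_mate_right hbc _)
    refine ⟨h1, h3.trans s, ?_⟩
    rw [h2, h4, hook_angle_right, hook_angle_of_ne hbc _ hab hca.symm]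
    norm_num

/-- The product of two hooks with disjoint columns. -/
lemma hook_comp_hook_apply {a b c d : Fin n} (hab : a ≠ b) (hcd : c ≠ d) (hac : a ≠ c) (had : a ≠ d)
    (hbc : b ≠ c) (hbd : b ≠ d) (r : Bool) (k : Fin n) :
    (((hook a b hab).comp (hook c d hcd)).net.mate (r, k) =
      if k = a ∨ k = b then (hook a b hab).mate (r, k) else (hook c d hcd).mate (r, k)) ∧
    (((hook a b hab).comp (hook c d hcd)).net.angle (r, k) =
      if k = a ∨ k = b then (hook a b hab).net.angle (r, k)
      else (hook c d hcd).net.angle (r, k)) := by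
  have key : ∀ r, (((hook a b hab).comp (hook c d hcd)).net.mate (r, a) = (r, b)) ∧
      ((hook a b hab).comp (hook c d hcd)).net.angle (r, a) = 1 := by
    intro r
    cases r
    · exact hook_comp_cup hab
    · obtain ⟨h1, h2⟩ := hook_comp_left hab (G := hook c d hcd) (v := (true, a)) (by simp) (by simp)
        (hook_mate_of_ne hcd _ hac had)
      rw [hook_angle_of_ne hcd _ hac had, hook_angle_of_ne hcd _ hbc hbd] at h2
      exact ⟨h1.trans (hook_mate_of_ne hcd _ hbc hbd), h2⟩
  by_cases ka : k = a
  · subst ka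
    simp [hook_mate_left, hook_angle_left, key]
  by_cases kb : k = b
  · subst kb
    have h := Net.eq_at_mate (N := ((hook a k hab).comp (hook c d hcd)).net)
      (M := (hook a k hab).net) (v := (r, a)) (w := (r, k))
      ⟨(key r).1.trans (hook_mate_left hab _).symm, (key r).2.trans (hook_angle_left hab _).symm⟩
      (hook_mate_left hab _)
    simp only [or_true, if_true]
    exact h
  · simp only [ka, kb, or_self, if_false]
    have h2 : ((hook c d hcd).mate (r, k)).2 ≠ a ∧ ((hook c d hcd).mate (r, k)).2 ≠ b := by
      by_cases kc : k = c
      · subst kc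
        rw [hook_mate_left]
        exact ⟨had.symm, hbd.symm⟩
      by_cases kd : k = d
      · subst kd
        rw [hook_mate_right]
        exact ⟨hac.symm, hbc.symm⟩
      rw [hook_mate_of_ne hcd _ kc kd]
      exact ⟨ka, kb⟩
    exact hook_comp_of_ne hab (by simp [ka]) (by simp [kb])
      (fun hc => h2.1 (by rw [hc])) (fun hc => h2.2 (by rw [hc]))

lemma hook_comp_comm {a b c d : Fin n} (hab : a ≠ b) (hcd : c ≠ d) (hac : a ≠ c) (had : a ≠ d)
    (hbc : b ≠ c) (hbd : b ≠ d) :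
    (hook a b hab).comp (hook c d hcd) = (hook c d hcd).comp (hook a b hab) := by
  refine ArrowTangle.ext_net fun ⟨r, k⟩ => ?_
  obtain ⟨h1, h2⟩ := hook_comp_hook_apply hab hcd hac had hbc hbd r k
  obtain ⟨h3, h4⟩ := hook_comp_hook_apply hcd hab hac.symm hbc.symm had.symm hbd.symm r k
  rw [h1, h2, h3, h4]
  by_cases kab : k = a ∨ k = b
  · have kcd : ¬ (k = c ∨ k = d) := by
      rintro (rfl | rfl) <;> rcases kab with rfl | rfl <;> contradiction
    simp [kab, kcd]
  by_cases kcd : k = c ∨ k = d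
  · simp [kab, kcd]
  · simp only [kab, kcd, if_false]
    rw [not_or] at kab kcd
    rw [hook_mate_of_ne hab _ kab.1 kab.2, hook_mate_of_ne hcd _ kcd.1 kcd.2,
      hook_angle_of_ne hab _ kab.1 kab.2, hook_angle_of_ne hcd _ kcd.1 kcd.2]
    exact ⟨rfl, rfl⟩

end Relations

/-! ## Closures after removing the last strand -/

section LastStrand

variable {n : ℕ}

/-- The jump to the other row in the last column. -/
def flipLast (v : Vertex (n + 1)) : Vertex (n + 1) := if v.2 = Fin.last n then flipRow v else v

lemma flipLast_last (r : Bool) : flipLast (r, Fin.last n) = (!r, Fin.last n) := by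
  simp [flipLast, flipRow]

lemma flipLast_vertexSucc (v : Vertex n) : flipLast (vertexSucc v) = vertexSucc v := by
  simp [flipLast, vertexSucc]

lemma flipLast_flipLast (v : Vertex (n + 1)) : flipLast (flipLast v) = v := by
  rcases eq_vertexSucc_or v with ⟨u, rfl⟩ | h
  · simp [flipLast_vertexSucc]
  · rw [h]
    simp [flipLast_last]

lemma flipLast_eq_iff (v : Vertex (n + 1)) : flipLast v = v ↔ ∃ u, vertexSucc u = v := by
  rcases eq_vertexSucc_or v with ⟨u, rfl⟩ | h
  · simp [flipLast_vertexSucc]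
  · rw [h, flipLast_last]
    simp [vertexSucc_ne]

/-- The last column is closed first, the other columns afterwards. This isolates the effect of the
added strand. -/
theorem closureFactor_of_isReduction {K : ArrowTangle (n + 1)} {G : ArrowTangle n}
    (h : K.net.IsReduction flipLast G.net vertexSucc) {S : Finset (Vertex (n + 1))}
    (hS : K.net.IsTransversal flipLast S) :
    closureFactor K = (∏ x ∈ S, K.net.value flipLast x) * closureFactor G := by
  obtain ⟨S', hS', hG⟩ := exists_transversal_closure G
  have b : ∀ v : Vertex (n + 1), flipLast v ≠ v → flipRow v = flipLast v := by
    intro v hv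
    unfold flipLast at hv ⊢
    split_ifs at hv ⊢
    · rfl
    · exact absurd rfl hv
  have hu := h.isTransversal_union flipLast_flipLast b (h := flipRow) (fun _ => rfl) flipRow_flipRow hS hS'
  rw [closureFactor_eq _ hu, hG,
    h.prod_union flipLast_flipLast b (h := flipRow) (fun _ => rfl) flipRow_flipRow hS]

/-- The added strand closes by itself into a loop of angle 0. -/
theorem closureFactor_sharp (G : ArrowTangle n) :
    closureFactor G.sharp = z 0 * closureFactor G := by
  have hred : G.sharp.net.IsReduction flipLast G.net vertexSucc :=
    { injective := vertexSucc_injective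
      fixed_iff := flipLast_eq_iff
      arc := fun v => .last (sharp_mate G v) (flipLast_vertexSucc _) (sharp_angle G v) }
  have s : ∀ r, G.sharp.net.step flipLast (r, Fin.last n) = (r, Fin.last n) := by
    intro r
    refine (congrArg flipLast (sharp_mate_last G r)).trans ?_
    rw [flipLast_last, Bool.not_not]
  have hc : ∀ r, G.sharp.net.IsClosed flipLast (r, Fin.last n) := by
    intro r i
    rw [Function.iterate_fixed (s r), flipLast_last]
    simp
  have hS := Net.isTransversal_singleton (hc false) (by
    intro y hy
    rcases eq_vertexSucc_or y with ⟨u, rfl⟩ | h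
    · exact absurd (flipLast_vertexSucc u) (hy 0)
    · rw [h]
      cases y.1
      · exact ⟨0, Or.inl rfl⟩
      · exact ⟨0, Or.inr (flipLast_last true).symm⟩)
  have hv : G.sharp.net.value flipLast (false, Fin.last n) = z 0 :=
    Net.value_eq_z_zero (k := 1) one_pos (s false) (by rw [Net.walkSum_one, sharp_angle_last])
  rw [closureFactor_of_isReduction hred hS, prod_singleton, hv]

/-- If the last strand of `K` subdivides the pair of `(0,k)` in `G`, without changing the angle, then
the closures of `K` and `G` have the same cycles. -/
theorem closureFactor_of_subdivision {K : ArrowTangle (n + 1)} {G : ArrowTangle n} {k : Fin n}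
    {r : Bool} {ε : ℤ}
    (h1 : K.net.mate (vertexSucc (false, k)) = (r, Fin.last n) ∧
      K.net.angle (vertexSucc (false, k)) = ε)
    (h2 : K.net.mate (!r, Fin.last n) = vertexSucc (G.net.mate (false, k)) ∧
      K.net.angle (!r, Fin.last n) = -ε + G.net.angle (false, k))
    (h3 : ∀ u, u ≠ (false, k) → G.net.mate u ≠ (false, k) →
      K.net.mate (vertexSucc u) = vertexSucc (G.net.mate u) ∧
        K.net.angle (vertexSucc u) = G.net.angle u) :
    closureFactor K = closureFactor G := by
  have h4 : K.net.mate (r, Fin.last n) = vertexSucc (false, k) ∧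
      K.net.angle (r, Fin.last n) = -ε := by
    rw [← h1.1, K.net.mate_mate, K.net.angle_mate, h1.2]
    exact ⟨rfl, rfl⟩
  have harc : ∀ u, K.net.Arc flipLast (vertexSucc u) (vertexSucc (G.net.mate u))
      (G.net.angle u) := by
    intro u
    by_cases hu : u = (false, k)
    · subst hu
      refine .cons (y := (!r, Fin.last n)) (by rw [h1.1, flipLast_last]) (by rw [h1.1]; simp)
        (.last h2.1 (flipLast_vertexSucc _) h2.2) (by rw [h1.2]; ring)
    by_cases hu' : G.net.mate u = (false, k)
    · have h5 : K.net.mate (vertexSucc u) = (!r, Fin.last n) ∧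
          K.net.angle (vertexSucc u) = ε + G.net.angle u := by
        have : vertexSucc u = K.net.mate (!r, Fin.last n) := by
          rw [h2.1, ← hu', G.net.mate_mate]
        rw [this, K.net.mate_mate, K.net.angle_mate, h2.2, ← hu', G.net.angle_mate]
        exact ⟨rfl, by ring⟩
      rw [hu']
      refine .cons (y := (r, Fin.last n)) (by rw [h5.1, flipLast_last, Bool.not_not])
        (by rw [h5.1]; simp) (.last h4.1 (flipLast_vertexSucc _) h4.2) (by rw [h5.2]; ring)
    · obtain ⟨e1, e2⟩ := h3 u hu hu'
      exact .last e1 (flipLast_vertexSucc _) e2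
  have hred : K.net.IsReduction flipLast G.net vertexSucc :=
    ⟨vertexSucc_injective, flipLast_eq_iff, harc⟩
  have hS : K.net.IsTransversal flipLast ∅ := by
    refine Net.isTransversal_empty fun x hx => ?_
    rcases eq_vertexSucc_or x with ⟨u, rfl⟩ | h
    · exact hx 0 (flipLast_vertexSucc _)
    · rw [h] at hx
      by_cases hr : x.1 = r
      · rw [hr] at hx
        exact (Net.Arc.last h4.1 (flipLast_vertexSucc _) h4.2).not_isClosed flipLast_flipLast hx
      · have hr : x.1 = !r := by
          revert hr
          cases x.1 <;> cases r <;> simp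
        rw [hr] at hx
        exact (Net.Arc.last h2.1 (flipLast_vertexSucc _) h2.2).not_isClosed flipLast_flipLast hx
  rw [closureFactor_of_isReduction hred hS, prod_empty, one_mul]

variable (G : ArrowTangle n) (k : Fin n)

/-- The detour through the last strand costs angle 1 on the pair `{(0,k), (0,n+1)}` and gets `-1`
back in the lower half of the hook, so the closure is unchanged. -/
lemma closureFactor_hook_comp_sharp (h : k.castSucc ≠ Fin.last n) :
    closureFactor ((hook k.castSucc (Fin.last n) h).comp G.sharp) = closureFactor G := by
  refine closureFactor_of_subdivision (k := k) (hook_comp_cup h) ?_ ?_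
  · obtain ⟨h1, h2⟩ := hook_comp_right h (v := (true, Fin.last n)) (by simp) (by simp)
      (sharp_mate_last G true)
    refine ⟨h1.trans (sharp_mate G (false, k)), h2.trans ?_⟩
    rw [sharp_angle_last, zero_add]
    congr 1
    exact sharp_angle G (false, k)
  · intro u hu hu'
    have e := sharp_mate G u
    obtain ⟨h1, h2⟩ := hook_comp_of_ne h (G := G.sharp)
      (vertexSucc_injective.ne hu) (vertexSucc_ne _ _)
      (e ▸ vertexSucc_injective.ne hu') (e ▸ vertexSucc_ne _ _)
    exact ⟨h1.trans e, h2.trans (sharp_angle G u)⟩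

lemma closureFactor_hook_comp_sharp' (h : Fin.last n ≠ k.castSucc) :
    closureFactor ((hook (Fin.last n) k.castSucc h).comp G.sharp) = closureFactor G := by
  refine closureFactor_of_subdivision (k := k) (hook_comp_cup' h) ?_ ?_
  · obtain ⟨h1, h2⟩ := hook_comp_left h (v := (true, Fin.last n)) (by simp) (by simp)
      (sharp_mate_last G true)
    refine ⟨h1.trans (sharp_mate G (false, k)), h2.trans ?_⟩
    rw [sharp_angle_last, zero_add, neg_neg]
    congr 1
    exact sharp_angle G (false, k)
  · intro u hu hu'
    have e := sharp_mate G u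
    obtain ⟨h1, h2⟩ := hook_comp_of_ne h (G := G.sharp)
      (vertexSucc_ne _ _) (vertexSucc_injective.ne hu)
      (e ▸ vertexSucc_ne _ _) (e ▸ vertexSucc_injective.ne hu')
    exact ⟨h1.trans e, h2.trans (sharp_angle G u)⟩

lemma closureFactor_swap_comp_sharp :
    closureFactor ((ArrowTangle.ofPerm (Equiv.swap k.castSucc (Fin.last n))).comp G.sharp) =
      closureFactor G := by
  have h := ofPerm_comp (Equiv.swap k.castSucc (Fin.last n)) G.sharp
  have key : ∀ u, u ≠ (false, k) →
      permTop (Equiv.swap k.castSucc (Fin.last n)) (vertexSucc u) = vertexSucc u := by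
    rintro ⟨r, l⟩ hu
    cases r
    · have hl : l ≠ k := by simpa using hu
      simp only [vertexSucc, (permTop_apply _ _).1]
      rw [Equiv.swap_apply_of_ne_of_ne ((Fin.castSucc_injective n).ne hl)
        (Fin.castSucc_ne_last l)]
    · rfl
  have key' : ∀ u, u ≠ (false, k) →
      (permTop (Equiv.swap k.castSucc (Fin.last n))).symm (vertexSucc u) = vertexSucc u := by
    intro u hu
    rw [Equiv.symm_apply_eq, key u hu]
  refine closureFactor_of_subdivision (k := k) (r := true) (ε := 0) ?_ ?_ ?_
  · obtain ⟨h1, h2⟩ := h (vertexSucc (false, k))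
    rw [h1, h2]
    simp [vertexSucc, permTop_apply, sharp_mate_last, sharp_angle_last]
  · obtain ⟨h1, h2⟩ := h (false, Fin.last n)
    have e : permTop (Equiv.swap k.castSucc (Fin.last n)) (false, Fin.last n) =
        vertexSucc (false, k) := by
      simp [permTop_apply, vertexSucc]
    rw [e] at h1 h2
    rw [sharp_mate, key' _ (G.mate_ne _)] at h1
    exact ⟨h1, h2.trans (by rw [sharp_angle, neg_zero, zero_add])⟩
  · intro u hu hu'
    obtain ⟨h1, h2⟩ := h (vertexSucc u)
    rw [key u hu] at h1 h2
    rw [sharp_mate] at h1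
    exact ⟨h1.trans (key' _ hu'), h2.trans (sharp_angle G u)⟩

end LastStrand

/-! ## Skein elements in an algebra -/

section Skein

variable {R B : Type*} [CommRing R] [Ring B] [Algebra R B]

/-- The image of a crossing whose horizontal smoothing is `e`. -/
def skein (q : R) (e : B) : B := -(q • 1) - q ^ 2 • e

/-- With loop value `-q - q'`, the coefficient of `e` in the product is `q q' (q + q') (1 - q q')`,
which vanishes. -/
lemma skein_mul_skein {q q' : R} (h : q * q' = 1) {e : B} (he : e * e = (-q - q') • e) :
    skein q e * skein q' e = 1 := by
  simp only [skein, sub_mul, mul_sub, neg_mul, mul_neg, smul_mul_assoc, mul_smul_comm, one_mul,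
    mul_one, he]
  match_scalars
  · linear_combination h
  · linear_combination (-q * q' * (q + q')) * h

lemma skein_commute {q : R} {e f : B} (h : e * f = f * e) :
    skein q e * skein q f = skein q f * skein q e := by
  simp only [skein, sub_mul, mul_sub, neg_mul, mul_neg, smul_mul_assoc, mul_smul_comm, one_mul,
    mul_one, h]
  module

lemma mul_skein {q : R} {u e f : B} (h : u * e = f * u) : u * skein q e = skein q f * u := by
  simp only [skein, sub_mul, mul_sub, neg_mul, mul_neg, smul_mul_assoc, mul_smul_comm, one_mul,
    mul_one, h]

/-- After expansion the relations for `e` and `f` leave `-q ^ 4` as coefficient of both `e` and `f`;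
the other terms are visibly symmetric. -/
lemma skein_braid {q q' : R} (h : q * q' = 1) {e f : B} (he : e * e = (-q - q') • e)
    (hf : f * f = (-q - q') • f) (hefe : e * (f * e) = e) (hfef : f * (e * f) = f) :
    skein q e * skein q f * skein q e = skein q f * skein q e * skein q f := by
  simp only [skein, sub_mul, mul_sub, neg_mul, mul_neg, smul_mul_assoc, mul_smul_comm, one_mul,
    mul_one, mul_assoc, he, hf, hefe, hfef]
  match_scalars
  all_goals first
    | ring1
    | linear_combination q ^ 4 * h
    | linear_combination -q ^ 4 * h

/-- The terms in `w`, `w e` and `e w` contribute `(-q - q') t`, `q' t` and `q t`, which cancel. Only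
`e w e = e`, with coefficient `(q q')² = 1`, survives. -/
lemma trace_skein_conj {q q' : R} (h : q * q' = 1) {e w x : B} (T : B →ₗ[R] R) {s t : R}
    (hewe : e * (w * e) = e) (hw : T (x * w) = (-q - q') * t) (hwe : T (x * (w * e)) = t)
    (hew : T (x * (e * w)) = t) (he : T (x * e) = s) :
    T (x * skein q e * w * skein q' e) = s := by
  simp only [skein, sub_mul, mul_sub, neg_mul, mul_neg, smul_mul_assoc, mul_smul_comm,
    mul_one, mul_assoc, hewe, map_sub, map_neg, map_smul, hw, hwe, hew, he, smul_eq_mul]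
  linear_combination (-q * t - q' * t + q' * t + q * t + s * (q * q' + 1)) * h

end Skein

lemma Apow_mul (k l : ℤ) : Apow k * Apow l = Apow (k + l) := by
  rw [Apow, Apow, Apow, ← map_mul, LaurentPolynomial.T_add]

lemma Apow_sq (k : ℤ) : Apow k ^ 2 = Apow (k + k) := by rw [sq, Apow_mul]

lemma Apow_zero : Apow 0 = 1 := by rw [Apow, LaurentPolynomial.T_zero, map_one]

/-! ## The algebra `ATL n` -/

namespace ATL

variable {n : ℕ}

lemma induction {P : ATL n → Prop} (x : ATL n) (h0 : P 0) (hadd : ∀ x y, P x → P y → P (x + y))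
    (hof : ∀ (r : Ra) F, P (r • of F)) : P x := by
  refine Finsupp.induction_linear (motive := P) x h0 hadd fun F r => ?_
  have h : (r • of F : ATL n) = (Finsupp.single F r : ArrowTangle n →₀ Ra) :=
    (Finsupp.smul_single r F 1).trans (by rw [smul_eq_mul, mul_one])
  exact h ▸ hof r F

lemma isAlgebra (n : ℕ) : IsAlgebra Ra (ATL n) := by
  have add_mul : ∀ x y t : ATL n, (x + y) * t = x * t + y * t := fun x y t => by
    change mulMap (x + y) t = _
    rw [map_add]
    rfl
  have mul_add : ∀ x y t : ATL n, x * (y + t) = x * y + x * t := fun x y t =>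
    map_add (mulMap x) y t
  have smul_mul : ∀ (r : Ra) (x y : ATL n), (r • x) * y = r • (x * y) := fun r x y => by
    change mulMap (r • x) y = _
    rw [map_smul]
    rfl
  have mul_smul : ∀ (r : Ra) (x y : ATL n), x * (r • y) = r • (x * y) := fun r x y =>
    map_smul (mulMap x) r y
  have zero_mul : ∀ x : ATL n, 0 * x = 0 := fun x => by
    change mulMap 0 x = 0
    rw [map_zero]
    rfl
  have mul_zero : ∀ x : ATL n, x * 0 = 0 := fun x => map_zero (mulMap x)
  refine ⟨add_mul, mul_add, smul_mul, mul_smul, fun x y t => ?_, fun x => ?_, fun x => ?_⟩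
  · induction x using induction with
    | h0 => simp only [zero_mul]
    | hadd x x' h h' => simp only [add_mul, h, h']
    | hof r F =>
      induction y using induction with
      | h0 => simp only [zero_mul, mul_zero]
      | hadd y y' h h' => simp only [add_mul, mul_add, h, h']
      | hof r' F' =>
        induction t using induction with
        | h0 => simp only [mul_zero]
        | hadd t t' h h' => simp only [mul_add, h, h']
        | hof r'' F'' =>
          obtain ⟨h1, h2⟩ := comp_assoc_cycleFactor F F' F''
          simp only [smul_mul, mul_smul, of_mul_of, h1, smul_smul]
          congr 1
          linear_combination r * r' * r'' * h2
  · induction x using induction with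
    | h0 => exact mul_zero 1
    | hadd x y h h' => rw [mul_add, h, h']
    | hof r F =>
      change of (ArrowTangle.ofPerm 1) * _ = _
      rw [mul_smul, of_mul_of, cycleFactor_ofPerm_left, ofPerm_one_comp, one_smul]
  · induction x using induction with
    | h0 => exact zero_mul 1
    | hadd x y h h' => rw [add_mul, h, h']
    | hof r F =>
      change _ * of (ArrowTangle.ofPerm 1) = _
      rw [smul_mul, of_mul_of, cycleFactor_ofPerm_right, comp_ofPerm_one, one_smul]

/-- The ring structure of `ATL n`. -/
@[reducible] def ring (n : ℕ) : Ring (ATL n) :=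
  { (inferInstance : AddCommGroup (ATL n)), (inferInstance : Mul (ATL n)),
    (inferInstance : One (ATL n)) with
    left_distrib := (isAlgebra n).mul_add
    right_distrib := (isAlgebra n).add_mul
    mul_assoc := (isAlgebra n).mul_assoc
    one_mul := (isAlgebra n).one_mul
    mul_one := (isAlgebra n).mul_one
    zero_mul := fun x => by
      have h := (isAlgebra n).add_mul 0 0 x
      rw [add_zero] at h
      exact left_eq_add.1 h
    mul_zero := fun x => by
      have h := (isAlgebra n).mul_add x 0 0
      rw [add_zero] at h
      exact left_eq_add.1 h }

attribute [local instance] ring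

/-- The algebra structure of `ATL n`. -/
@[reducible] def algebra (n : ℕ) : Algebra Ra (ATL n) :=
  Algebra.ofModule (isAlgebra n).smul_mul (isAlgebra n).mul_smul

attribute [local instance] algebra

lemma incl_of (F : ArrowTangle n) : incl n (of F) = of F.sharp := lift_of _ F

lemma trace_of (F : ArrowTangle n) : trace n (of F) = closureFactor F := lift_of _ F

lemma incl_mul (x y : ATL n) : incl n (x * y) = incl n x * incl n y := by
  induction x using induction with
  | h0 => simp only [zero_mul, map_zero]
  | hadd x x' h h' => simp only [add_mul, map_add, h, h']
  | hof r F =>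
    induction y using induction with
    | h0 => simp only [mul_zero, map_zero]
    | hadd y y' h h' => simp only [mul_add, map_add, h, h']
    | hof r' F' =>
      simp only [smul_mul_assoc, mul_smul_comm, map_smul, of_mul_of, incl_of, cycleFactor_sharp,
        comp_sharp]

lemma trace_mul_comm (x y : ATL n) : trace n (x * y) = trace n (y * x) := by
  induction x using induction with
  | h0 => simp only [zero_mul, mul_zero, map_zero]
  | hadd x x' h h' => simp only [add_mul, mul_add, map_add, h, h']
  | hof r F =>
    induction y using induction with
    | h0 => simp only [zero_mul, mul_zero, map_zero]
    | hadd y y' h h' => simp only [add_mul, mul_add, map_add, h, h']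
    | hof r' F' =>
      simp only [smul_mul_assoc, mul_smul_comm, map_smul, of_mul_of, trace_of, smul_eq_mul]
      linear_combination r * r' * cycleFactor_mul_closureFactor_comm F F'

/-- The map sends a basis injectively into a basis. -/
lemma incl_injective (n : ℕ) : Function.Injective (incl n) := by
  have h : LinearIndependent Ra
      (fun F : ArrowTangle n => (Finsupp.single F.sharp 1 : ArrowTangle (n + 1) →₀ Ra)) :=
    (Finsupp.linearIndependent_single_one Ra (ArrowTangle (n + 1))).comp _ sharp_injective
  exact h

/-! ### Permutations and hooks -/

/-- The element of `ATL n` given by a permutation. -/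
def perm (p : Equiv.Perm (Fin n)) : ATL n := of (ArrowTangle.ofPerm p)

/-- The element of `ATL n` given by a hook. -/
def hookElt (a b : Fin n) (hab : a ≠ b) : ATL n := of (hook a b hab)

lemma perm_one : perm (1 : Equiv.Perm (Fin n)) = 1 := rfl

lemma perm_mul_perm (p q : Equiv.Perm (Fin n)) : perm p * perm q = perm (q * p) := by
  rw [perm, perm, of_mul_of, cycleFactor_ofPerm_left, one_smul, ofPerm_comp_ofPerm, perm]

lemma perm_mul_hookElt (p : Equiv.Perm (Fin n)) {a b c d : Fin n} (hab : a ≠ b) (hcd : c ≠ d)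
    (hc : p a = c) (hd : p b = d) : perm p * hookElt c d hcd = hookElt a b hab * perm p := by
  subst hc hd
  rw [perm, hookElt, hookElt, of_mul_of, of_mul_of, cycleFactor_ofPerm_left,
    cycleFactor_ofPerm_right, ofPerm_comp_hook p hab]

lemma hookElt_mul_self {a b : Fin n} (hab : a ≠ b) :
    hookElt a b hab * hookElt a b hab = z 0 • hookElt a b hab := by
  rw [hookElt, of_mul_of, cycleFactor_hook_loop hab (hook_mate_left hab _)
    (hook_angle_left hab _), hook_comp_self]

lemma hookElt_mul_of {a b : Fin n} (hab : a ≠ b) {G : ArrowTangle n}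
    (h : G.mate (false, a) ≠ (false, b)) :
    hookElt a b hab * of G = of ((hook a b hab).comp G) := by
  rw [hookElt, of_mul_of, cycleFactor_hook hab h, one_smul]

lemma hookElt_mul_hookElt {a b c d : Fin n} (hab : a ≠ b) (hcd : c ≠ d)
    (h : (hook c d hcd).mate (false, a) ≠ (false, b)) :
    hookElt a b hab * hookElt c d hcd = of ((hook a b hab).comp (hook c d hcd)) :=
  hookElt_mul_of hab h

lemma hookElt_mul_comm {a b c d : Fin n} (hab : a ≠ b) (hcd : c ≠ d) (hac : a ≠ c) (had : a ≠ d)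
    (hbc : b ≠ c) (hbd : b ≠ d) :
    hookElt a b hab * hookElt c d hcd = hookElt c d hcd * hookElt a b hab := by
  rw [hookElt_mul_hookElt hab hcd (by rw [hook_mate_of_ne hcd _ hac had]; simp),
    hookElt_mul_hookElt hcd hab (by rw [hook_mate_of_ne hab _ hac.symm hbc.symm]; simp),
    hook_comp_comm hab hcd hac had hbc hbd]

lemma hookElt_next {a b c : Fin n} (hab : a ≠ b) (hbc : b ≠ c) (hca : c ≠ a) :
    hookElt a b hab * (hookElt b c hbc * hookElt a b hab) = hookElt a b hab := by
  have h : ((hook b c hbc).comp (hook a b hab)).mate (false, a) = _ :=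
    (hook_comp_left hbc (G := hook a b hab) (v := (false, a)) (by simpa)
      (by simpa using hca.symm) (hook_mate_left hab _)).1
  rw [hookElt_mul_hookElt hbc hab
    (by rw [hook_mate_right hab]; simpa using hca.symm), hookElt_mul_of hab, hook_comp_hook_next,
    hookElt]
  · exact hca
  · rw [h, hook_mate_of_ne hab _ hca hbc.symm]
    simp

lemma hookElt_prev {a b c : Fin n} (hab : a ≠ b) (hbc : b ≠ c) (hca : c ≠ a) :
    hookElt b c hbc * (hookElt a b hab * hookElt b c hbc) = hookElt b c hbc := by
  have h : ((hook a b hab).comp (hook b c hbc)).mate (false, b) = _ :=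
    (hook_comp_cup' hab (G := hook b c hbc)).1
  rw [hookElt_mul_hookElt hab hbc
    (by rw [hook_mate_of_ne hbc _ hab hca.symm]; simp), hookElt_mul_of hbc, hook_comp_hook_prev,
    hookElt]
  · exact hca
  · rw [h]
    simpa using hca.symm

lemma hookElt_swap_left {a b c : Fin n} (hab : a ≠ b) (hca : c ≠ a) (hcb : c ≠ b) :
    hookElt a b hab * (perm (Equiv.swap a c) * hookElt a b hab) = hookElt a b hab := by
  rw [perm, hookElt, of_mul_of, cycleFactor_ofPerm_left, one_smul, ← hookElt, hookElt_mul_of hab,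
    hook_comp_swap_left hab hca hcb]
  · rfl
  have h := (ofPerm_comp (Equiv.swap a c) (hook a b hab) (false, a)).1
  intro h'
  have := h.symm.trans h'
  simp [permTop_apply, hook_mate_of_ne, hca, hcb] at this

lemma hookElt_swap_right {a b c : Fin n} (hab : a ≠ b) (hca : c ≠ a) (hcb : c ≠ b) :
    hookElt a b hab * (perm (Equiv.swap b c) * hookElt a b hab) = hookElt a b hab := by
  rw [perm, hookElt, of_mul_of, cycleFactor_ofPerm_left, one_smul, ← hookElt, hookElt_mul_of hab,
    hook_comp_swap_right hab hca hcb]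
  · rfl
  have h := (ofPerm_comp (Equiv.swap b c) (hook a b hab) (false, a)).1
  intro h'
  have := h.symm.trans h'
  simp [permTop_apply, hook_mate_left, Equiv.swap_apply_of_ne_of_ne hab hca.symm, hcb] at this

/-! ### Traces after adding a strand -/

lemma trace_incl (x : ATL n) : trace (n + 1) (incl n x) = z 0 * trace n x := by
  induction x using induction with
  | h0 => simp only [map_zero, mul_zero]
  | hadd x y h h' => simp only [map_add, mul_add, h, h']
  | hof r F =>
    simp only [map_smul, incl_of, trace_of, closureFactor_sharp, smul_eq_mul]
    ring

/-- Cyclicity puts the new generator on the left, the side on which hooks and permutations were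
multiplied explicitly. -/
lemma trace_incl_mul {y : ATL (n + 1)}
    (h : ∀ F : ArrowTangle n, trace (n + 1) (y * of F.sharp) = closureFactor F) (x : ATL n) :
    trace (n + 1) (incl n x * y) = trace n x := by
  rw [trace_mul_comm]
  induction x using induction with
  | h0 => simp only [map_zero, mul_zero]
  | hadd x y h h' => simp only [map_add, mul_add, h, h']
  | hof r F => simp only [map_smul, mul_smul_comm, incl_of, trace_of, h]

lemma trace_incl_mul_hookElt (x : ATL n) (k : Fin n) (h : k.castSucc ≠ Fin.last n) :
    trace (n + 1) (incl n x * hookElt k.castSucc (Fin.last n) h) = trace n x :=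
  trace_incl_mul (fun F => by
    rw [hookElt_mul_of h (G := F.sharp), trace_of, closureFactor_hook_comp_sharp]
    exact (sharp_mate F (false, k)).trans_ne (vertexSucc_ne _ _)) x

lemma trace_incl_mul_hookElt' (x : ATL n) (k : Fin n) (h : Fin.last n ≠ k.castSucc) :
    trace (n + 1) (incl n x * hookElt (Fin.last n) k.castSucc h) = trace n x :=
  trace_incl_mul (fun F => by
    rw [hookElt_mul_of h (G := F.sharp), trace_of, closureFactor_hook_comp_sharp']
    rw [sharp_mate_last]
    simp) x

lemma trace_incl_mul_swap (x : ATL n) (k : Fin n) :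
    trace (n + 1) (incl n x * perm (Equiv.swap k.castSucc (Fin.last n))) = trace n x :=
  trace_incl_mul (fun F => by
    rw [perm, of_mul_of, cycleFactor_ofPerm_left, one_smul, trace_of,
      closureFactor_swap_comp_sharp]) x

end ATL

/-- The free strand contributes `-q (-q - q') t` and the hook contributes `-q ^ 2 t`; with `q q' =
1` the sum is `t`. -/
lemma trace_mul_skein {R B : Type*} [CommRing R] [Ring B] [Algebra R B] {q q' : R} (h : q * q' = 1)
    {e x : B} (T : B →ₗ[R] R) {t : R} (hx : T x = (-q - q') * t) (he : T (x * e) = t) :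
    T (x * skein q e) = t := by
  simp only [skein, mul_sub, mul_neg, mul_smul_comm, mul_one, map_sub, map_neg, map_smul, hx, he,
    smul_eq_mul]
  linear_combination t * h

/-! ### Constants, and generators after adding a strand. -/

lemma Apow_neg_two_mul : Apow (-2) * Apow 2 = 1 := by
  rw [Apow_mul, neg_add_cancel, Apow_zero]

lemma Apow_two_mul : Apow 2 * Apow (-2) = 1 := by
  rw [mul_comm, Apow_neg_two_mul]

lemma z_zero : z 0 = -Apow 2 - Apow (-2) := rfl

lemma z_zero' : z 0 = -Apow (-2) - Apow 2 := by rw [z_zero]; ring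

/-- Both sides are the transposition of `x` and `z`. -/
lemma swap_braid {α : Type*} [DecidableEq α] {x y z : α} (hxy : x ≠ y) (hxz : x ≠ z)
    (hyz : y ≠ z) : Equiv.swap x y * Equiv.swap y z * Equiv.swap x y =
      Equiv.swap y z * Equiv.swap x y * Equiv.swap y z := by
  rw [Equiv.swap_mul_swap_mul_swap hxy hxz, Equiv.swap_comm x y, Equiv.swap_comm y z,
    Equiv.swap_mul_swap_mul_swap hyz.symm hxz.symm, Equiv.swap_comm]

lemma ne_add_two (i : ℕ) : i ≠ i + 1 + 1 := by omega

lemma sharp_ofPerm_swap {n : ℕ} (a b : Fin n) :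
    (ArrowTangle.ofPerm (Equiv.swap a b)).sharp =
      ArrowTangle.ofPerm (Equiv.swap a.castSucc b.castSucc) := by
  have h : ∀ k : Fin n, Equiv.swap a.castSucc b.castSucc k.castSucc = (Equiv.swap a b k).castSucc :=
    fun k => ((Fin.castSucc_injective n).map_swap a b k).symm
  have h' := Equiv.swap_apply_of_ne_of_ne (Fin.castSucc_ne_last a).symm (Fin.castSucc_ne_last b).symm
  refine ArrowTangle.ext (funext ?_) (funext ?_) <;> rintro ⟨r, k⟩ <;>
    induction k using Fin.lastCases <;> cases r <;>
    simp [ArrowTangle.sharp, ArrowTangle.ofPerm, h, h']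

lemma sharp_cupCap {n : ℕ} {a b : Fin n} (hab : a ≠ b) :
    (ArrowTangle.cupCap a b hab).sharp =
      ArrowTangle.cupCap a.castSucc b.castSucc ((Fin.castSucc_injective n).ne hab) := by
  have ha := (Fin.castSucc_ne_last a).symm
  have hb := (Fin.castSucc_ne_last b).symm
  refine ArrowTangle.ext (funext ?_) (funext ?_) <;> rintro ⟨r, k⟩ <;>
    induction k using Fin.lastCases <;>
    simp [ArrowTangle.sharp, ArrowTangle.cupCap, ha, hb]
  split_ifs <;> simp

namespace ATL

attribute [local instance] ring algebra

variable {n : ℕ}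

lemma F_eq_hookElt (i : ℕ) (h : i + 1 < n) :
    F n i h = hookElt ⟨i, by omega⟩ ⟨i + 1, h⟩ (by simp) :=
  congrArg of (cupCap_eq_hook (Fin.mk_lt_mk.2 (Nat.lt_succ_self i)))

lemma w_eq_perm (i : ℕ) (h : i + 1 < n) :
    w n i h = perm (Equiv.swap ⟨i, by omega⟩ ⟨i + 1, h⟩) := rfl

lemma F_mul_F (i : ℕ) (h : i + 1 < n) : F n i h * F n i h = z 0 • F n i h := by
  rw [F_eq_hookElt, hookElt_mul_self]

lemma w_mul_w (i : ℕ) (h : i + 1 < n) : w n i h * w n i h = 1 := by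
  rw [w_eq_perm, perm_mul_perm, Equiv.swap_mul_self, perm_one]

lemma incl_F (i : ℕ) (h : i + 1 < n) : incl n (F n i h) = F (n + 1) i (by omega) := by
  rw [F, incl_of, sharp_cupCap]
  rfl

lemma incl_w (i : ℕ) (h : i + 1 < n) : incl n (w n i h) = w (n + 1) i (by omega) := by
  rw [w, incl_of, sharp_ofPerm_swap]
  rfl

lemma incl_one : incl n 1 = 1 := by
  refine (incl_of _).trans (congrArg of ?_)
  have h : ∀ m, Equiv.symm (1 : Equiv.Perm (Fin m)) = 1 := fun _ => rfl
  refine ArrowTangle.ext (funext ?_) (funext ?_) <;> rintro ⟨r, k⟩ <;>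
    induction k using Fin.lastCases <;> cases r <;>
    simp [ArrowTangle.sharp, ArrowTangle.ofPerm, h]

/-! ### The representations of the virtual braid groups -/

/-- The image of the generator `σ_i`. -/
def sigmaUnit (i : ℕ) (h : i + 1 < n) : (ATL n)ˣ where
  val := skein (Apow (-2)) (F n i h)
  inv := skein (Apow 2) (F n i h)
  val_inv := skein_mul_skein Apow_neg_two_mul (by rw [F_mul_F, z_zero'])
  inv_val := skein_mul_skein Apow_two_mul (by rw [F_mul_F, z_zero])

/-- The image of the generator `τ_i`. -/
def tauUnit (i : ℕ) (h : i + 1 < n) : (ATL n)ˣ where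
  val := w n i h
  inv := w n i h
  val_inv := w_mul_w i h
  inv_val := w_mul_w i h

/-- The images of the generators. -/
def genUnit : VBGen n → (ATL n)ˣ
  | VBGen.sigma i h => sigmaUnit i h
  | VBGen.tau i h => tauUnit i h

lemma F_mul_F_far (i j : ℕ) (hi : i + 1 < n) (hj : j + 1 < n) (h : i + 2 ≤ j ∨ j + 2 ≤ i) :
    F n i hi * F n j hj = F n j hj * F n i hi := by
  rw [F_eq_hookElt, F_eq_hookElt]
  apply hookElt_mul_comm <;> simp only [ne_eq, Fin.mk.injEq] <;> omega

lemma w_mul_w_far (i j : ℕ) (hi : i + 1 < n) (hj : j + 1 < n) (h : i + 2 ≤ j ∨ j + 2 ≤ i) :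
    w n i hi * w n j hj = w n j hj * w n i hi := by
  rw [w_eq_perm, w_eq_perm, perm_mul_perm, perm_mul_perm]
  congr 1
  refine (Equiv.Perm.disjoint_swap_swap ?_).commute
  simp only [List.nodup_cons, List.mem_cons, List.not_mem_nil, Fin.mk.injEq, not_or, or_false,
    List.nodup_nil, not_false_eq_true, and_true]
  omega

lemma w_mul_F_far (i j : ℕ) (hi : i + 1 < n) (hj : j + 1 < n) (h : i + 2 ≤ j ∨ j + 2 ≤ i) :
    w n i hi * F n j hj = F n j hj * w n i hi := by
  rw [w_eq_perm, F_eq_hookElt]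
  apply perm_mul_hookElt <;> apply Equiv.swap_apply_of_ne_of_ne <;>
    simp only [ne_eq, Fin.mk.injEq] <;> omega

lemma F_mul_F_mul_F (i j : ℕ) (hi : i + 1 < n) (hj : j + 1 < n) (h : i + 1 = j ∨ j + 1 = i) :
    F n i hi * (F n j hj * F n i hi) = F n i hi := by
  rw [F_eq_hookElt, F_eq_hookElt]
  rcases h with rfl | rfl
  · apply hookElt_next
    simp [(ne_add_two _).symm]
  · apply hookElt_prev
    simp [(ne_add_two _).symm]

lemma w_mul_w_mul_w (i j : ℕ) (hi : i + 1 < n) (hj : j + 1 < n) (h : i + 1 = j ∨ j + 1 = i) :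
    w n i hi * w n j hj * w n i hi = w n j hj * w n i hi * w n j hj := by
  have key : ∀ i (hi : i + 1 < n) (hj : i + 1 + 1 < n),
      w n i hi * w n (i + 1) hj * w n i hi = w n (i + 1) hj * w n i hi * w n (i + 1) hj := by
    intro i hi hj
    simp only [w_eq_perm, perm_mul_perm, ← mul_assoc]
    congr 1
    exact swap_braid (by simp) (by simp [ne_add_two]) (by simp)
  rcases h with rfl | rfl
  · exact key _ _ _
  · exact (key _ _ _).symm

lemma w_mul_w_mul_F (i j : ℕ) (hi : i + 1 < n) (hj : j + 1 < n) (h : i + 1 = j ∨ j + 1 = i) :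
    w n i hi * w n j hj * F n i hi = F n j hj * (w n i hi * w n j hj) := by
  rw [w_eq_perm, w_eq_perm, F_eq_hookElt, F_eq_hookElt, perm_mul_perm]
  rcases h with rfl | rfl
  · apply perm_mul_hookElt <;> simp [Equiv.swap_apply_def, ne_add_two, (ne_add_two _).symm]
  · apply perm_mul_hookElt <;> simp [Equiv.swap_apply_def, ne_add_two, (ne_add_two _).symm]

/-- Only the relations among hooks and permutations carry content; the skein lemmas transfer them to
the generators `σ_i`. -/
lemma genUnit_rel {a b : FreeGroup (VBGen n)} (h : VBRel n a b) :
    FreeGroup.lift genUnit a = FreeGroup.lift (genUnit (n := n)) b := by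
  have hs : ∀ i hi, FreeGroup.lift genUnit (fs (n := n) i hi) = sigmaUnit i hi :=
    fun i hi => FreeGroup.lift_apply_of
  have ht : ∀ i hi, FreeGroup.lift genUnit (ft (n := n) i hi) = tauUnit i hi :=
    fun i hi => FreeGroup.lift_apply_of
  have hf : ∀ i hi, F n i hi * F n i hi = (-Apow (-2) - Apow 2) • F n i hi := by
    intro i hi
    rw [F_mul_F, z_zero']
  cases h <;> simp only [map_mul, map_one, hs, ht] <;> apply Units.ext <;>
    simp only [Units.val_mul, Units.val_one, sigmaUnit, tauUnit]
  case tau_sq i hi => exact w_mul_w i hi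
  case sigma_sigma i j hi hj hij => exact skein_commute (F_mul_F_far i j hi hj hij)
  case tau_tau i j hi hj hij => exact w_mul_w_far i j hi hj hij
  case tau_sigma i j hi hj hij => exact mul_skein (w_mul_F_far i j hi hj hij)
  case braid_sigma i j hi hj hij =>
    exact skein_braid Apow_neg_two_mul (hf i hi) (hf j hj) (F_mul_F_mul_F i j hi hj hij)
      (F_mul_F_mul_F j i hj hi hij.symm)
  case braid_tau i j hi hj hij => exact w_mul_w_mul_w i j hi hj hij
  case braid_mixed i j hi hj hij =>
    rw [mul_assoc (skein _ _)]
    exact mul_skein (w_mul_w_mul_F i j hi hj hij)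

/-- The homomorphism from the virtual braid group to the units of `ATL n`. -/
def rep (n : ℕ) : VB n →* (ATL n)ˣ :=
  PresentedGroup.toGroup (f := genUnit) (by
    rintro r ⟨a, b, h, rfl⟩
    rw [map_mul, map_inv, genUnit_rel h, mul_inv_cancel])

lemma rep_sigma (i : ℕ) (h : i + 1 < n) : rep n (VB.σ n i h) = sigmaUnit i h :=
  PresentedGroup.toGroup.of _

lemma rep_tau (i : ℕ) (h : i + 1 < n) : rep n (VB.τ n i h) = tauUnit i h :=
  PresentedGroup.toGroup.of _

/-- The homomorphism `ρ_n` from the group algebra of the virtual braid group to `ATL n`. -/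
def rho (n : ℕ) : MonoidAlgebra Ra (VB n) →ₗ[Ra] ATL n :=
  (MonoidAlgebra.lift Ra (ATL n) (VB n) ((Units.coeHom (ATL n)).comp (rep n))).toLinearMap

lemma rho_single (β : VB n) (r : Ra) : rho n (MonoidAlgebra.single β r) = r • (rep n β : ATL n) :=
  MonoidAlgebra.lift_single _ β r

lemma rho_one : rho n 1 = 1 :=
  map_one (MonoidAlgebra.lift Ra (ATL n) (VB n) ((Units.coeHom (ATL n)).comp (rep n)))

lemma rho_mul (x y : MonoidAlgebra Ra (VB n)) : rho n (x * y) = rho n x * rho n y :=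
  map_mul (MonoidAlgebra.lift Ra (ATL n) (VB n) ((Units.coeHom (ATL n)).comp (rep n))) x y

lemma img_rho (β : VB n) : img rho β = (rep n β : ATL n) := by
  refine (rho_single β 1).trans ?_
  rw [one_smul]

/-- Both sides are group homomorphisms into units, so it suffices to compare them on generators. -/
lemma incl_rep (β : VB n) : incl n (rep n β : ATL n) = (rep (n + 1) (VB.incl n β) : ATL (n + 1)) := by
  let ι : ATL n →* ATL (n + 1) := { toFun := incl n, map_one' := incl_one, map_mul' := incl_mul }
  have h : (Units.map ι).comp (rep n) = (rep (n + 1)).comp (VB.incl n) := by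
    apply PresentedGroup.ext
    rintro (⟨i, hi⟩ | ⟨i, hi⟩) <;> apply Units.ext <;>
      simp only [MonoidHom.comp_apply, VB.incl, PresentedGroup.toGroup.of, rep, Units.coe_map]
    · change incl n (skein _ (F n i hi)) = skein _ (F (n + 1) i _)
      simp only [skein, map_sub, map_neg, map_smul, incl_F]
      congr 3
      exact incl_one
    · exact incl_w i hi
  exact congrArg Units.val (DFunLike.congr_fun h β)

lemma rho_mapDomain (x : MonoidAlgebra Ra (VB n)) :
    rho (n + 1) (MonoidAlgebra.mapDomain (VB.incl n) x) = incl n (rho n x) := by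
  induction x using MonoidAlgebra.induction_linear with
  | zero => simp only [MonoidAlgebra.mapDomain_zero, map_zero]
  | add x y h h' => simp only [MonoidAlgebra.mapDomain_add, map_add, h, h']
  | single β r => rw [MonoidAlgebra.mapDomain_single, rho_single, rho_single, map_smul, incl_rep]

/-! ### The Markov property -/

lemma F_last (i : ℕ) (hi : i + 1 < n + 1) (h : i + 1 = n) :
    F (n + 1) i hi = hookElt (Fin.castSucc ⟨i, by omega⟩) (Fin.last n) (Fin.castSucc_ne_last _) := by
  subst h
  exact F_eq_hookElt i hi

lemma w_last (i : ℕ) (hi : i + 1 < n + 1) (h : i + 1 = n) :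
    w (n + 1) i hi = perm (Equiv.swap (Fin.castSucc ⟨i, by omega⟩) (Fin.last n)) := by
  subst h
  rfl

lemma trace_incl_mul_F (x : ATL n) (i : ℕ) (hi : i + 1 < n + 1) (h : i + 1 = n) :
    trace (n + 1) (incl n x * F (n + 1) i hi) = trace n x := by
  rw [F_last i hi h, trace_incl_mul_hookElt]

theorem trace_sigma (x : ATL n) (i : ℕ) (hi : i + 1 < n + 1) (h : i + 1 = n) :
    trace (n + 1) (incl n x * skein (Apow (-2)) (F (n + 1) i hi)) = trace n x :=
  trace_mul_skein Apow_neg_two_mul _ (by rw [trace_incl, z_zero']) (trace_incl_mul_F x i hi h)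

theorem trace_sigma_inv (x : ATL n) (i : ℕ) (hi : i + 1 < n + 1) (h : i + 1 = n) :
    trace (n + 1) (incl n x * skein (Apow 2) (F (n + 1) i hi)) = trace n x :=
  trace_mul_skein Apow_two_mul _ (by rw [trace_incl, z_zero]) (trace_incl_mul_F x i hi h)

theorem trace_tau (x : ATL n) (i : ℕ) (hi : i + 1 < n + 1) (h : i + 1 = n) :
    trace (n + 1) (incl n x * w (n + 1) i hi) = trace n x := by
  rw [w_last i hi h, trace_incl_mul_swap]

/-- Conjugation of an element `w` coming from `ATL n` by a skein element. -/
lemma trace_conj {q q' : Ra} (h : q * q' = 1) (hz : z 0 = -q - q') {e : ATL (n + 1)} {w : ATL n}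
    (he : ∀ x : ATL n, trace (n + 1) (incl n x * e) = trace n x)
    (hewe : e * (incl n w * e) = e) (x : ATL n) :
    trace (n + 1) (incl n x * skein q e * incl n w * skein q' e) = trace n x := by
  -- The elements `w e` and `e w` both give the trace of `x * w` or `w * x` on `n` strands;
  -- cyclicity there makes these the same `t`.
  refine trace_skein_conj h (trace (n + 1)) (t := trace n (x * w)) hewe ?_ ?_ ?_ (he x)
  · rw [← incl_mul, trace_incl, hz]
  · rw [← mul_assoc, ← incl_mul, he]
  · rw [← mul_assoc, trace_mul_comm, ← mul_assoc, ← incl_mul, he, trace_mul_comm]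

theorem trace_right (x : ATL n) (i : ℕ) (hi : i + 1 + 1 < n + 1) (h : i + 1 + 1 = n) :
    trace (n + 1) (incl n x * skein (Apow 2) (F (n + 1) (i + 1) hi) * w (n + 1) i (by omega) *
      skein (Apow (-2)) (F (n + 1) (i + 1) hi)) = trace n x := by
  rw [← incl_w i (by omega)]
  refine trace_conj Apow_two_mul z_zero (fun y => trace_incl_mul_F y _ hi h) ?_ x
  rw [incl_w, w_eq_perm, F_eq_hookElt, Equiv.swap_comm]
  apply hookElt_swap_left <;> simp [ne_add_two]

/-- Sliding `w_n w_{n-1}` to the right turns `F_{n-1}` into a hook `e` from the last column, and the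
word becomes a conjugate of `w_{n-1}` by the skein element of `e`. -/
theorem trace_left (x : ATL n) (i : ℕ) (hi : i + 1 + 1 < n + 1) (h : i + 1 + 1 = n) :
    trace (n + 1) (incl n x * w (n + 1) (i + 1) hi * w (n + 1) i (by omega) *
      skein (Apow (-2)) (F (n + 1) i (by omega)) * w (n + 1) (i + 1) hi *
      skein (Apow 2) (F (n + 1) i (by omega)) * w (n + 1) i (by omega) *
      w (n + 1) (i + 1) hi) = trace n x := by
  set a := w (n + 1) (i + 1) hi with ha
  set b := w (n + 1) i (by omega) with hb
  set f := F (n + 1) i (by omega) with hf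
  -- The hook runs backwards, from the last column to column `i` and past column `i + 1`, so it is
  -- not one of the `F_j`.
  obtain ⟨e, he⟩ : ∃ e : ATL (n + 1), e = hookElt (Fin.last n) (Fin.castSucc ⟨i, by omega⟩)
    (Fin.castSucc_ne_last _).symm := ⟨_, rfl⟩
  have haa : a * a = 1 := w_mul_w _ _
  have hbb : b * b = 1 := w_mul_w _ _
  have h1 : a * b * f = e * (a * b) := by
    rw [ha, hb, hf, he, w_eq_perm, w_eq_perm, F_eq_hookElt, perm_mul_perm]
    subst h
    apply perm_mul_hookElt <;> simp [Equiv.swap_apply_def, Fin.ext_iff, ne_add_two]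
  have h2 : a * b * a = b * (a * b) := by
    rw [← mul_assoc]
    exact w_mul_w_mul_w _ _ _ _ (Or.inr rfl)
  have h3 : a * b * (b * a) = 1 := by
    rw [mul_assoc, ← mul_assoc b, hbb, one_mul, haa]
  have key : incl n x * a * b * skein (Apow (-2)) f * a * skein (Apow 2) f * b * a =
      incl n x * skein (Apow (-2)) e * b * skein (Apow 2) e := by
    calc _ = incl n x * (a * b * skein (Apow (-2)) f) * a * skein (Apow 2) f * (b * a) := by
          simp only [mul_assoc]
      _ = incl n x * skein (Apow (-2)) e * (a * b * a) * skein (Apow 2) f * (b * a) := by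
          rw [mul_skein h1]
          simp only [mul_assoc]
      _ = incl n x * skein (Apow (-2)) e * b * (a * b * skein (Apow 2) f) * (b * a) := by
          rw [h2]
          simp only [mul_assoc]
      _ = incl n x * skein (Apow (-2)) e * b * skein (Apow 2) e * (a * b * (b * a)) := by
          rw [mul_skein h1]
          simp only [mul_assoc]
      _ = _ := by rw [h3, mul_one]
  rw [key, hb, ← incl_w i (by omega)]
  refine trace_conj Apow_neg_two_mul z_zero' (fun y => ?_) ?_ x
  · rw [he, trace_incl_mul_hookElt']
  · rw [incl_w, w_eq_perm, he]
    subst h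
    apply hookElt_swap_right <;> simp [Fin.ext_iff]

/-! ### Tower, compatibility and Markov trace. -/

theorem isTower : IsTower incl where
  isAlgebra n _ := isAlgebra n
  isAlgebraHom _ _ := ⟨incl_one, incl_mul⟩
  injective n _ := incl_injective n

theorem isCompatible : IsCompatible incl rho where
  isAlgebraHom _ _ := ⟨rho_one, rho_mul⟩
  restrict _ _ := rho_mapDomain

lemma img_sigma (i : ℕ) (h : i + 1 < n) :
    img rho (VB.σ n i h) = skein (Apow (-2)) (F n i h) := by
  rw [img_rho, rep_sigma]
  rfl

lemma img_sigma_inv (i : ℕ) (h : i + 1 < n) :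
    img rho (VB.σ n i h)⁻¹ = skein (Apow 2) (F n i h) := by
  rw [img_rho, map_inv, rep_sigma]
  rfl

lemma img_tau (i : ℕ) (h : i + 1 < n) : img rho (VB.τ n i h) = w n i h := by
  rw [img_rho, rep_tau]
  rfl

theorem isMarkovTrace : IsMarkovTrace incl rho trace where
  cyclic _ _ := trace_mul_comm
  sigma n hn x := by
    rw [img_sigma]
    exact (trace_sigma x _ _ (by omega)).symm
  sigma_inv n hn x := by
    rw [img_sigma_inv]
    exact (trace_sigma_inv x _ _ (by omega)).symm
  tau n hn x := by
    rw [img_tau]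
    exact (trace_tau x _ _ (by omega)).symm
  right n hn x := by
    -- With `n + 2` strands in place of `n`, the truncated indices `n - 1` and `n - 2` reduce to `n
    -- + 1` and `n`.
    obtain ⟨n, rfl⟩ := Nat.exists_eq_add_of_le' hn
    rw [img_sigma, img_sigma_inv, img_tau]
    exact (trace_right x n (by omega) rfl).symm
  left n hn x := by
    obtain ⟨n, rfl⟩ := Nat.exists_eq_add_of_le' hn
    rw [img_sigma, img_sigma_inv, img_tau, img_tau]
    exact (trace_left x n (by omega) rfl).symm

end ATL

end ArrowTL

end

theorem theorem3p5 :
    ArrowTL.IsTower ArrowTL.ATL.incl ∧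
    ∃ ρ : ∀ n, MonoidAlgebra ArrowTL.Ra (ArrowTL.VB n) →ₗ[ArrowTL.Ra] ArrowTL.ATL n,
      ArrowTL.IsCompatible ArrowTL.ATL.incl ρ ∧
      (∀ (n i : ℕ) (h : i + 1 < n),
        ArrowTL.img ρ (ArrowTL.VB.σ n i h) =
          -(ArrowTL.Apow (-2) • 1) - ArrowTL.Apow (-4) • ArrowTL.ATL.F n i h ∧
        ArrowTL.img ρ (ArrowTL.VB.τ n i h) = ArrowTL.ATL.w n i h) ∧
      ArrowTL.IsMarkovTrace ArrowTL.ATL.incl ρ ArrowTL.ATL.trace := by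
  refine ⟨ArrowTL.ATL.isTower, ArrowTL.ATL.rho, ArrowTL.ATL.isCompatible,
    fun n i h => ⟨?_, ArrowTL.ATL.img_tau i h⟩, ArrowTL.ATL.isMarkovTrace⟩
  -- The skein element is written with `q ^ 2`, where `q = A⁻²`.
  rw [show ArrowTL.Apow (-4) = ArrowTL.Apow (-2) ^ 2 by rw [ArrowTL.Apow_sq]; norm_num]
  exact ArrowTL.ATL.img_sigma i h
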